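/- Let $\rho\in C^\infty(\mathbb R^d\setminus\{0\})$ be a homogeneous distance function of degree $\beta>0$, i.e. $\rho(\xi)>0$ and $\rho(t^{1/\beta}\xi)=t\rho(\xi)$ for all $\xi\ne0$ and $t>0$. Write $\widehat f(\xi)=\int f(x)e^{-i\langle x,\xi\rangle}\,dx$ and let $\mathcal F^{-1}$ be the inverse transform. For $l\in\mathbb Z$ put $\mathfrak A_l=\{x\in\mathbb R^d:2^l\le|x|<2^{l+1}\}$. The homogeneous Herz space $\dot{\mathscr K}^{\gamma,2}_q$ consists of the measurable functions $f$ on $\mathbb R^d$ for which $$\|f\|_{\dot{\mathscr K}^{\gamma,2}_q}=\Big(\sum_{l\in\mathbb Z}2^{l\gamma q}\|f\|_{L^2(\mathfrak A_l)}^q\Big)^{1/q}$$ is finite (with a supremum over $l$ if $q=\infty$). Fix $\zeta_0\in C^\infty(\mathbb R)$, supported in $(-1,1)$ and equal to $1$ on $[-\frac12,\frac12]$, let $\zeta_j(r)=\zeta_0(2^{-j}r)-\zeta_0(2^{-j+1}r)$ for $j\ge1$ and $V_jh=\mathcal F^{-1}[\zeta_j\widehat h\,]$ for functions $h$ on $\mathbb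 R$. For $\alpha>0$ the Besov space $B^2_{\alpha,s}(\mathbb R)$ consists of the $h\in L^2(\mathbb R)$ for which $$\|h\|_{B^2_{\alpha,s}}=\Big(\sum_{j\ge0}\big[2^{j\alpha}\|V_jh\|_{L^2(\mathbb R)}\big]^s\Big)^{1/s}$$ is finite (with a supremum over $j$ if $s=\infty$). **Theorem.** Let $\frac12<\alpha<\frac d2$, $1\le q\le\infty$ and $s=\frac q{q-1}$ (so $s=\infty$ if $q=1$ and $s=1$ if $q=\infty$). There is a constant $C$, depending only on $d$, $\rho$ (and its degree $\beta$), $\zeta_0$, $\alpha$, $q$, such that the following holds for all $h\in B^2_{\alpha,s}(\mathbb R)$ supported in $(\frac12,2)$ and all $f\in\dot{\mathscr K}^{-\alpha,2}_q$. For all $t>0$ and $x\in\mathbb R^d$ the convolution integral $$\mathcal F^{-1}\big[h(\tfrac{\rho(\cdot)}t)\widehat f\,\big](x)=\int_{\mathbb R^d}\mathcal F^{-1}\big[h(\tfrac{\rho(\cdot)}t)\big](x-y)\,f(y)\,dy$$ converges absolutely, the maximal function $\sup_{t>0}\big|\mathcal F^{-1}[h(\tfrac{\rho(\cdot)}t)\widehat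 f\,]\big|$ is measurable, and it satisfies: (i) if $2\le q\le\infty$, then $$\Big\|\sup_{t>0}\big|\mathcal F^{-1}[h(\tfrac{\rho(\cdot)}t)\widehat f\,]\big|\Big\|_{\dot{\mathscr K}^{-\alpha,2}_q}\le C\,\|h\|_{B^2_{\alpha,s}}\|f\|_{\dot{\mathscr K}^{-\alpha,2}_q};$$ (ii) if $1\le q\le2$, then $$\Big\|\sup_{t>0}\big|\mathcal F^{-1}[h(\tfrac{\rho(\cdot)}t)\widehat f\,]\big|\Big\|_{\dot{\mathscr K}^{-\alpha,2}_2}\le C\,\|h\|_{B^2_{\alpha,s}}\|f\|_{\dot{\mathscr K}^{-\alpha,2}_q}.$$ -/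

import Mathlib

open MeasureTheory Set
open scoped ENNReal NNReal FourierTransform

section Multipliers

variable {E : Type*} [NormedAddCommGroup E] [InnerProductSpace ℝ E] [FiniteDimensional ℝ E]
  [MeasurableSpace E] [BorelSpace E]

/-- The kernel `K(x) = (2π)^{-dim E} ∫ m(ξ) e^{i⟨x, ξ⟩} dξ` of the Fourier multiplier `m`.
Mathlib's `𝓕⁻` has the phase `e^{2πi⟨x, ξ⟩}`, so `ξ` is replaced by `2πξ`. -/
noncomputable def multiplierKernel (m : E → ℂ) : E → ℂ :=
  𝓕⁻ (fun ξ : E => m ((2 * Real.pi) • ξ))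

/-- The function `F⁻¹[m f̂]`, where `f̂(ξ) = ∫ f(x) e^{-i⟨x, ξ⟩} dx`, as the convolution of `f` with
the kernel `F⁻¹[m]`. This form makes sense whenever the integral converges absolutely, also when
`f̂` is only a distribution; see `fourierMultiplier_eq_fourierInv` for integrable `m` and `f`. -/
noncomputable def fourierMultiplier (m f : E → ℂ) (x : E) : ℂ :=
  ∫ y, multiplierKernel m (x - y) * f y

/-- For integrable `m` and `f`, `fourierMultiplier m f` is the inverse Fourier transform of the
product of `m` and the Fourier transform of `f`. -/
theorem fourierMultiplier_eq_fourierInv {m f : E → ℂ} (hm : Integrable m) (hf : Integrable f)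
    (x : E) :
    fourierMultiplier m f x = 𝓕⁻ (fun ξ : E => m ((2 * Real.pi) • ξ) * 𝓕 f ξ) x := by
  have hm2 : Integrable (fun ξ : E => m ((2 * Real.pi) • ξ)) :=
    hm.comp_smul (by positivity)
  have hg : Integrable (fun ξ : E => Real.fourierChar (inner ℝ ξ x) • m ((2 * Real.pi) • ξ)) := by
    have hc : AEStronglyMeasurable (fun ξ : E => (Real.fourierChar (inner ℝ ξ x) : ℂ)) volume := by
      have : Continuous (fun ξ : E => (Real.fourierChar (inner ℝ ξ x) : ℂ)) := by
        have := Real.continuous_fourierChar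
        fun_prop
      exact this.aestronglyMeasurable
    refine hm2.mono (hc.mul hm2.aestronglyMeasurable) (Filter.Eventually.of_forall fun ξ => ?_)
    simp [Circle.norm_smul]
  have hk : ∀ y : E, multiplierKernel m (x - y) =
      𝓕 (fun ξ : E => Real.fourierChar (inner ℝ ξ x) • m ((2 * Real.pi) • ξ)) y := by
    intro y
    rw [multiplierKernel, Real.fourierInv_eq, Real.fourier_eq]
    congr 1
    ext ξ
    rw [← mul_smul, ← AddChar.map_add_eq_mul, inner_sub_right]
    congr 2
    ring
  have hflip := VectorFourier.integral_fourierIntegral_smul_eq_flip (μ := volume) (ν := volume) (L := innerₗ E)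
    Real.continuous_fourierChar continuous_inner hg hf
  simp only [smul_eq_mul, flip_innerₗ] at hflip
  simp only [fourierMultiplier, hk]
  refine hflip.trans ?_
  rw [Real.fourierInv_eq]
  congr 1
  ext ξ
  simp only [Circle.smul_def, smul_eq_mul, mul_assoc]
  rfl

end Multipliers

section Herz

variable {d : ℕ} {ε : Type*} [TopologicalSpace ε] [ContinuousENorm ε]

/-- The dyadic annulus `{x : 2^l ≤ |x| < 2^(l+1)}` in `ℝ^d`. -/
def dyadicAnnulus (d : ℕ) (l : ℤ) : Set (EuclideanSpace ℝ (Fin d)) :=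
  {x | (2 : ℝ) ^ l ≤ ‖x‖ ∧ ‖x‖ < (2 : ℝ) ^ (l + 1)}

/-- The norm of the homogeneous Herz space `K̇^{γ,r}_q(ℝ^d)`: the `ℓ^q(ℤ)` norm of the sequence
`l ↦ 2^{lγ} ‖f‖_{L^r(A_l)}`, where `A_l` is the `l`-th dyadic annulus. -/
noncomputable def herzNorm (γ : ℝ) (r q : ℝ≥0∞) (f : EuclideanSpace ℝ (Fin d) → ε) : ℝ≥0∞ :=
  eLpNorm (fun l : ℤ => (2 : ℝ≥0∞) ^ ((l : ℝ) * γ) *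
    eLpNorm f r (volume.restrict (dyadicAnnulus d l))) q Measure.count

/-- Membership in the homogeneous Herz space `K̇^{γ,r}_q(ℝ^d)`. -/
def MemHerz (γ : ℝ) (r q : ℝ≥0∞) (f : EuclideanSpace ℝ (Fin d) → ε) : Prop :=
  AEStronglyMeasurable f volume ∧ herzNorm γ r q f < ∞

end Herz

section Besov

/-- A smooth function on `ℝ` that is supported in `(-1, 1)` and equal to `1` on `[-1/2, 1/2]`. -/
structure IsDyadicCutoff (ζ : ℝ → ℝ) : Prop where
  smooth : ContDiff ℝ (⊤ : ℕ∞) ζ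
  support_subset : Function.support ζ ⊆ Ioo (-1) 1
  eq_one : ∀ r : ℝ, |r| ≤ 1 / 2 → ζ r = 1

/-- The inhomogeneous dyadic partition of unity generated by a cutoff `ζ`: `ζ_0 = ζ`, and
`ζ_j(r) = ζ(2^{-j} r) - ζ(2^{-j+1} r)` for `j ≥ 1`. -/
noncomputable def dyadicPiece (ζ : ℝ → ℝ) : ℕ → ℝ → ℝ
  | 0, r => ζ r
  | j + 1, r => ζ (r / 2 ^ (j + 1)) - ζ (r / 2 ^ j)

/-- The Littlewood-Paley piece `V_j h = F⁻¹[ζ_j ĥ]` of a function `h` on `ℝ`. -/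
noncomputable def littlewoodPaley (ζ : ℝ → ℝ) (j : ℕ) (h : ℝ → ℂ) : ℝ → ℂ :=
  fourierMultiplier (fun r : ℝ => (dyadicPiece ζ j r : ℂ)) h

/-- The norm of the Besov space `B^2_{α,s}(ℝ)`: the `ℓ^s` norm of the sequence
`j ↦ 2^{jα} ‖V_j h‖_{L^2(ℝ)}`. -/
noncomputable def besovNorm (ζ : ℝ → ℝ) (α : ℝ) (s : ℝ≥0∞) (h : ℝ → ℂ) : ℝ≥0∞ :=
  eLpNorm (fun j : ℕ => (2 : ℝ≥0∞) ^ ((j : ℝ) * α) *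
    eLpNorm (littlewoodPaley ζ j h) 2 volume) s Measure.count

/-- Membership in the Besov space `B^2_{α,s}(ℝ)` for `α > 0`, all of whose elements are
`L^2` functions. -/
def MemBesov (ζ : ℝ → ℝ) (α : ℝ) (s : ℝ≥0∞) (h : ℝ → ℂ) : Prop :=
  MemLp h 2 volume ∧ besovNorm ζ α s h < ∞

end Besov

section Maximal

variable {d : ℕ}

/-- A homogeneous distance function of degree `β > 0` on `ℝ^d`: smooth and positive away from the
origin, with `ρ(t^{1/β} ξ) = t ρ(ξ)` for `t > 0`. The value at the origin plays no role. -/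
structure IsHomogeneousDistance (ρ : EuclideanSpace ℝ (Fin d) → ℝ) (β : ℝ) : Prop where
  degree_pos : 0 < β
  smooth : ContDiffOn ℝ (⊤ : ℕ∞) ρ {0}ᶜ
  pos : ∀ ξ, ξ ≠ 0 → 0 < ρ ξ
  homogeneous : ∀ t : ℝ, 0 < t → ∀ ξ, ξ ≠ 0 → ρ (t ^ (1 / β) • ξ) = t * ρ ξ

/-- The dilated quasiradial multiplier `ξ ↦ h(ρ(ξ)/t)`. -/
noncomputable def quasiradial (ρ : EuclideanSpace ℝ (Fin d) → ℝ) (h : ℝ → ℂ) (t : ℝ) :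
    EuclideanSpace ℝ (Fin d) → ℂ :=
  fun ξ => h (ρ ξ / t)

/-- The maximal function `sup_{t > 0} |F⁻¹[h(ρ(·)/t) f̂](x)|`, with values in `[0, ∞]`. -/
noncomputable def maximalFunction (ρ : EuclideanSpace ℝ (Fin d) → ℝ) (h : ℝ → ℂ)
    (f : EuclideanSpace ℝ (Fin d) → ℂ) (x : EuclideanSpace ℝ (Fin d)) : ℝ≥0∞ :=
  ⨆ t : Ioi (0 : ℝ), ‖fourierMultiplier (quasiradial ρ h t) f x‖ₑ

end Maximal

/-!
# A maximal theorem for quasiradial multipliers on Herz spaces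

Fourier inversion of `h` in one variable writes the multiplier operator as a superposition
`∫ 𝓕 h τ · U (τ / t) dτ` of the propagators `U τ` with symbol `e^{2πi τ ρ(2πξ)}`
(`IsFrequencyCutoff.fourierMultiplier_eq_integral`; the propagator is `waveEvolution`). As long as
`t` stays in the block `[1, 2^β]`, all multipliers live in a fixed annulus in frequency, and a
Littlewood-Paley decomposition of `𝓕 h` together with the Cauchy-Schwarz inequality in `τ` bounds
the supremum over `t` by `∑_j ‖V_j h‖₂ · (∫_{|τ| ≤ 2^j} |U τ g(x)|² dτ)^{1/2}`. The supremum has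
disappeared, and `L²` bounds for the energy of the propagator suffice. There are three:

* conservation of the `L²` norm, `lintegral_waveEvolution_sq`, which costs `2^{j/2}`;
* local smoothing at a point and on balls of radius `M ≥ 1`, with operator norms `O(1)` and
  `O(M^{1/2})` that do not depend on `j`:
  `IsHomogeneousDistance.exists_lintegral_waveEvolution_sq_le` and
  `IsHomogeneousDistance.exists_lintegral_ball_waveEvolution_sq_le`. With Gaussian weights in place
  of sharp cutoffs, expanding the square reduces them to Schur's test for an explicit positive
  kernel which concentrates near the level sets of `ρ`. Its mass is computed by averaging over
  small dilations, which move the level sets transversally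
  (`IsHomogeneousDistance.lintegral_annulus_mul_comp_le`); no polar coordinates are needed;
* finite speed of propagation, up to rapidly decaying tails, from nonstationary phase
  (`IsHomogeneousDistance.exists_norm_waveEvolution_cutoff_le`).

For `g` supported in the annulus `2^n ≤ |x| < 2^{n+1}` this gives, on the annulus
`2^m ≤ |x| < 2^{m+1}`, the bounds of `IsFrequencyCutoff.exists_singleScale_le`. If `n ≤ m + 1` the norm is
`O(‖h‖_{B^2_{1/2,1}})`. If `n ≥ m + 2`, the distance between the two annuli is comparable to `2^n`,
so that only the frequencies with `2^j ≳ 2^n` contribute to the main term, and local smoothing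
gains the factor `2^{m/2}` (or `2^{md/2}` for `m < 0`) relative to `∑_{2^j ≳ 2^n} ‖V_j h‖₂`. After
multiplication by the weights `2^{-mα}` and `2^{nα}`, the former is summable over `m` precisely
because `1/2 < α < d/2`, and the latter is in `ℓ^s` with norm at most `C ‖h‖_{B^2_{α,s}}`.

By homogeneity the block `2^{kβ} ≤ t ≤ 2^{(k+1)β}` is the `2^k`-dilate of the block `1 ≤ t ≤ 2^β`,
and it involves only the frequencies `|ξ| ~ 2^k` of `f`. The supremum over `k` is bounded by the
square function, and Plancherel's theorem makes these frequency localizations almost orthogonal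
(`IsFrequencyCutoff.exists_seqNorm_localizedFourier_le`). What remains is an inequality for
sequences indexed by `k`, `m` and `n`, `seqNorm_seqNorm_two_le`. It follows from Young's, Hölder's
and Minkowski's inequalities whenever the exponent `p` of the target space satisfies `p ≥ q` and
`p ≥ 2`; the choices `p = q` and `p = 2` give the two parts of the theorem.

The bounds for a single block are uniform on compact sets and summable over the annuli on which `f`
is decomposed. This yields absolute convergence and continuity in `x` of the convolution integrals
(`IsHomogeneousDistance.fourierMultiplier_annularPiece`), and the maximal function is measurable as
a supremum of continuous functions.
-/

open scoped SchwartzMap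

/-! ### The Fourier transform on `L¹ ∩ L²` -/

section FourierL2

variable {V : Type*} [NormedAddCommGroup V] [InnerProductSpace ℝ V] [FiniteDimensional ℝ V]
  [MeasurableSpace V] [BorelSpace V]

/-- Locally integrable functions are determined by their pairings with Schwartz functions. -/
theorem ae_eq_of_integral_schwartz_mul_eq {f g : V → ℂ} (hf : LocallyIntegrable f)
    (hg : LocallyIntegrable g) (h : ∀ φ : 𝓢(V, ℂ), ∫ x, φ x * f x = ∫ x, φ x * g x) :
    f =ᵐ[volume] g := by
  refine ae_eq_of_integral_contDiff_smul_eq hf hg fun u hu huc => ?_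
  have hu' : ContDiff ℝ (⊤ : ℕ∞) (fun x => (u x : ℂ)) := Complex.ofRealCLM.contDiff.comp hu
  have huc' : HasCompactSupport (fun x => (u x : ℂ)) := huc.comp_left (g := ((↑) : ℝ → ℂ)) rfl
  simpa [Complex.real_smul] using h (huc'.toSchwartzMap hu')

theorem integral_mul_fourier_eq {f g : V → ℂ} (hf : Integrable f) (hg : Integrable g) :
    ∫ x, f x * 𝓕 g x = ∫ x, 𝓕 f x * g x := by
  have := VectorFourier.integral_fourierIntegral_smul_eq_flip (μ := volume) (ν := volume)
    (L := innerₗ V) Real.continuous_fourierChar continuous_inner hf hg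
  simp only [smul_eq_mul, flip_innerₗ] at this
  exact this.symm

theorem continuous_fourier_of_integrable {f : V → ℂ} (hf : Integrable f) :
    Continuous (𝓕 f) :=
  VectorFourier.fourierIntegral_continuous Real.continuous_fourierChar continuous_inner hf

theorem continuous_fourierInv_of_integrable {f : V → ℂ} (hf : Integrable f) :
    Continuous (𝓕⁻ f) := by
  have : 𝓕⁻ f = fun x => 𝓕 f (-x) := by ext x; exact Real.fourierInv_eq_fourier_neg f x
  rw [this]
  exact (continuous_fourier_of_integrable hf).comp continuous_neg

/-- Plancherel's theorem for the Fourier integral on `L¹ ∩ L²`. -/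
theorem eLpNorm_fourier_two {f : V → ℂ} (h1 : Integrable f) (h2 : MemLp f 2) :
    eLpNorm (𝓕 f) 2 volume = eLpNorm f 2 volume := by
  have hae : 𝓕 f =ᵐ[volume] (𝓕 (h2.toLp f) : Lp ℂ 2 (volume : Measure V)) := by
    refine ae_eq_of_integral_schwartz_mul_eq
      (continuous_fourier_of_integrable h1).locallyIntegrable
      ((Lp.memLp (𝓕 (h2.toLp f) : Lp ℂ 2 (volume : Measure V))).locallyIntegrable one_le_two)
      fun φ => ?_
    have h := congrArg (fun T : 𝓢'(V, ℂ) => T φ) (Lp.fourier_toTemperedDistribution_eq (h2.toLp f))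
    simp only [TemperedDistribution.fourier_apply, Lp.toTemperedDistribution_apply,
      smul_eq_mul] at h
    rw [← h, integral_mul_fourier_eq φ.integrable h1, SchwartzMap.fourier_coe]
    refine integral_congr_ae ?_
    filter_upwards [h2.coeFn_toLp] with x hx
    rw [hx]
  rw [eLpNorm_congr_ae hae, ← eLpNorm_congr_ae h2.coeFn_toLp]
  have := Lp.norm_fourier_eq (h2.toLp f)
  rw [Lp.norm_def, Lp.norm_def, ENNReal.toReal_eq_toReal_iff' (Lp.eLpNorm_ne_top _)
    (Lp.eLpNorm_ne_top _)] at this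
  exact this

theorem eLpNorm_fourierInv_two {f : V → ℂ} (h1 : Integrable f) (h2 : MemLp f 2) :
    eLpNorm (𝓕⁻ f) 2 volume = eLpNorm f 2 volume := by
  have : 𝓕⁻ f = 𝓕 f ∘ (fun x => -x) := by ext x; exact Real.fourierInv_eq_fourier_neg f x
  rw [this, eLpNorm_comp_measurePreserving
    (continuous_fourier_of_integrable h1).aestronglyMeasurable
    (Measure.measurePreserving_neg volume), eLpNorm_fourier_two h1 h2]

/-- Fourier inversion almost everywhere, for an integrable function with integrable Fourier
transform. -/
theorem fourierInv_fourier_ae_eq {f : V → ℂ} (hf : Integrable f) (hf' : Integrable (𝓕 f)) :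
    𝓕⁻ (𝓕 f) =ᵐ[volume] f := by
  refine ae_eq_of_integral_schwartz_mul_eq
    (continuous_fourierInv_of_integrable hf').locallyIntegrable
    hf.locallyIntegrable fun φ => ?_
  have e : (φ : V → ℂ) = 𝓕 ((𝓕⁻ φ : 𝓢(V, ℂ)) : V → ℂ) := by
    rw [← SchwartzMap.fourier_coe]; simp
  have e2 : ∀ g : V → ℂ, Integrable g → ∫ x, φ x * 𝓕⁻ g x = ∫ x, (𝓕⁻ φ : 𝓢(V, ℂ)) x * g x := by
    intro g hg
    have h3 := integral_mul_fourier_eq φ.integrable hg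
    have h4 := integral_neg_eq_self (fun x => φ x * 𝓕 g (-x)) volume
    have h5 := integral_mul_fourier_eq (f := fun x => φ (-x)) φ.integrable.comp_neg hg
    simp only [neg_neg] at h4
    simp only [Real.fourierInv_eq_fourier_neg]
    rw [← h4, h5]
    congr 1; ext x
    congr 1
    rw [SchwartzMap.fourierInv_coe, Real.fourierInv_eq_fourier_comp_neg]
  rw [e2 _ hf', integral_mul_fourier_eq (𝓕⁻ φ : 𝓢(V, ℂ)).integrable hf, ← e]

end FourierL2

/-! ### Norms of sequences of extended nonnegative reals -/

section SequenceNorms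

theorem eLpNorm_tsum_le {X ι : Type*} [MeasurableSpace X] {μ : Measure X} [Countable ι]
    {F : ι → X → ℝ≥0∞} (hF : ∀ i, AEMeasurable (F i) μ) {p : ℝ≥0∞} (hp : 1 ≤ p) :
    eLpNorm (fun x => ∑' i, F i x) p μ ≤ ∑' i, eLpNorm (F i) p μ := by
  have hfin : ∀ s : Finset ι,
      eLpNorm (fun x => ∑ i ∈ s, F i x) p μ ≤ ∑ i ∈ s, eLpNorm (F i) p μ := by
    intro s
    induction s using Finset.cons_induction with
    | empty => simp
    | cons i s hi ih =>
      simp only [Finset.sum_cons]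
      refine (eLpNorm_add_le (hF i).aestronglyMeasurable
        (Finset.aemeasurable_fun_sum s fun i _ => hF i).aestronglyMeasurable hp).trans ?_
      gcongr
  have hp0 : p ≠ 0 := (zero_lt_one.trans_le hp).ne'
  rcases eq_or_ne p ∞ with rfl | hpt
  · simp only [eLpNorm_exponent_top, eLpNormEssSup, enorm_eq_self]
    refine essSup_le_of_ae_le _ ?_
    filter_upwards [ae_all_iff.2 fun i => ENNReal.ae_le_essSup (μ := μ) (F i)] with x hx
    exact ENNReal.tsum_le_tsum hx
  · have hp' : 0 < p.toReal := ENNReal.toReal_pos hp0 hpt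
    simp only [eLpNorm_eq_lintegral_rpow_enorm_toReal hp0 hpt, enorm_eq_self] at hfin ⊢
    have hmono : Monotone fun s : Finset ι => fun x => (∑ i ∈ s, F i x) ^ p.toReal := by
      intro s t hst x
      exact ENNReal.rpow_le_rpow (Finset.sum_le_sum_of_subset hst) hp'.le
    have hsup : ∀ x, (∑' i, F i x) ^ p.toReal = ⨆ s : Finset ι, (∑ i ∈ s, F i x) ^ p.toReal := by
      intro x
      rw [ENNReal.tsum_eq_iSup_sum]
      exact (ENNReal.orderIsoRpow p.toReal hp').map_iSup _
    simp only [hsup]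
    rw [lintegral_iSup_directed (fun s => ?_) hmono.directed_le]
    · rw [← ENNReal.rpow_le_rpow_iff hp', ← ENNReal.rpow_mul, one_div_mul_cancel hp'.ne',
        ENNReal.rpow_one]
      refine iSup_le fun s => ?_
      rw [← ENNReal.rpow_inv_le_iff hp', ← one_div]
      exact (hfin s).trans (ENNReal.sum_le_tsum s)
    · exact (Finset.aemeasurable_fun_sum s fun i _ => hF i).pow_const _

variable {ι κ : Type*}

/-- The `ℓ^p` norm of a family of extended nonnegative reals. -/
noncomputable def seqNorm [MeasurableSpace ι] (p : ℝ≥0∞) (u : ι → ℝ≥0∞) : ℝ≥0∞ :=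
  eLpNorm u p Measure.count

theorem seqNorm_mono [MeasurableSpace ι] {p : ℝ≥0∞} {u v : ι → ℝ≥0∞} (h : ∀ i, u i ≤ v i) :
    seqNorm p u ≤ seqNorm p v :=
  eLpNorm_mono_enorm (by simpa using h)

variable [MeasurableSpace ι] [MeasurableSpace κ] [MeasurableSingletonClass ι]
  [MeasurableSingletonClass κ]

theorem seqNorm_top (u : ι → ℝ≥0∞) : seqNorm ∞ u = ⨆ i, u i := by
  simp [seqNorm]

theorem seqNorm_eq [Countable ι] {p : ℝ≥0∞} (h0 : p ≠ 0) (ht : p ≠ ∞) (u : ι → ℝ≥0∞) :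
    seqNorm p u = (∑' i, u i ^ p.toReal) ^ (1 / p.toReal) := by
  rw [seqNorm, eLpNorm_eq_lintegral_rpow_enorm_toReal h0 ht, lintegral_count]
  simp

theorem seqNorm_one [Countable ι] (u : ι → ℝ≥0∞) : seqNorm 1 u = ∑' i, u i := by
  simp [seqNorm_eq]

theorem le_seqNorm {p : ℝ≥0∞} (h0 : p ≠ 0) (u : ι → ℝ≥0∞) (i : ι) : u i ≤ seqNorm p u := by
  simpa [seqNorm] using enorm_le_eLpNorm_count u i h0

theorem seqNorm_tsum_le {κ : Type*} [Countable ι] [Countable κ] {p : ℝ≥0∞} (hp : 1 ≤ p)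
    (F : κ → ι → ℝ≥0∞) :
    seqNorm p (fun i => ∑' k, F k i) ≤ ∑' k, seqNorm p (F k) :=
  eLpNorm_tsum_le (fun _ => (measurable_of_countable _).aemeasurable) hp

theorem seqNorm_add_le [Countable ι] {p : ℝ≥0∞} (hp : 1 ≤ p) (u v : ι → ℝ≥0∞) :
    seqNorm p (fun i => u i + v i) ≤ seqNorm p u + seqNorm p v :=
  eLpNorm_add_le (measurable_of_countable _).aestronglyMeasurable
    (measurable_of_countable _).aestronglyMeasurable hp

theorem seqNorm_const_mul [Countable ι] (p : ℝ≥0∞) (c : ℝ≥0∞) (u : ι → ℝ≥0∞) :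
    seqNorm p (fun i => c * u i) = c * seqNorm p u := by
  rcases eq_or_ne p 0 with rfl | h0
  · simp [seqNorm]
  rcases eq_or_ne p ∞ with rfl | ht
  · simp [seqNorm_top, ENNReal.mul_iSup]
  · have hp := ENNReal.toReal_pos h0 ht
    simp only [seqNorm_eq h0 ht, ENNReal.mul_rpow_of_nonneg _ _ hp.le, ENNReal.tsum_mul_left]
    rw [ENNReal.mul_rpow_of_nonneg _ _ (by positivity), ← ENNReal.rpow_mul,
      mul_one_div_cancel hp.ne', ENNReal.rpow_one]

theorem seqNorm_comp_equiv [Countable ι] [Countable κ] (p : ℝ≥0∞) (e : ι ≃ κ) (u : κ → ℝ≥0∞) :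
    seqNorm p (fun i => u (e i)) = seqNorm p u := by
  rcases eq_or_ne p 0 with rfl | h0
  · simp [seqNorm]
  rcases eq_or_ne p ∞ with rfl | ht
  · simp only [seqNorm_top]; exact e.surjective.iSup_comp u
  · simp only [seqNorm_eq h0 ht]
    rw [e.tsum_eq (fun k => u k ^ p.toReal)]

/-- The `ℓ^p` norms decrease in `p`. -/
theorem seqNorm_antitone [Countable ι] {p r : ℝ≥0∞} (h0 : p ≠ 0) (hpr : p ≤ r) (u : ι → ℝ≥0∞) :
    seqNorm r u ≤ seqNorm p u := by
  have hr0 : r ≠ 0 := (h0.bot_lt.trans_le hpr).ne'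
  rcases eq_or_ne r ∞ with rfl | hrt
  · rw [seqNorm_top]; exact iSup_le fun i => le_seqNorm h0 u i
  have hpt : p ≠ ∞ := ne_top_of_le_ne_top hrt hpr
  have hp := ENNReal.toReal_pos h0 hpt
  have hr := ENNReal.toReal_pos hr0 hrt
  have hpr' : p.toReal ≤ r.toReal := ENNReal.toReal_mono hrt hpr
  rw [seqNorm_eq hr0 hrt, one_div, ENNReal.rpow_inv_le_iff hr]
  -- `u_i^r ≤ ‖u‖_p^{r-p} u_i^p`
  have key : ∀ i, u i ^ r.toReal ≤ seqNorm p u ^ (r.toReal - p.toReal) * u i ^ p.toReal := by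
    intro i
    have : u i ^ r.toReal = u i ^ (r.toReal - p.toReal) * u i ^ p.toReal := by
      rw [← ENNReal.rpow_add_of_nonneg _ _ (sub_nonneg.2 hpr') hp.le, sub_add_cancel]
    rw [this]
    gcongr
    exact le_seqNorm h0 u i
  refine (ENNReal.tsum_le_tsum key).trans ?_
  rw [ENNReal.tsum_mul_left]
  have : ∑' i, u i ^ p.toReal = seqNorm p u ^ p.toReal := by
    rw [seqNorm_eq h0 hpt, ← ENNReal.rpow_mul, one_div_mul_cancel hp.ne', ENNReal.rpow_one]
  rw [this, ← ENNReal.rpow_add_of_nonneg _ _ (sub_nonneg.2 hpr') hp.le, sub_add_cancel]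

/-- Hölder's inequality for sequences. -/
theorem tsum_mul_le_seqNorm_mul [Countable ι] {q s : ℝ≥0∞} (hqs : q⁻¹ + s⁻¹ = 1)
    (u v : ι → ℝ≥0∞) : ∑' i, u i * v i ≤ seqNorm s u * seqNorm q v := by
  have htop : ∀ u v : ι → ℝ≥0∞, ∑' i, u i * v i ≤ seqNorm ∞ u * seqNorm 1 v := by
    intro u v
    rw [seqNorm_one, ← ENNReal.tsum_mul_left]
    exact ENNReal.tsum_le_tsum fun i => by gcongr; exact le_seqNorm (by simp) u i
  rcases eq_or_ne q ∞ with rfl | hq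
  · have : s = 1 := by simpa using hqs
    subst this
    simpa [mul_comm] using htop v u
  rcases eq_or_ne s ∞ with rfl | hs
  · have : q = 1 := by simpa using hqs
    subst this
    exact htop u v
  have hq1 : 1 ≤ q := by
    rw [← ENNReal.inv_le_one, ← hqs]; exact le_self_add
  have hs1 : 1 ≤ s := by
    rw [← ENNReal.inv_le_one, ← hqs]; exact le_add_self
  have hq0 : q ≠ 0 := (zero_lt_one.trans_le hq1).ne'
  have hs0 : s ≠ 0 := (zero_lt_one.trans_le hs1).ne'
  have hconj : s.toReal.HolderConjugate q.toReal := by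
    have h := congrArg ENNReal.toReal hqs
    rw [ENNReal.toReal_add (by simpa using hq0) (by simpa using hs0)] at h
    simp only [ENNReal.toReal_inv, ENNReal.toReal_one] at h
    refine ⟨?_, ENNReal.toReal_pos hs0 hs, ENNReal.toReal_pos hq0 hq⟩
    rw [inv_one]; linarith
  have := ENNReal.lintegral_mul_le_Lp_mul_Lq (μ := (Measure.count : Measure ι)) hconj
    (f := u) (g := v) (measurable_of_countable _).aemeasurable
    (measurable_of_countable _).aemeasurable
  simpa [lintegral_count, seqNorm_eq hs0 hs, seqNorm_eq hq0 hq] using this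

/-- Young's inequality `ℓ¹ * ℓ^p ⊆ ℓ^p` on `ℤ`. -/
theorem seqNorm_convolution_le {p : ℝ≥0∞} (hp : 1 ≤ p) (w u : ℤ → ℝ≥0∞) :
    seqNorm p (fun m => ∑' n, w (m - n) * u n) ≤ (∑' i, w i) * seqNorm p u := by
  have : ∀ m, ∑' n, w (m - n) * u n = ∑' i, w i * u (m - i) := by
    intro m
    rw [← (Equiv.subLeft m).tsum_eq]
    simp
  simp only [this]
  refine (seqNorm_tsum_le hp _).trans ?_
  rw [← ENNReal.tsum_mul_right]
  refine ENNReal.tsum_le_tsum fun i => ?_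
  rw [seqNorm_const_mul]
  exact (congrArg _ (seqNorm_comp_equiv p (Equiv.subRight i) u)).le

/-- Minkowski's inequality for mixed norms: `ℓ^p(ℓ^q) ≤ ℓ^q(ℓ^p)` for `q ≤ p`. -/
theorem seqNorm_seqNorm_le [Countable ι] [Countable κ] {p q : ℝ≥0∞} (hq : q ≠ 0) (hqp : q ≤ p)
    (u : κ → ι → ℝ≥0∞) :
    seqNorm p (fun k => seqNorm q (u k)) ≤ seqNorm q (fun i => seqNorm p fun k => u k i) := by
  have hp0 : p ≠ 0 := (hq.bot_lt.trans_le hqp).ne'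
  rcases eq_or_ne p ∞ with rfl | hp
  · rw [seqNorm_top]
    exact iSup_le fun k => seqNorm_mono fun i => le_seqNorm hp0 (fun k => u k i) k
  have hqt : q ≠ ∞ := ne_top_of_le_ne_top hp hqp
  have hq' := ENNReal.toReal_pos hq hqt
  have hp' := ENNReal.toReal_pos hp0 hp
  have hqp' : q.toReal ≤ p.toReal := ENNReal.toReal_mono hp hqp
  -- the triangle inequality in `ℓ^{p/q}` for `q`-th powers
  have hr1 : 1 ≤ p.toReal / q.toReal := (one_le_div hq').2 hqp'
  set r : ℝ≥0∞ := ENNReal.ofReal (p.toReal / q.toReal) with hr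
  have hr1' : 1 ≤ r := by rw [hr]; exact ENNReal.one_le_ofReal.2 hr1
  have hr0 : r ≠ 0 := (zero_lt_one.trans_le hr1').ne'
  have hrt : r ≠ ∞ := ENNReal.ofReal_ne_top
  have hrr : r.toReal = p.toReal / q.toReal := ENNReal.toReal_ofReal (by positivity)
  have hpow : ∀ {ι' : Type _} [Countable ι'] [MeasurableSpace ι'] [MeasurableSingletonClass ι']
      (v : ι' → ℝ≥0∞), seqNorm r (fun i => v i ^ q.toReal) = seqNorm p v ^ q.toReal := by
    intro ι' _ _ _ v
    rw [seqNorm_eq hr0 hrt, seqNorm_eq hp0 hp, hrr, ← ENNReal.rpow_mul]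
    simp only [← ENNReal.rpow_mul]
    congr 1
    · congr 1; ext i; congr 1; field_simp
    · field_simp
  rw [← ENNReal.rpow_le_rpow_iff hq', ← hpow]
  have e : ∀ v : ι → ℝ≥0∞, seqNorm q v ^ q.toReal = ∑' i, v i ^ q.toReal := by
    intro v
    rw [seqNorm_eq hq hqt, ← ENNReal.rpow_mul, one_div_mul_cancel hq'.ne', ENNReal.rpow_one]
  simp only [e]
  refine (seqNorm_tsum_le hr1' _).trans (ENNReal.tsum_le_tsum fun i => ?_)
  rw [hpow]

end SequenceNorms

/-! ### The inequality for mixed sequence norms -/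

section SquareFunction

/-- The discrete inequality behind the maximal theorem. Here `A k n` and `a n` stand for the size of
the input on the `n`-th annulus, with and without frequency localization at scale `2^k`, and `O m k`
stands for the output on the `m`-th annulus of the part of the maximal function at scale `2^k`. -/
theorem seqNorm_seqNorm_two_le {p q s : ℝ≥0∞} (hq : 1 ≤ q) (hqp : q ≤ p) (hp : 2 ≤ p)
    (hqs : q⁻¹ + s⁻¹ = 1) {a : ℤ → ℝ≥0∞} {A O : ℤ → ℤ → ℝ≥0∞} {B D : ℝ≥0∞}
    {w w' v c e : ℤ → ℝ≥0∞} (hA : ∀ n, seqNorm 2 (fun k => A k n) ≤ D * a n)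
    (hO : ∀ m k, O m k ≤ B * ∑' n, w (m - n) * A k n + v (m + k) * ∑' n, c (n + k) * A k n +
      B * ∑' n, w' (m - n) * (e (n + k) * a n)) :
    seqNorm p (fun m => seqNorm 2 (O m)) ≤
      (B * (∑' i, w i) * D + (∑' i, v i) * seqNorm s c * D +
        B * (∑' i, w' i) * seqNorm 2 e) * seqNorm q a := by
  have h12 : (1 : ℝ≥0∞) ≤ 2 := one_le_two
  have hp1 : 1 ≤ p := hq.trans hqp
  have hq0 : q ≠ 0 := (zero_lt_one.trans_le hq).ne'
  have hpq : seqNorm p a ≤ seqNorm q a := seqNorm_antitone hq0 hqp a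
  have h1 : ∀ m, seqNorm 2 (fun k => B * ∑' n, w (m - n) * A k n) ≤
      B * D * ∑' n, w (m - n) * a n := by
    intro m
    rw [seqNorm_const_mul, mul_assoc, ← ENNReal.tsum_mul_left]
    gcongr
    refine (seqNorm_tsum_le h12 (fun n k => w (m - n) * A k n)).trans
      (ENNReal.tsum_le_tsum fun n => ?_)
    rw [seqNorm_const_mul, mul_left_comm]
    gcongr
    exact hA n
  have h3 : ∀ m, seqNorm 2 (fun k => B * ∑' n, w' (m - n) * (e (n + k) * a n)) ≤
      B * seqNorm 2 e * ∑' n, w' (m - n) * a n := by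
    intro m
    rw [seqNorm_const_mul, mul_assoc, ← ENNReal.tsum_mul_left]
    gcongr
    refine (seqNorm_tsum_le h12 (fun n k => w' (m - n) * (e (n + k) * a n))).trans
      (ENNReal.tsum_le_tsum fun n => ?_)
    rw [seqNorm_const_mul, mul_left_comm]
    gcongr
    simp only [mul_comm _ (a n)]
    rw [seqNorm_const_mul]
    exact (congrArg _ (seqNorm_comp_equiv 2 (Equiv.addLeft n) e)).le
  have h2 : ∀ m, seqNorm 2 (fun k => v (m + k) * ∑' n, c (n + k) * A k n) ≤
      seqNorm s c * ∑' k, v (m + k) * seqNorm q (A k) := by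
    intro m
    refine (seqNorm_antitone one_ne_zero h12 _).trans ?_
    rw [seqNorm_one, ← ENNReal.tsum_mul_left]
    refine ENNReal.tsum_le_tsum fun k => ?_
    rw [mul_left_comm]
    gcongr
    refine (tsum_mul_le_seqNorm_mul hqs _ _).trans ?_
    gcongr
    exact (seqNorm_comp_equiv s (Equiv.addRight k) c).le
  have hAq : seqNorm p (fun k => seqNorm q (A k)) ≤ D * seqNorm q a := by
    refine (seqNorm_seqNorm_le hq0 hqp A).trans ?_
    rw [← seqNorm_const_mul]
    exact seqNorm_mono fun n => (seqNorm_antitone two_ne_zero hp _).trans (hA n)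
  have hmid : seqNorm p (fun m => ∑' k, v (m + k) * seqNorm q (A k)) ≤
      (∑' i, v i) * (D * seqNorm q a) := by
    have e1 : ∀ m, ∑' k, v (m + k) * seqNorm q (A k) =
        ∑' k, v (m - k) * seqNorm q (A (-k)) := by
      intro m
      rw [← (Equiv.neg ℤ).tsum_eq]
      simp [sub_eq_add_neg]
    simp only [e1]
    refine (seqNorm_convolution_le hp1 v fun k => seqNorm q (A (-k))).trans ?_
    gcongr
    exact (seqNorm_comp_equiv p (Equiv.neg ℤ) (fun k => seqNorm q (A k))).le.trans hAq
  calc seqNorm p (fun m => seqNorm 2 (O m))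
      ≤ seqNorm p (fun m => B * D * (∑' n, w (m - n) * a n) +
          seqNorm s c * (∑' k, v (m + k) * seqNorm q (A k)) +
          B * seqNorm 2 e * ∑' n, w' (m - n) * a n) := by
        refine seqNorm_mono fun m => (seqNorm_mono (hO m)).trans ?_
        refine (seqNorm_add_le h12 _ _).trans (add_le_add ?_ (h3 m))
        exact (seqNorm_add_le h12 _ _).trans (add_le_add (h1 m) (h2 m))
    _ ≤ B * D * ((∑' i, w i) * seqNorm q a) + seqNorm s c * ((∑' i, v i) * (D * seqNorm q a)) +
          B * seqNorm 2 e * ((∑' i, w' i) * seqNorm q a) := by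
        refine (seqNorm_add_le hp1 _ _).trans (add_le_add ?_ ?_)
        · refine (seqNorm_add_le hp1 _ _).trans (add_le_add ?_ ?_)
          · rw [seqNorm_const_mul]
            gcongr
            exact (seqNorm_convolution_le hp1 _ _).trans (by gcongr)
          · rw [seqNorm_const_mul]
            gcongr
        · rw [seqNorm_const_mul]
          gcongr
          exact (seqNorm_convolution_le hp1 _ _).trans (by gcongr)
    _ = _ := by ring

end SquareFunction

/-! ### Homogeneous distance functions and their level sets -/

section HomogeneousDistance

variable {d : ℕ} {ρ : EuclideanSpace ℝ (Fin d) → ℝ} {β : ℝ}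

/-- The closed annulus `{ξ : r ≤ |ξ| ≤ R}`. -/
def closedAnnulus (d : ℕ) (r R : ℝ) : Set (EuclideanSpace ℝ (Fin d)) :=
  {ξ | r ≤ ‖ξ‖ ∧ ‖ξ‖ ≤ R}

theorem isClosed_closedAnnulus (r R : ℝ) : IsClosed (closedAnnulus d r R) :=
  (isClosed_le continuous_const continuous_norm).inter
    (isClosed_le continuous_norm continuous_const)

theorem measurableSet_closedAnnulus (r R : ℝ) : MeasurableSet (closedAnnulus d r R) :=
  (isClosed_closedAnnulus r R).measurableSet

theorem isCompact_closedAnnulus (r R : ℝ) : IsCompact (closedAnnulus d r R) :=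
  (isCompact_closedBall (0 : EuclideanSpace ℝ (Fin d)) R).of_isClosed_subset
    (isClosed_closedAnnulus r R) fun ξ hξ => by simpa using hξ.2

theorem IsHomogeneousDistance.comp_smul (hρ : IsHomogeneousDistance ρ β) {c : ℝ} (hc : c ≠ 0) :
    IsHomogeneousDistance (fun ξ => ρ (c • ξ)) β where
  degree_pos := hρ.degree_pos
  smooth := hρ.smooth.comp (contDiff_const_smul c).contDiffOn fun ξ hξ => by simpa [hc] using hξ
  pos ξ hξ := hρ.pos _ (by simp [hc, hξ])
  homogeneous t ht ξ hξ := by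
    rw [smul_comm]; exact hρ.homogeneous t ht _ (by simp [hc, hξ])

theorem IsHomogeneousDistance.apply_smul (hρ : IsHomogeneousDistance ρ β) {s : ℝ} (hs : 0 < s)
    {ξ : EuclideanSpace ℝ (Fin d)} (hξ : ξ ≠ 0) : ρ (s • ξ) = s ^ β * ρ ξ := by
  have := hρ.homogeneous (s ^ β) (by positivity) ξ hξ
  rwa [← Real.rpow_mul hs.le, mul_one_div_cancel hρ.degree_pos.ne', Real.rpow_one] at this

theorem IsHomogeneousDistance.measurable (hρ : IsHomogeneousDistance ρ β) : Measurable ρ :=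
  measurable_of_continuousOn_compl_singleton 0 hρ.smooth.continuousOn

theorem IsHomogeneousDistance.exists_bounds (hρ : IsHomogeneousDistance ρ β) :
    ∃ c C : ℝ, 0 < c ∧ 0 < C ∧ ∀ ξ, ξ ≠ 0 → c * ‖ξ‖ ^ β ≤ ρ ξ ∧ ρ ξ ≤ C * ‖ξ‖ ^ β := by
  have hS : IsCompact (closedAnnulus d 1 1) := isCompact_closedAnnulus 1 1
  have h0 : ∀ ξ ∈ closedAnnulus d 1 1, ξ ≠ 0 := by
    rintro ξ hξ rfl
    have := hξ.1
    norm_num at this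
  have hcont : ContinuousOn ρ (closedAnnulus d 1 1) := hρ.smooth.continuousOn.mono h0
  have hnorm : ∀ ξ : EuclideanSpace ℝ (Fin d), ξ ≠ 0 → ‖ξ‖⁻¹ • ξ ∈ closedAnnulus d 1 1 := by
    intro ξ hξ
    have : ‖‖ξ‖⁻¹ • ξ‖ = 1 := by
      rw [norm_smul, norm_inv, norm_norm, inv_mul_cancel₀ (norm_ne_zero_iff.2 hξ)]
    exact ⟨this.ge, this.le⟩
  have hpol : ∀ ξ : EuclideanSpace ℝ (Fin d), ξ ≠ 0 → ρ ξ = ρ (‖ξ‖⁻¹ • ξ) * ‖ξ‖ ^ β := by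
    intro ξ hξ
    have hn := norm_pos_iff.2 hξ
    rw [mul_comm, ← hρ.apply_smul hn (h0 _ (hnorm ξ hξ)), smul_inv_smul₀ hn.ne']
  rcases (closedAnnulus d 1 1).eq_empty_or_nonempty with he | hne
  · refine ⟨1, 1, one_pos, one_pos, fun ξ hξ => ?_⟩
    have := hnorm ξ hξ
    rw [he] at this
    exact this.elim
  obtain ⟨x, hx, hmin⟩ := hS.exists_isMinOn hne hcont
  obtain ⟨y, hy, hmax⟩ := hS.exists_isMaxOn hne hcont
  refine ⟨ρ x, ρ y, hρ.pos x (h0 x hx), hρ.pos y (h0 y hy), fun ξ hξ => ?_⟩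
  rw [hpol ξ hξ]
  exact ⟨by gcongr; exact hmin (hnorm ξ hξ), by gcongr; exact hmax (hnorm ξ hξ)⟩

/-- A smooth bump function, equal to `1` for `r ≤ |ξ| ≤ R` and vanishing unless
`r / 2 ≤ |ξ| ≤ 2R`. -/
theorem exists_annular_cutoff (d : ℕ) {r R : ℝ} (hr : 0 < r) (hR : 0 < R) :
    ∃ χ : EuclideanSpace ℝ (Fin d) → ℝ, ContDiff ℝ (⊤ : ℕ∞) χ ∧ (∀ ξ, 0 ≤ χ ξ ∧ χ ξ ≤ 1) ∧
      (∀ ξ, r ≤ ‖ξ‖ → ‖ξ‖ ≤ R → χ ξ = 1) ∧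
      Function.support χ ⊆ closedAnnulus d (r / 2) (2 * R) := by
  let f : ContDiffBump (0 : EuclideanSpace ℝ (Fin d)) := ⟨R, 2 * R, hR, by linarith⟩
  let g : ContDiffBump (0 : EuclideanSpace ℝ (Fin d)) := ⟨r / 2, r, by linarith, by linarith⟩
  refine ⟨fun ξ => f ξ * (1 - g ξ), f.contDiff.mul (contDiff_const.sub g.contDiff),
    fun ξ => ⟨mul_nonneg f.nonneg (sub_nonneg.2 g.le_one),
      mul_le_one₀ f.le_one (sub_nonneg.2 g.le_one) (by linarith [g.nonneg (x := ξ)])⟩,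
    fun ξ h1 h2 => ?_, fun ξ hξ => ?_⟩
  · beta_reduce
    rw [f.one_of_mem_closedBall (by simpa [f] using h2), g.zero_of_le_dist (by simpa [g] using h1)]
    norm_num
  · refine ⟨?_, ?_⟩
    · by_contra! h
      exact hξ (by simp [g.one_of_mem_closedBall (x := ξ) (by simpa [g] using h.le)])
    · by_contra! h
      exact hξ (by simp [f.zero_of_le_dist (x := ξ) (by simpa [f] using h.le)])

/-- A homogeneous distance function can be modified near `0` and `∞` to a smooth one. -/
theorem IsHomogeneousDistance.exists_smooth_eqOn (hρ : IsHomogeneousDistance ρ β) {r R : ℝ}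
    (hr : 0 < r) (hR : 0 < R) : ∃ ψ : EuclideanSpace ℝ (Fin d) → ℝ, ContDiff ℝ (⊤ : ℕ∞) ψ ∧
      HasCompactSupport ψ ∧ ∀ ξ ∈ closedAnnulus d r R, ψ ξ = ρ ξ := by
  obtain ⟨χ, hχ, -, h1, hs⟩ := exists_annular_cutoff d hr hR
  have hts : tsupport χ ⊆ closedAnnulus d (r / 2) (2 * R) :=
    closure_minimal hs (isClosed_closedAnnulus _ _)
  refine ⟨fun ξ => χ ξ * ρ ξ, ?_, ?_, fun ξ hξ => by
    beta_reduce; rw [h1 ξ hξ.1 hξ.2, one_mul]⟩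
  · rw [contDiff_iff_contDiffAt]
    intro ξ
    by_cases hξ : ξ = 0
    · have h0 : ξ ∉ tsupport χ := fun h => by
        have := (hts h).1
        rw [hξ, norm_zero] at this
        linarith
      have he : (fun ξ => χ ξ * ρ ξ) =ᶠ[nhds ξ] fun _ => 0 := by
        filter_upwards [(isClosed_tsupport χ).isOpen_compl.mem_nhds h0] with x hx
        rw [image_eq_zero_of_notMem_tsupport hx, zero_mul]
      exact contDiffAt_const.congr_of_eventuallyEq he
    · exact hχ.contDiffAt.mul (hρ.smooth.contDiffAt (isOpen_compl_singleton.mem_nhds hξ))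
  · exact (HasCompactSupport.intro' (isCompact_closedAnnulus (d := d) (r / 2) (2 * R))
      (isClosed_closedAnnulus _ _) fun ξ hξ => by
        rw [Function.notMem_support.1 fun h => hξ (hs h), zero_mul])

theorem lintegral_eq_lintegral_smul (F : EuclideanSpace ℝ (Fin d) → ℝ≥0∞) (hF : Measurable F)
    {c : ℝ} (hc : 0 < c) :
    ∫⁻ η, F η = ENNReal.ofReal (c ^ d) * ∫⁻ η, F (c • η) := by
  have h := Measure.map_addHaar_smul (volume : Measure (EuclideanSpace ℝ (Fin d))) hc.ne'
  have h2 : ∫⁻ η, F (c • η) = ENNReal.ofReal |(c ^ d)⁻¹| * ∫⁻ η, F η := by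
    rw [← lintegral_map hF (measurable_const_smul c), h, lintegral_smul_measure]
    simp
  rw [h2, ← mul_assoc, ← ENNReal.ofReal_mul (by positivity), abs_of_pos (by positivity),
    mul_inv_cancel₀ (by positivity), ENNReal.ofReal_one, one_mul]

/-- Change of variables `u = e^{βs} y` along a dilation orbit. -/
theorem lintegral_comp_exp_le {c : ℝ} (hβ : 0 < β) (hc : 0 < c) {y : ℝ} (hy : c ≤ y)
    (Γ : ℝ → ℝ≥0∞) (T : ℝ) :
    ∫⁻ s in Icc 0 T, Γ (Real.exp (β * s) * y) ≤ ENNReal.ofReal (1 / (β * c)) * ∫⁻ u, Γ u := by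
  have hy0 : 0 < y := hc.trans_le hy
  have hder : ∀ s ∈ Icc 0 T, HasDerivWithinAt (fun s => Real.exp (β * s) * y)
      (Real.exp (β * s) * β * y) (Icc 0 T) s := by
    intro s _
    have : HasDerivAt (fun s => Real.exp (β * s) * y) (Real.exp (β * s) * β * y) s := by
      simpa using (((hasDerivAt_id s).const_mul β).exp).mul_const y
    exact this.hasDerivWithinAt
  have hinj : InjOn (fun s => Real.exp (β * s) * y) (Icc 0 T) := by
    intro s _ s' _ h
    have h2 := Real.exp_injective (mul_right_cancel₀ hy0.ne' h)
    exact mul_left_cancel₀ hβ.ne' h2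
  have hcv := lintegral_image_eq_lintegral_abs_deriv_mul measurableSet_Icc hder hinj Γ
  have hβc : 0 < β * c := by positivity
  calc ∫⁻ s in Icc 0 T, Γ (Real.exp (β * s) * y)
      ≤ ∫⁻ s in Icc 0 T, ENNReal.ofReal (1 / (β * c)) *
          (ENNReal.ofReal |Real.exp (β * s) * β * y| * Γ (Real.exp (β * s) * y)) := by
        refine setLIntegral_mono' measurableSet_Icc fun s hs => ?_
        rw [← mul_assoc, ← ENNReal.ofReal_mul (by positivity)]
        refine le_mul_of_one_le_left' (ENNReal.one_le_ofReal.2 ?_)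
        rw [abs_of_pos (by positivity), one_div, ← div_eq_inv_mul, one_le_div hβc, mul_assoc]
        have h1 : 1 ≤ Real.exp (β * s) := Real.one_le_exp (mul_nonneg hβ.le hs.1)
        have h2 : β * c ≤ β * y := by gcongr
        nlinarith
    _ = ENNReal.ofReal (1 / (β * c)) *
          ∫⁻ u in (fun s => Real.exp (β * s) * y) '' Icc 0 T, Γ u := by
        rw [lintegral_const_mul' _ _ ENNReal.ofReal_ne_top, hcv]
    _ ≤ _ := by gcongr; exact Measure.restrict_le_self

/-- Averaging over the dilations `η ↦ e^s η` with `0 ≤ s ≤ 1/M` turns a function of `ρ` into its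
integral over `ℝ`. This replaces integration over the level sets of `ρ`. -/
theorem IsHomogeneousDistance.lintegral_annulus_mul_comp_le (hρ : IsHomogeneousDistance ρ β)
    {r R M c : ℝ} (hr : 0 < r) (hM : 1 ≤ M) (hc : 0 < c)
    (hρc : ∀ η ∈ closedAnnulus d (r / Real.exp 1) R, c ≤ ρ η)
    {G G' : EuclideanSpace ℝ (Fin d) → ℝ≥0∞} (hG : Measurable G) (hG' : Measurable G')
    (hGG' : ∀ η ∈ closedAnnulus d (r / Real.exp 1) R, ∀ s ∈ Icc 0 (1 / M),
      G (Real.exp s • η) ≤ G' η)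
    {Γ : ℝ → ℝ≥0∞} (hΓ : Measurable Γ) :
    ∫⁻ η in closedAnnulus d r R, G η * Γ (ρ η) ≤
      ENNReal.ofReal (M * (Real.exp d * (1 / (β * c)))) *
        ((∫⁻ η in closedAnnulus d (r / Real.exp 1) R, G' η) * ∫⁻ u, Γ u) := by
  have hM0 : 0 < M := one_pos.trans_le hM
  set A := closedAnnulus d r R
  set A' := closedAnnulus d (r / Real.exp 1) R with hA'
  have hA'0 : ∀ η ∈ A', η ≠ 0 := by
    rintro η hη rfl
    have := hη.1
    rw [norm_zero] at this
    have : 0 < r / Real.exp 1 := by positivity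
    linarith
  set F : EuclideanSpace ℝ (Fin d) → ℝ≥0∞ := A.indicator fun η => G η * Γ (ρ η) with hF
  have hFm : Measurable F :=
    (hG.mul (hΓ.comp hρ.measurable)).indicator (measurableSet_closedAnnulus r R)
  have hs : ∀ s ∈ Icc 0 (1 / M), ∫⁻ η in A, G η * Γ (ρ η) ≤
      ENNReal.ofReal (Real.exp d) * ∫⁻ η in A', G' η * Γ (Real.exp (β * s) * ρ η) := by
    intro s hs
    have hs1 : s ≤ 1 := hs.2.trans (by rw [div_le_one hM0]; exact hM)
    rw [← lintegral_indicator (measurableSet_closedAnnulus r R), ← hF,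
      lintegral_eq_lintegral_smul F hFm (Real.exp_pos s),
      ← lintegral_indicator (measurableSet_closedAnnulus _ R)]
    gcongr with η
    · rw [← Real.exp_nat_mul]
      exact Real.exp_le_exp.2 (by nlinarith [Nat.cast_nonneg (α := ℝ) d, hs.1])
    · by_cases hη : Real.exp s • η ∈ A
      · have hn : ‖Real.exp s • η‖ = Real.exp s * ‖η‖ := by
          rw [norm_smul, Real.norm_eq_abs, abs_of_pos (Real.exp_pos s)]
        have hη' : η ∈ A' := by
          refine ⟨?_, ?_⟩
          · rw [div_le_iff₀ (Real.exp_pos 1)]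
            calc r ≤ Real.exp s * ‖η‖ := hn ▸ hη.1
              _ ≤ ‖η‖ * Real.exp 1 := by rw [mul_comm]; gcongr
          · have h1 : 1 ≤ Real.exp s := Real.one_le_exp hs.1
            have h2 : Real.exp s * ‖η‖ ≤ R := hn ▸ hη.2
            nlinarith [norm_nonneg η]
        rw [hF, indicator_of_mem hη, indicator_of_mem hη', hρ.apply_smul (Real.exp_pos s)
          (hA'0 η hη'), ← Real.exp_mul, mul_comm s β]
        gcongr
        exact hGG' η hη' s hs
      · rw [hF, indicator_of_notMem hη]; exact zero_le
  -- integrate over `s` and apply Tonelli's theorem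
  have hmeas : Measurable (Function.uncurry fun (s : ℝ) (η : EuclideanSpace ℝ (Fin d)) =>
      G' η * Γ (Real.exp (β * s) * ρ η)) := by
    have := hρ.measurable
    fun_prop
  have hint : ENNReal.ofReal (1 / M) * ∫⁻ η in A, G η * Γ (ρ η) ≤
      ENNReal.ofReal (Real.exp d) *
        ∫⁻ η in A', ∫⁻ s in Icc 0 (1 / M), G' η * Γ (Real.exp (β * s) * ρ η) := by
    calc ENNReal.ofReal (1 / M) * ∫⁻ η in A, G η * Γ (ρ η)
        = ∫⁻ s in Icc 0 (1 / M), ∫⁻ η in A, G η * Γ (ρ η) := by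
          rw [setLIntegral_const, Real.volume_Icc, sub_zero, mul_comm]
      _ ≤ ∫⁻ s in Icc 0 (1 / M), ENNReal.ofReal (Real.exp d) *
            ∫⁻ η in A', G' η * Γ (Real.exp (β * s) * ρ η) :=
          setLIntegral_mono' measurableSet_Icc hs
      _ = _ := by
          rw [lintegral_const_mul' _ _ ENNReal.ofReal_ne_top,
            lintegral_lintegral_swap hmeas.aemeasurable]
  have hinner : ∫⁻ η in A', ∫⁻ s in Icc 0 (1 / M), G' η * Γ (Real.exp (β * s) * ρ η) ≤
      ENNReal.ofReal (1 / (β * c)) * ((∫⁻ η in A', G' η) * ∫⁻ u, Γ u) := by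
    rw [← mul_assoc, mul_right_comm, mul_comm _ (∫⁻ η in A', G' η), ← lintegral_mul_const _ hG']
    refine setLIntegral_mono' (measurableSet_closedAnnulus _ R) fun η hη => ?_
    rw [lintegral_const_mul _ (by fun_prop)]
    gcongr
    exact lintegral_comp_exp_le hρ.degree_pos hc (hρc η hη) Γ _
  calc ∫⁻ η in A, G η * Γ (ρ η)
      = ENNReal.ofReal M * (ENNReal.ofReal (1 / M) * ∫⁻ η in A, G η * Γ (ρ η)) := by
        rw [← mul_assoc, ← ENNReal.ofReal_mul hM0.le, mul_one_div_cancel hM0.ne',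
          ENNReal.ofReal_one, one_mul]
    _ ≤ ENNReal.ofReal M * (ENNReal.ofReal (Real.exp d) *
          (ENNReal.ofReal (1 / (β * c)) * ((∫⁻ η in A', G' η) * ∫⁻ u, Γ u))) := by
        refine mul_le_mul_right (hint.trans ?_) _
        gcongr
    _ = _ := by
        rw [ENNReal.ofReal_mul hM0.le, ENNReal.ofReal_mul (Real.exp_pos _).le]
        ring

/-- The preimage of a null set under `ρ` is a null set. -/
theorem IsHomogeneousDistance.ae_notMem_of_volume_eq_zero [Nonempty (Fin d)]
    (hρ : IsHomogeneousDistance ρ β) {N : Set ℝ} (hN : volume N = 0) :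
    ∀ᵐ ξ : EuclideanSpace ℝ (Fin d), ρ ξ ∉ N := by
  obtain ⟨c, C, hc, -, hcC⟩ := hρ.exists_bounds
  have hnull : ∀ n : ℕ, volume (closedAnnulus d (1 / (n + 1)) (n + 1) ∩ ρ ⁻¹' N) = 0 := by
    intro n
    have hr : (0 : ℝ) < 1 / (n + 1) := by positivity
    set r : ℝ := 1 / (n + 1) with hrdef
    have hr' : 0 < r / Real.exp 1 := by positivity
    set Γ : ℝ → ℝ≥0∞ := (toMeasurable volume N).indicator 1 with hΓ
    have hΓm : Measurable Γ := measurable_one.indicator (measurableSet_toMeasurable _ _)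
    have := hρ.lintegral_annulus_mul_comp_le (R := n + 1) (c := c * (r / Real.exp 1) ^ β)
      hr le_rfl (by positivity)
      (fun η hη => by
        have h0 : η ≠ 0 := by
          rintro rfl
          have := hη.1
          rw [norm_zero] at this
          linarith
        refine le_trans ?_ (hcC η h0).1
        have := hη.1
        have := hρ.degree_pos
        gcongr)
      (G := 1) (G' := 1) measurable_one measurable_one (fun _ _ _ _ => le_rfl) hΓm
    have hzero : ∫⁻ u, Γ u = 0 := by
      rw [hΓ, lintegral_indicator_one (measurableSet_toMeasurable _ _), measure_toMeasurable, hN]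
    rw [hzero, mul_zero, mul_zero] at this
    have h2 : volume (closedAnnulus d r (n + 1) ∩ ρ ⁻¹' N) ≤
        ∫⁻ η in closedAnnulus d r (n + 1), (1 : EuclideanSpace ℝ (Fin d) → ℝ≥0∞) η * Γ (ρ η) := by
      calc volume (closedAnnulus d r (n + 1) ∩ ρ ⁻¹' N)
          ≤ volume (closedAnnulus d r (n + 1) ∩ ρ ⁻¹' (toMeasurable volume N)) := by
            gcongr; exact subset_toMeasurable _ _
        _ = ∫⁻ η in closedAnnulus d r (n + 1), (ρ ⁻¹' (toMeasurable volume N)).indicator 1 η := by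
            rw [lintegral_indicator_one (hρ.measurable (measurableSet_toMeasurable _ _)),
              Measure.restrict_apply (hρ.measurable (measurableSet_toMeasurable _ _)), inter_comm]
        _ = _ := by
            refine lintegral_congr fun η => ?_
            rw [Pi.one_apply, one_mul]
            rfl
    exact le_antisymm (h2.trans this) zero_le
  have h0 : volume ({0} : Set (EuclideanSpace ℝ (Fin d))) = 0 := by
    have : Nontrivial (EuclideanSpace ℝ (Fin d)) := inferInstance
    exact measure_singleton 0
  refine measure_mono_null ?_ ((measure_union_null_iff (μ := volume)).2
    ⟨h0, measure_iUnion_null hnull⟩)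
  intro ξ hξ
  simp only [mem_compl_iff, mem_ofPred_eq, not_not] at hξ
  by_cases h : ξ = 0
  · exact Or.inl h
  · right
    have hpos := norm_pos_iff.2 h
    obtain ⟨n, hn⟩ := exists_nat_gt (max ‖ξ‖ ‖ξ‖⁻¹)
    refine mem_iUnion.2 ⟨n, ⟨?_, ?_⟩, hξ⟩
    · rw [one_div_le (by positivity) hpos, one_div]
      linarith [le_max_right ‖ξ‖ ‖ξ‖⁻¹]
    · linarith [le_max_left ‖ξ‖ ‖ξ‖⁻¹]

end HomogeneousDistance

/-! ### Schur's test and oscillatory integral operators -/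

section OscillatoryIntegrals

theorem eLpNorm_two_sq {X ε : Type*} [MeasurableSpace X] [TopologicalSpace ε] [ContinuousENorm ε]
    (μ : Measure X) (f : X → ε) : eLpNorm f 2 μ ^ 2 = ∫⁻ x, ‖f x‖ₑ ^ 2 ∂μ := by
  rw [eLpNorm_eq_lintegral_rpow_enorm_toReal two_ne_zero ENNReal.ofNat_ne_top,
    ← ENNReal.rpow_natCast,
    ← ENNReal.rpow_mul]
  simp

theorem two_mul_mul_le_sq_add_sq (x y : ℝ≥0∞) : 2 * x * y ≤ x ^ 2 + y ^ 2 := by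
  wlog h : x ≤ y generalizing x y
  · have := this y x (le_of_not_ge h)
    rwa [mul_right_comm, add_comm]
  obtain ⟨z, rfl⟩ := exists_add_of_le h
  calc 2 * x * (x + z) = x ^ 2 + (x ^ 2 + 2 * x * z) := by ring
    _ ≤ x ^ 2 + ((x ^ 2 + 2 * x * z) + z ^ 2) :=
        add_le_add le_rfl le_self_add
    _ = x ^ 2 + (x + z) ^ 2 := by ring

/-- Schur's test for a symmetric kernel. -/
theorem lintegral_lintegral_mul_kernel_le {X : Type*} [MeasurableSpace X] {μ : Measure X}
    [SFinite μ] {K : X → X → ℝ≥0∞} (hK : Measurable (Function.uncurry K))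
    (hsymm : ∀ x y, K x y = K y x) {S : Set X} (hS : MeasurableSet S) {A : ℝ≥0∞}
    (hA : ∀ x ∈ S, ∫⁻ y in S, K x y ∂μ ≤ A) {u : X → ℝ≥0∞} (hu : AEMeasurable u μ)
    (hus : ∀ x, x ∉ S → u x = 0) :
    ∫⁻ x, ∫⁻ y, u x * u y * K x y ∂μ ∂μ ≤ A * ∫⁻ x, u x ^ 2 ∂μ := by
  have hsq : ∫⁻ x, ∫⁻ y in S, u x ^ 2 * K x y ∂μ ∂μ ≤ A * ∫⁻ x, u x ^ 2 ∂μ := by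
    rw [← lintegral_const_mul'' A (hu.pow_const 2)]
    refine lintegral_mono fun x => ?_
    rw [lintegral_const_mul _ (by fun_prop), mul_comm]
    by_cases hx : x ∈ S
    · gcongr; exact hA x hx
    · simp [hus x hx]
  have hmeas : ∀ f g : X → ℝ≥0∞, AEMeasurable f μ → AEMeasurable g μ →
      AEMeasurable (Function.uncurry fun x y => f x * g y * K x y) (μ.prod μ) := by
    intro f g hf hg
    exact ((hf.comp_fst).mul (hg.comp_snd)).mul hK.aemeasurable
  set v : X → ℝ≥0∞ := S.indicator 1 with hv
  have hvm : Measurable v := measurable_one.indicator hS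
  have hsq1 : ∫⁻ x, ∫⁻ y, u x ^ 2 * v y * K x y ∂μ ∂μ ≤ A * ∫⁻ x, u x ^ 2 ∂μ := by
    refine le_trans (le_of_eq (lintegral_congr fun x => ?_)) hsq
    rw [← lintegral_indicator hS]
    refine lintegral_congr fun y => ?_
    by_cases hy : y ∈ S <;> simp [hv, hy]
  have hsq2 : ∫⁻ x, ∫⁻ y, v x * u y ^ 2 * K x y ∂μ ∂μ ≤ A * ∫⁻ x, u x ^ 2 ∂μ := by
    rw [lintegral_lintegral_swap (hmeas v (fun y => u y ^ 2) hvm.aemeasurable (hu.pow_const 2))]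
    refine le_trans (le_of_eq ?_) hsq1
    refine lintegral_congr fun x => lintegral_congr fun y => ?_
    rw [hsymm, mul_comm (v y)]
  -- `2 u(x) u(y) ≤ u(x)² + u(y)²`, and by symmetry both squares lead to the same integral
  have hpt : ∀ x y, 2 * (u x * u y * K x y) ≤ u x ^ 2 * v y * K x y + v x * u y ^ 2 * K x y := by
    intro x y
    by_cases hx : x ∈ S
    · by_cases hy : y ∈ S
      · simp only [hv, indicator_of_mem hx, indicator_of_mem hy, Pi.one_apply, mul_one, one_mul]
        rw [← add_mul, ← mul_assoc, ← mul_assoc]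
        gcongr
        exact two_mul_mul_le_sq_add_sq _ _
      · simp [hus y hy]
    · simp [hus x hx]
  have h2 : 2 * ∫⁻ x, ∫⁻ y, u x * u y * K x y ∂μ ∂μ ≤ 2 * (A * ∫⁻ x, u x ^ 2 ∂μ) := by
    calc 2 * ∫⁻ x, ∫⁻ y, u x * u y * K x y ∂μ ∂μ
        = ∫⁻ x, ∫⁻ y, 2 * (u x * u y * K x y) ∂μ ∂μ := by
          rw [← lintegral_const_mul' _ _ (by norm_num)]
          refine lintegral_congr fun x => ?_
          rw [← lintegral_const_mul' _ _ (by norm_num)]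
      _ ≤ ∫⁻ x, ∫⁻ y, (u x ^ 2 * v y * K x y + v x * u y ^ 2 * K x y) ∂μ ∂μ :=
          lintegral_mono fun x => lintegral_mono fun y => hpt x y
      _ = (∫⁻ x, ∫⁻ y, u x ^ 2 * v y * K x y ∂μ ∂μ) +
            ∫⁻ x, ∫⁻ y, v x * u y ^ 2 * K x y ∂μ ∂μ := by
          rw [← lintegral_add_left']
          · refine lintegral_congr fun x => ?_
            rw [lintegral_add_left]
            exact (hvm.const_mul _).mul (by fun_prop)
          · exact (hmeas (fun x => u x ^ 2) v (hu.pow_const 2)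
              hvm.aemeasurable).lintegral_prod_right'
      _ ≤ _ := by rw [two_mul]; exact add_le_add hsq1 hsq2
  exact (ENNReal.mul_le_mul_iff_right (by norm_num) (by norm_num)).1 h2

/-- A weighted `L²` bound for an oscillatory integral operator, by expanding the square and applying
Schur's test to the kernel `∫ w(z) e(φ(z, ξ) - φ(z, η)) dz`. -/
theorem lintegral_weight_mul_oscillatory_sq_le {Z X : Type*} [MeasurableSpace Z] [MeasurableSpace X]
    {ν : Measure Z} {μ : Measure X} [SFinite ν] [SFinite μ] {φ : Z → X → ℝ}
    (hφ : Measurable (Function.uncurry φ)) {w : Z → ℝ} (hw : Integrable w ν) (hw0 : ∀ z, 0 ≤ w z)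
    {K : X → X → ℝ≥0∞} (hK : Measurable (Function.uncurry K)) (hsymm : ∀ x y, K x y = K y x)
    (hwK : ∀ ξ η, ‖∫ z, (w z : ℂ) * (Real.fourierChar (φ z ξ - φ z η) : ℂ) ∂ν‖ₑ ≤ K ξ η)
    {S : Set X} (hS : MeasurableSet S) {A : ℝ≥0∞} (hA : ∀ x ∈ S, ∫⁻ y in S, K x y ∂μ ≤ A)
    {b : X → ℂ} (hb : Integrable b μ) (hbS : ∀ x, x ∉ S → b x = 0) :
    ∫⁻ z, ENNReal.ofReal (w z) * ‖∫ ξ, (Real.fourierChar (φ z ξ) : ℂ) * b ξ ∂μ‖ₑ ^ 2 ∂ν ≤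
      A * ∫⁻ ξ, ‖b ξ‖ₑ ^ 2 ∂μ := by
  have hem : Measurable fun r : ℝ => (Real.fourierChar r : ℂ) :=
    (continuous_subtype_val.comp Real.continuous_fourierChar).measurable
  set U : Z → ℂ := fun z => ∫ ξ, (Real.fourierChar (φ z ξ) : ℂ) * b ξ ∂μ with hU
  have hUm : AEStronglyMeasurable U ν := by
    refine AEStronglyMeasurable.integral_prod_right'
      (f := fun p : Z × X => (Real.fourierChar (φ p.1 p.2) : ℂ) * b p.2) ?_
    exact (hem.comp hφ).aestronglyMeasurable.mul hb.aestronglyMeasurable.comp_snd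
  -- the square of the oscillatory integral as a double integral
  have hUU : ∀ z, ((‖U z‖ ^ 2 : ℝ) : ℂ) = ∫ p : X × X, (Real.fourierChar (φ z p.1 - φ z p.2) : ℂ) *
      (b p.1 * (starRingEnd ℂ) (b p.2)) ∂(μ.prod μ) := by
    intro z
    rw [← Complex.normSq_eq_norm_sq, ← Complex.mul_conj, hU, ← integral_conj, ← integral_prod_mul]
    refine integral_congr_ae (Filter.Eventually.of_forall fun p => ?_)
    simp only [map_mul, AddChar.map_sub_eq_div, Circle.coe_div]
    rw [← Circle.coe_inv_eq_conj, Circle.coe_inv]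
    ring
  set bb : X × X → ℂ := fun p => b p.1 * (starRingEnd ℂ) (b p.2) with hbb
  have hbbi : Integrable bb (μ.prod μ) := by
    have hc : Integrable (fun x => (starRingEnd ℂ) (b x)) μ :=
      (LinearIsometryEquiv.integrable_comp_iff Complex.conjLIE).2 hb
    exact hb.mul_prod hc
  have hF : Integrable (fun q : Z × (X × X) => (w q.1 : ℂ) *
      ((Real.fourierChar (φ q.1 q.2.1 - φ q.1 q.2.2) : ℂ) * bb q.2)) (ν.prod (μ.prod μ)) := by
    have h0 := (hw.ofReal (𝕜 := ℂ)).mul_prod hbbi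
    refine h0.mono ?_ (Filter.Eventually.of_forall fun q => ?_)
    · have hm : Measurable fun q : Z × (X × X) =>
          (Real.fourierChar (φ q.1 q.2.1 - φ q.1 q.2.2) : ℂ) := by
        refine hem.comp ((hφ.comp (f := fun q : Z × (X × X) => (q.1, q.2.1)) (by fun_prop)).sub
          (hφ.comp (f := fun q : Z × (X × X) => (q.1, q.2.2)) (by fun_prop)))
      have h1 : AEStronglyMeasurable (fun q : Z × (X × X) => (w q.1 : ℂ)) (ν.prod (μ.prod μ)) :=
        (hw.ofReal (𝕜 := ℂ)).aestronglyMeasurable.comp_fst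
      exact h1.mul (hm.aestronglyMeasurable.mul hbbi.aestronglyMeasurable.comp_snd)
    · simp [Circle.norm_coe]
  have hI : ((∫ z, w z * ‖U z‖ ^ 2 ∂ν : ℝ) : ℂ) =
      ∫ p, (∫ z, (w z : ℂ) * (Real.fourierChar (φ z p.1 - φ z p.2) : ℂ) ∂ν) * bb p ∂(μ.prod μ) := by
    rw [← integral_complex_ofReal]
    calc ∫ z, ((w z * ‖U z‖ ^ 2 : ℝ) : ℂ) ∂ν
        = ∫ z, ∫ p, (w z : ℂ) * ((Real.fourierChar (φ z p.1 - φ z p.2) : ℂ) * bb p)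
            ∂(μ.prod μ) ∂ν := by
          refine integral_congr_ae (Filter.Eventually.of_forall fun z => ?_)
          beta_reduce
          rw [integral_const_mul, ← hUU, Complex.ofReal_mul]
      _ = ∫ p, ∫ z, (w z : ℂ) * ((Real.fourierChar (φ z p.1 - φ z p.2) : ℂ) * bb p)
            ∂ν ∂(μ.prod μ) := integral_integral_swap hF
      _ = _ := by
          refine integral_congr_ae (Filter.Eventually.of_forall fun p => ?_)
          simp only [← mul_assoc]
          rw [integral_mul_const]
  have hUb : ∀ z, ‖U z‖ ≤ ∫ ξ, ‖b ξ‖ ∂μ := fun z =>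
    (norm_integral_le_integral_norm _).trans (by simp [Circle.norm_coe])
  have hint : Integrable (fun z => w z * ‖U z‖ ^ 2) ν := by
    refine hw.mul_bdd (c := (∫ ξ, ‖b ξ‖ ∂μ) ^ 2) (hUm.norm.pow 2)
      (Filter.Eventually.of_forall fun z => ?_)
    rw [Real.norm_of_nonneg (by positivity)]
    gcongr
    exact hUb z
  calc ∫⁻ z, ENNReal.ofReal (w z) * ‖U z‖ₑ ^ 2 ∂ν
      = ∫⁻ z, ENNReal.ofReal (w z * ‖U z‖ ^ 2) ∂ν := by
        refine lintegral_congr fun z => ?_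
        rw [ENNReal.ofReal_mul (hw0 z), ENNReal.ofReal_pow (norm_nonneg _), ofReal_norm]
    _ = ENNReal.ofReal (∫ z, w z * ‖U z‖ ^ 2 ∂ν) :=
        (ofReal_integral_eq_lintegral_ofReal hint (Filter.Eventually.of_forall fun z =>
          mul_nonneg (hw0 z) (by positivity))).symm
    _ ≤ ‖∫ z, w z * ‖U z‖ ^ 2 ∂ν‖ₑ := Real.ofReal_le_enorm _
    _ = ‖∫ p, (∫ z, (w z : ℂ) * (Real.fourierChar (φ z p.1 - φ z p.2) : ℂ) ∂ν) * bb p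
          ∂(μ.prod μ)‖ₑ := by
        rw [← hI, ← ofReal_norm, ← ofReal_norm, Complex.norm_real]
    _ ≤ ∫⁻ p, K p.1 p.2 * ‖bb p‖ₑ ∂(μ.prod μ) := by
        refine (enorm_integral_le_lintegral_enorm _).trans (lintegral_mono fun p => ?_)
        rw [enorm_mul]
        gcongr
        exact hwK p.1 p.2
    _ = ∫⁻ x, ∫⁻ y, ‖b x‖ₑ * ‖b y‖ₑ * K x y ∂μ ∂μ := by
        rw [lintegral_prod (fun p => K p.1 p.2 * ‖bb p‖ₑ)
          (hK.aemeasurable.mul hbbi.aestronglyMeasurable.enorm)]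
        refine lintegral_congr fun x => lintegral_congr fun y => ?_
        simp only [hbb, enorm_mul]
        rw [mul_comm]
        congr 2
        simp [← ofReal_norm]
    _ ≤ _ := lintegral_lintegral_mul_kernel_le hK hsymm hS hA hb.aestronglyMeasurable.enorm
        fun x hx => by simp [hbS x hx]

/-- The Fourier transform of a dilated Gaussian. -/
theorem integral_gaussian_mul_fourierChar {V : Type*} [NormedAddCommGroup V] [InnerProductSpace ℝ V]
    [FiniteDimensional ℝ V] [MeasurableSpace V] [BorelSpace V] {M : ℝ} (hM : 0 < M) (w : V) :
    ∫ v : V, ((Real.exp (-(Real.pi / M ^ 2) * ‖v‖ ^ 2) : ℝ) : ℂ) *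
        (Real.fourierChar (inner ℝ v w) : ℂ) =
      ((M ^ Module.finrank ℝ V * Real.exp (-(Real.pi * M ^ 2) * ‖w‖ ^ 2) : ℝ) : ℂ) := by
  have hpi := Real.pi_pos
  have hb : 0 < ((Real.pi / M ^ 2 : ℝ) : ℂ).re := by
    rw [Complex.ofReal_re]; positivity
  have h := fourier_gaussian_innerProductSpace hb (-w)
  rw [Real.fourier_eq] at h
  have e1 : ((Real.pi : ℂ) / ((Real.pi / M ^ 2 : ℝ) : ℂ)) ^ (Module.finrank ℝ V / 2 : ℂ) =
      ((M ^ Module.finrank ℝ V : ℝ) : ℂ) := by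
    have : (Real.pi : ℂ) / ((Real.pi / M ^ 2 : ℝ) : ℂ) = ((M ^ 2 : ℝ) : ℂ) := by
      push_cast
      have : (Real.pi : ℂ) ≠ 0 := by exact_mod_cast hpi.ne'
      have : (M : ℂ) ≠ 0 := by exact_mod_cast hM.ne'
      field_simp
    rw [this]
    have e2 : (Module.finrank ℝ V / 2 : ℂ) = ((Module.finrank ℝ V / 2 : ℝ) : ℂ) := by push_cast; rfl
    rw [e2, ← Complex.ofReal_cpow (by positivity), ← Real.rpow_natCast, ← Real.rpow_natCast,
      ← Real.rpow_mul hM.le]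
    congr 2
    push_cast
    ring
  rw [e1] at h
  convert h using 1
  · refine integral_congr_ae (Filter.Eventually.of_forall fun v => ?_)
    simp only [inner_neg_right, neg_neg, Circle.smul_def, smul_eq_mul]
    rw [mul_comm]
    push_cast
    ring_nf
  · push_cast
    congr 2
    rw [norm_neg]
    have : (Real.pi : ℂ) ≠ 0 := by exact_mod_cast hpi.ne'
    have : (M : ℂ) ≠ 0 := by exact_mod_cast hM.ne'
    field_simp

end OscillatoryIntegrals

/-! ### Local smoothing estimates for the propagator -/

section WaveEvolution

variable {d : ℕ} {ρ : EuclideanSpace ℝ (Fin d) → ℝ} {β : ℝ}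

/-- The function `x ↦ ∫ e^{2πi(⟨ξ, x⟩ + τ ρ(ξ))} b(ξ) dξ`: the solution at time `τ` of the
dispersive equation with symbol `ρ` whose initial datum has Fourier transform `b`. -/
noncomputable def waveEvolution (ρ : EuclideanSpace ℝ (Fin d) → ℝ)
    (b : EuclideanSpace ℝ (Fin d) → ℂ) (τ : ℝ) (x : EuclideanSpace ℝ (Fin d)) : ℂ :=
  ∫ ξ, (Real.fourierChar (inner ℝ ξ x + τ * ρ ξ) : ℂ) * b ξ

theorem waveEvolution_eq_fourierInv (b : EuclideanSpace ℝ (Fin d) → ℂ) (τ : ℝ)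
    (x : EuclideanSpace ℝ (Fin d)) :
    waveEvolution ρ b τ x = 𝓕⁻ (fun ξ => (Real.fourierChar (τ * ρ ξ) : ℂ) * b ξ) x := by
  rw [Real.fourierInv_eq, waveEvolution]
  refine integral_congr_ae (Filter.Eventually.of_forall fun ξ => ?_)
  simp only [AddChar.map_add_eq_mul, Circle.coe_mul, Circle.smul_def, smul_eq_mul, mul_assoc]

theorem measurable_coe_fourierChar : Measurable fun r : ℝ => (Real.fourierChar r : ℂ) :=
  (continuous_subtype_val.comp Real.continuous_fourierChar).measurable

theorem aestronglyMeasurable_fourierChar_mul {X : Type*} [MeasurableSpace X] {μ : Measure X}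
    {φ : X → ℝ} (hφ : Measurable φ) {b : X → ℂ} (hb : AEStronglyMeasurable b μ) :
    AEStronglyMeasurable (fun x => (Real.fourierChar (φ x) : ℂ) * b x) μ :=
  (measurable_coe_fourierChar.comp hφ).aestronglyMeasurable.mul hb

theorem integrable_fourierChar_mul {X : Type*} [MeasurableSpace X] {μ : Measure X}
    {φ : X → ℝ} (hφ : Measurable φ) {b : X → ℂ} (hb : Integrable b μ) :
    Integrable (fun x => (Real.fourierChar (φ x) : ℂ) * b x) μ :=
  hb.mono (aestronglyMeasurable_fourierChar_mul hφ hb.aestronglyMeasurable)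
    (Filter.Eventually.of_forall fun x => by simp [Circle.norm_coe])

theorem stronglyMeasurable_waveEvolution (hρ : Measurable ρ)
    {b : EuclideanSpace ℝ (Fin d) → ℂ} (hb : AEStronglyMeasurable b) :
    StronglyMeasurable fun p : ℝ × EuclideanSpace ℝ (Fin d) => waveEvolution ρ b p.1 p.2 := by
  have h : (fun p : ℝ × EuclideanSpace ℝ (Fin d) => waveEvolution ρ b p.1 p.2) =
      fun p => ∫ ξ, (Real.fourierChar (inner ℝ ξ p.2 + p.1 * ρ ξ) : ℂ) * hb.mk b ξ := by
    ext p
    refine integral_congr_ae ?_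
    filter_upwards [hb.ae_eq_mk] with ξ hξ
    rw [hξ]
  rw [h]
  refine StronglyMeasurable.integral_prod_right
    (f := fun (p : ℝ × EuclideanSpace ℝ (Fin d)) ξ =>
      (Real.fourierChar (inner ℝ ξ p.2 + p.1 * ρ ξ) : ℂ) * hb.mk b ξ) ?_
  have hm : Measurable fun q : (ℝ × EuclideanSpace ℝ (Fin d)) × EuclideanSpace ℝ (Fin d) =>
      inner ℝ q.2 q.1.2 + q.1.1 * ρ q.2 := by fun_prop
  exact (measurable_coe_fourierChar.comp hm).stronglyMeasurable.mul
    (hb.stronglyMeasurable_mk.comp_measurable measurable_snd)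

theorem measurable_waveEvolution (hρ : Measurable ρ)
    {b : EuclideanSpace ℝ (Fin d) → ℂ} (hb : AEStronglyMeasurable b) :
    Measurable fun p : ℝ × EuclideanSpace ℝ (Fin d) => waveEvolution ρ b p.1 p.2 :=
  (stronglyMeasurable_waveEvolution hρ hb).measurable

theorem measurable_waveEvolution_comp {X : Type*} [MeasurableSpace X] (hρ : Measurable ρ)
    {b : EuclideanSpace ℝ (Fin d) → ℂ} (hb : AEStronglyMeasurable b) {f : X → ℝ}
    {g : X → EuclideanSpace ℝ (Fin d)} (hf : Measurable f) (hg : Measurable g) :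
    Measurable fun z => waveEvolution ρ b (f z) (g z) := by
  have h := measurable_waveEvolution hρ hb
  have h2 := hf.prodMk hg
  have h3 := h.comp h2
  unfold Function.comp at h3
  exact h3

/-- Conservation of the `L²` norm. -/
theorem lintegral_waveEvolution_sq (hρ : Measurable ρ) {b : EuclideanSpace ℝ (Fin d) → ℂ}
    (hb : Integrable b) (hb2 : MemLp b 2) (τ : ℝ) :
    ∫⁻ x, ‖waveEvolution ρ b τ x‖ₑ ^ 2 = ∫⁻ ξ, ‖b ξ‖ₑ ^ 2 := by
  have hm : Measurable fun ξ => τ * ρ ξ := by fun_prop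
  have h1 := integrable_fourierChar_mul hm hb
  have hn : ∀ ξ, ‖(Real.fourierChar (τ * ρ ξ) : ℂ) * b ξ‖ₑ = ‖b ξ‖ₑ := fun ξ => by
    rw [enorm_mul, ← ofReal_norm, Circle.norm_coe, ENNReal.ofReal_one, one_mul]
  have h2 : MemLp (fun ξ => (Real.fourierChar (τ * ρ ξ) : ℂ) * b ξ) 2 :=
    hb2.congr_enorm h1.aestronglyMeasurable (Filter.Eventually.of_forall fun ξ => (hn ξ).symm)
  have h := eLpNorm_fourierInv_two h1 h2
  simp only [waveEvolution_eq_fourierInv]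
  rw [← eLpNorm_two_sq, h, eLpNorm_two_sq]
  simp only [hn]

/-- A homogeneous distance function is bounded below away from the origin. -/
theorem closedAnnulus_lower_bound (hρ : IsHomogeneousDistance ρ β) {r : ℝ} (hr : 0 < r) :
    ∃ c : ℝ, 0 < c ∧ ∀ R, ∀ η ∈ closedAnnulus d r R, c ≤ ρ η := by
  obtain ⟨c, C, hc, -, hcC⟩ := hρ.exists_bounds
  refine ⟨c * r ^ β, by positivity, fun R η hη => ?_⟩
  have h0 : η ≠ 0 := by
    rintro rfl
    have := hη.1
    rw [norm_zero] at this
    linarith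
  refine le_trans ?_ (hcC η h0).1
  have := hη.1
  have := hρ.degree_pos
  gcongr

/-- The Gaussian weight `e^{-π τ² / Λ²}` is bounded below for `|τ| ≤ Λ`. -/
theorem one_le_exp_pi_mul_gaussian {t Λ : ℝ} (hΛ : 0 < Λ) (h0 : 0 ≤ t) (h : t ≤ Λ) :
    (1 : ℝ≥0∞) ≤ ENNReal.ofReal (Real.exp Real.pi) *
      ENNReal.ofReal (Real.exp (-(Real.pi / Λ ^ 2) * t ^ 2)) := by
  rw [← ENNReal.ofReal_mul (Real.exp_pos _).le, ← Real.exp_add, ENNReal.one_le_ofReal,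
    Real.one_le_exp_iff]
  have h2 : t ^ 2 ≤ Λ ^ 2 := by gcongr
  have : Real.pi / Λ ^ 2 * t ^ 2 ≤ Real.pi := by
    rw [div_mul_eq_mul_div, div_le_iff₀ (by positivity)]
    exact mul_le_mul_of_nonneg_left h2 Real.pi_pos.le
  linarith

theorem integrable_gaussian_norm {V : Type*} [NormedAddCommGroup V] [InnerProductSpace ℝ V]
    [FiniteDimensional ℝ V] [MeasurableSpace V] [BorelSpace V] {a : ℝ} (ha : 0 < a) :
    Integrable fun v : V => Real.exp (-a * ‖v‖ ^ 2) := by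
  have h := GaussianFourier.integrable_cexp_neg_mul_sq_norm_add (V := V) (b := (a : ℂ))
    (by simpa using ha) 0 0
  refine h.norm.congr (Filter.Eventually.of_forall fun v => ?_)
  simp [Complex.norm_exp, ← Complex.ofReal_pow]

theorem lintegral_gaussian_norm {V : Type*} [NormedAddCommGroup V] [InnerProductSpace ℝ V]
    [FiniteDimensional ℝ V] [MeasurableSpace V] [BorelSpace V] {a : ℝ} (ha : 0 < a) (w : V) :
    ∫⁻ v : V, ENNReal.ofReal (Real.exp (-a * ‖w - v‖ ^ 2)) =
      ENNReal.ofReal ((Real.pi / a) ^ (Module.finrank ℝ V / 2 : ℝ)) := by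
  rw [lintegral_sub_left_eq_self (fun v : V => ENNReal.ofReal (Real.exp (-a * ‖v‖ ^ 2))) w,
    ← ofReal_integral_eq_lintegral_ofReal (integrable_gaussian_norm ha)
      (Filter.Eventually.of_forall fun v => (Real.exp_pos _).le),
    GaussianFourier.integral_rexp_neg_mul_sq_norm ha]

/-- The approximate identity on `ℝ` that is the Fourier transform of a Gaussian weight. -/
noncomputable def gaussianBump (Λ u : ℝ) : ℝ≥0∞ :=
  ENNReal.ofReal (Λ * Real.exp (-(Real.pi * Λ ^ 2) * u ^ 2))

theorem measurable_gaussianBump (Λ : ℝ) : Measurable (gaussianBump Λ) := by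
  unfold gaussianBump; fun_prop

theorem lintegral_gaussianBump {Λ : ℝ} (hΛ : 0 < Λ) (y : ℝ) :
    ∫⁻ u, gaussianBump Λ (y - u) = 1 := by
  have hpi := Real.pi_pos
  have h := lintegral_gaussian_norm (V := ℝ) (a := Real.pi * Λ ^ 2) (by positivity) y
  simp only [gaussianBump, ENNReal.ofReal_mul hΛ.le]
  rw [lintegral_const_mul' _ _ ENNReal.ofReal_ne_top]
  simp only [Real.norm_eq_abs, sq_abs] at h
  rw [h, ← ENNReal.ofReal_mul hΛ.le, ENNReal.ofReal_eq_one, Module.finrank_self,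
    div_mul_cancel_left₀ hpi.ne', Nat.cast_one, ← Real.sqrt_eq_rpow, Real.sqrt_inv,
    Real.sqrt_sq hΛ.le, mul_inv_cancel₀ hΛ.ne']

theorem enorm_integral_gaussian_fourierChar_le {Λ : ℝ} (hΛ : 0 < Λ) (u : ℝ) :
    ‖∫ τ : ℝ, ((Real.exp (-(Real.pi / Λ ^ 2) * |τ| ^ 2) : ℝ) : ℂ) *
      (Real.fourierChar (τ * u) : ℂ)‖ₑ ≤ gaussianBump Λ u := by
  have h := integral_gaussian_mul_fourierChar hΛ u
  simp only [Real.norm_eq_abs, Module.finrank_self, pow_one] at h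
  have h' : ∀ τ : ℝ, inner ℝ τ u = τ * u := fun τ => by simp [mul_comm]
  simp only [h'] at h
  rw [h, ← ofReal_norm, Complex.norm_real, Real.norm_of_nonneg (by positivity), sq_abs,
    gaussianBump]

/-- Local smoothing at a single point: `∫ |waveEvolution ρ b τ x|² dτ ≲ ‖b‖₂²`, uniformly in `x`,
for `b` supported in a fixed annulus. -/
theorem IsHomogeneousDistance.exists_lintegral_waveEvolution_sq_le
    (hρ : IsHomogeneousDistance ρ β) {r R : ℝ} (hr : 0 < r) :
    ∃ A : ℝ≥0, ∀ b : EuclideanSpace ℝ (Fin d) → ℂ, Integrable b →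
      (∀ ξ, ξ ∉ closedAnnulus d r R → b ξ = 0) → ∀ x, ∀ Λ : ℝ, 0 < Λ →
      ∫⁻ τ in Icc (-Λ) Λ, ‖waveEvolution ρ b τ x‖ₑ ^ 2 ≤ A * ∫⁻ ξ, ‖b ξ‖ₑ ^ 2 := by
  obtain ⟨c, hc, hcρ⟩ := closedAnnulus_lower_bound hρ (r := r / Real.exp 1) (by positivity)
  set A : ℝ≥0∞ := ENNReal.ofReal (1 * (Real.exp d * (1 / (β * c)))) *
        ((∫⁻ η in closedAnnulus d (r / Real.exp 1) R, 1) * 1) with hA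
  have hAt : A ≠ ∞ := by
    refine ENNReal.mul_ne_top ENNReal.ofReal_ne_top (ENNReal.mul_ne_top ?_ ENNReal.one_ne_top)
    rw [setLIntegral_one]
    exact (isCompact_closedAnnulus _ _).measure_lt_top.ne
  refine ⟨(ENNReal.ofReal (Real.exp Real.pi) * A).toNNReal, fun b hb hbs x Λ hΛ => ?_⟩
  rw [ENNReal.coe_toNNReal (ENNReal.mul_ne_top ENNReal.ofReal_ne_top hAt)]
  have hpi := Real.pi_pos
  have hρm := hρ.measurable
  have hφ : Measurable (Function.uncurry fun (τ : ℝ) (ξ : EuclideanSpace ℝ (Fin d)) =>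
      inner ℝ ξ x + τ * ρ ξ) := by
    fun_prop
  have hw : Integrable fun τ : ℝ => Real.exp (-(Real.pi / Λ ^ 2) * |τ| ^ 2) :=
    integrable_gaussian_norm (V := ℝ) (by positivity)
  -- Schur's test: the Gaussian weight in `τ` produces the kernel `gaussianBump Λ (ρ ξ - ρ η)`,
  -- whose integral in `η` over the annulus is bounded uniformly in `Λ`
  have hmain := lintegral_weight_mul_oscillatory_sq_le (ν := volume) (μ := volume) hφ hw
    (fun τ => (Real.exp_pos _).le) (K := fun ξ η => gaussianBump Λ (ρ ξ - ρ η))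
    ((measurable_gaussianBump Λ).comp (by fun_prop))
    (fun ξ η => by simp only [gaussianBump]; congr 4; ring)
    (fun ξ η => by
      have := enorm_integral_gaussian_fourierChar_le hΛ (ρ ξ - ρ η)
      refine le_trans (le_of_eq ?_) this
      have e : ∀ τ : ℝ, inner ℝ ξ x + τ * ρ ξ - (inner ℝ η x + τ * ρ η) =
          (inner ℝ ξ x - inner ℝ η x) + τ * (ρ ξ - ρ η) := fun τ => by ring
      simp only [e, AddChar.map_add_eq_mul, Circle.coe_mul]
      simp only [mul_left_comm _ ((Real.fourierChar (inner ℝ ξ x - inner ℝ η x) : Circle) : ℂ)]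
      rw [integral_const_mul, enorm_mul, ← ofReal_norm, Circle.norm_coe, ENNReal.ofReal_one,
        one_mul])
    (measurableSet_closedAnnulus r R) (A := A)
    (fun ξ _ => by
      have := hρ.lintegral_annulus_mul_comp_le hr le_rfl hc (hcρ R) (G := 1) (G' := 1)
        measurable_one measurable_one (fun _ _ _ _ => le_rfl)
        (Γ := fun u => gaussianBump Λ (ρ ξ - u)) ((measurable_gaussianBump Λ).comp (by fun_prop))
      rw [lintegral_gaussianBump hΛ] at this
      simpa [hA] using this) hb hbs
  calc ∫⁻ τ in Icc (-Λ) Λ, ‖waveEvolution ρ b τ x‖ₑ ^ 2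
      ≤ ∫⁻ τ in Icc (-Λ) Λ, ENNReal.ofReal (Real.exp Real.pi) *
          (ENNReal.ofReal (Real.exp (-(Real.pi / Λ ^ 2) * |τ| ^ 2)) *
            ‖waveEvolution ρ b τ x‖ₑ ^ 2) := by
        refine setLIntegral_mono' measurableSet_Icc fun τ hτ => ?_
        rw [← mul_assoc]
        exact le_mul_of_one_le_left' (one_le_exp_pi_mul_gaussian hΛ (abs_nonneg τ) (abs_le.2 hτ))
    _ ≤ ENNReal.ofReal (Real.exp Real.pi) *
          ∫⁻ τ, ENNReal.ofReal (Real.exp (-(Real.pi / Λ ^ 2) * |τ| ^ 2)) *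
            ‖waveEvolution ρ b τ x‖ₑ ^ 2 := by
        rw [lintegral_const_mul' _ _ ENNReal.ofReal_ne_top]
        gcongr
        exact Measure.restrict_le_self
    _ ≤ _ := by
        rw [mul_assoc]
        gcongr
        exact hmain

/-- A dilation by `e^s` with `0 ≤ s ≤ 1/M` moves a point of norm `≤ R` by `O(1/M)`, hence changes a
Gaussian of width `1/M` by at most a constant factor, after doubling its variance. -/
theorem gaussian_comp_exp_smul_bound {V : Type*} [NormedAddCommGroup V] [InnerProductSpace ℝ V]
    {R M s : ℝ} (hM : 1 ≤ M) (hs : s ∈ Icc 0 (1 / M)) {ξ η : V} (hη : ‖η‖ ≤ R) :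
    -(Real.pi * M ^ 2) * ‖ξ - Real.exp s • η‖ ^ 2 ≤
      Real.pi * (Real.exp 1 * R) ^ 2 + -(Real.pi * M ^ 2 / 2) * ‖ξ - η‖ ^ 2 := by
  have hM0 : 0 < M := one_pos.trans_le hM
  have hpi := Real.pi_pos
  have hs1 : s ≤ 1 := hs.2.trans (by rw [div_le_one hM0]; exact hM)
  have hes : Real.exp s - 1 ≤ Real.exp 1 * s := by
    have h1 : 1 - s ≤ Real.exp (-s) := by linarith [Real.add_one_le_exp (-s)]
    have h2 : Real.exp s * (1 - s) ≤ 1 := by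
      calc Real.exp s * (1 - s) ≤ Real.exp s * Real.exp (-s) := by gcongr
        _ = 1 := by rw [← Real.exp_add]; simp
    have h3 : Real.exp s * s ≤ Real.exp 1 * s := by
      have := hs.1
      gcongr
    linarith
  have hes0 : 0 ≤ Real.exp s - 1 := by linarith [Real.one_le_exp hs.1]
  have hd1 : ‖Real.exp s • η - η‖ ≤ Real.exp 1 * R / M := by
    have : Real.exp s • η - η = (Real.exp s - 1) • η := by rw [sub_smul, one_smul]
    rw [this, norm_smul, Real.norm_of_nonneg hes0]
    calc (Real.exp s - 1) * ‖η‖ ≤ (Real.exp 1 * (1 / M)) * R := by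
          gcongr
          · exact hes.trans (by gcongr; exact hs.2)
      _ = Real.exp 1 * R / M := by ring
  have htri : ‖ξ - η‖ ≤ ‖ξ - Real.exp s • η‖ + Real.exp 1 * R / M := by
    have : ξ - η = (ξ - Real.exp s • η) + (Real.exp s • η - η) := by abel
    rw [this]
    exact (norm_add_le _ _).trans (by gcongr)
  have hsq : ‖ξ - η‖ ^ 2 ≤ 2 * ‖ξ - Real.exp s • η‖ ^ 2 + 2 * (Real.exp 1 * R / M) ^ 2 := by
    calc ‖ξ - η‖ ^ 2 ≤ (‖ξ - Real.exp s • η‖ + Real.exp 1 * R / M) ^ 2 := by gcongr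
      _ ≤ _ := by nlinarith [sq_nonneg (‖ξ - Real.exp s • η‖ - Real.exp 1 * R / M)]
  have h4 : M ^ 2 * (Real.exp 1 * R / M) ^ 2 = (Real.exp 1 * R) ^ 2 := by
    field_simp
  have h5 : Real.pi * M ^ 2 / 2 * ‖ξ - η‖ ^ 2 ≤ Real.pi * M ^ 2 * ‖ξ - Real.exp s • η‖ ^ 2 +
      Real.pi * (Real.exp 1 * R) ^ 2 := by
    rw [← h4]
    calc Real.pi * M ^ 2 / 2 * ‖ξ - η‖ ^ 2 ≤ Real.pi * M ^ 2 / 2 *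
          (2 * ‖ξ - Real.exp s • η‖ ^ 2 + 2 * (Real.exp 1 * R / M) ^ 2) := by gcongr
      _ = _ := by ring
  linarith

/-- The convolution kernel on `ℝ^d` that is the Fourier transform of a Gaussian weight of width
`M`. -/
noncomputable def gaussianKernel (M : ℝ) (ξ η : EuclideanSpace ℝ (Fin d)) : ℝ≥0∞ :=
  ENNReal.ofReal (M ^ d * Real.exp (-(Real.pi * M ^ 2) * ‖ξ - η‖ ^ 2))

theorem measurable_gaussianKernel (M : ℝ) :
    Measurable (Function.uncurry (gaussianKernel (d := d) M)) := by
  unfold gaussianKernel; fun_prop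

theorem measurable_gaussianKernel_right (M : ℝ) (ξ : EuclideanSpace ℝ (Fin d)) :
    Measurable (gaussianKernel M ξ) := by
  unfold gaussianKernel; fun_prop

/-- The bound for Schur's test: near each level set of `ρ`, the Gaussian kernel of width `M` has
mass `O(M)`. -/
theorem IsHomogeneousDistance.lintegral_gaussianKernel_mul_gaussianBump_le
    (hρ : IsHomogeneousDistance ρ β) {r R c M Λ : ℝ} (hr : 0 < r) (hc : 0 < c)
    (hcρ : ∀ η ∈ closedAnnulus d (r / Real.exp 1) R, c ≤ ρ η) (hM : 1 ≤ M) (hΛ : 0 < Λ)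
    (ξ : EuclideanSpace ℝ (Fin d)) :
    ∫⁻ η in closedAnnulus d r R, gaussianKernel M ξ η * gaussianBump Λ (ρ ξ - ρ η) ≤
      ENNReal.ofReal ((Real.exp d * (1 / (β * c))) *
        (Real.exp (Real.pi * (Real.exp 1 * R) ^ 2) * 2 ^ ((d : ℝ) / 2))) * ENNReal.ofReal M := by
  have hM0 : 0 < M := one_pos.trans_le hM
  have hpi := Real.pi_pos
  set D : ℝ := Real.exp (Real.pi * (Real.exp 1 * R) ^ 2) * 2 ^ ((d : ℝ) / 2) with hD
  set G' : EuclideanSpace ℝ (Fin d) → ℝ≥0∞ := fun η =>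
    ENNReal.ofReal (M ^ d * Real.exp (Real.pi * (Real.exp 1 * R) ^ 2)) *
      ENNReal.ofReal (Real.exp (-(Real.pi * M ^ 2 / 2) * ‖ξ - η‖ ^ 2)) with hG'
  have hG'm : Measurable G' := by simp only [hG']; fun_prop
  have hGG' : ∀ η ∈ closedAnnulus d (r / Real.exp 1) R, ∀ s ∈ Icc 0 (1 / M),
      gaussianKernel M ξ (Real.exp s • η) ≤ G' η := by
    intro η hη s hs
    simp only [gaussianKernel, hG']
    rw [← ENNReal.ofReal_mul (by positivity), mul_assoc, ← Real.exp_add]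
    gcongr
    exact gaussian_comp_exp_smul_bound hM hs hη.2
  have := hρ.lintegral_annulus_mul_comp_le hr hM hc hcρ (G := gaussianKernel M ξ) (G' := G')
    (measurable_gaussianKernel_right M ξ) hG'm hGG'
    (Γ := fun u => gaussianBump Λ (ρ ξ - u)) ((measurable_gaussianBump Λ).comp
      (measurable_const.sub measurable_id))
  rw [lintegral_gaussianBump hΛ, mul_one] at this
  refine this.trans ?_
  have hG'i : ∫⁻ η in closedAnnulus d (r / Real.exp 1) R, G' η ≤ ENNReal.ofReal D := by
    refine (lintegral_mono' Measure.restrict_le_self le_rfl).trans (le_of_eq ?_)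
    simp only [hG']
    rw [lintegral_const_mul' _ _ ENNReal.ofReal_ne_top, lintegral_gaussian_norm (by positivity),
      ← ENNReal.ofReal_mul (by positivity), finrank_euclideanSpace, Fintype.card_fin, hD]
    congr 1
    have : Real.pi / (Real.pi * M ^ 2 / 2) = 2 * (M ^ 2)⁻¹ := by field_simp
    rw [this, Real.mul_rpow (by positivity) (by positivity), Real.inv_rpow (by positivity),
      ← Real.rpow_natCast M 2, ← Real.rpow_mul hM0.le, Nat.cast_ofNat,
      mul_div_cancel₀ _ two_ne_zero, Real.rpow_natCast]
    field_simp
  calc _ ≤ ENNReal.ofReal (M * (Real.exp d * (1 / (β * c)))) * ENNReal.ofReal D := by gcongr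
    _ = _ := by
      have := hρ.degree_pos
      rw [← ENNReal.ofReal_mul (by positivity), ← ENNReal.ofReal_mul (by positivity)]
      congr 1; ring

theorem enorm_integral_gaussian_prod_le {M Λ : ℝ} (hM0 : 0 < M) (hΛ : 0 < Λ)
    (ξ η : EuclideanSpace ℝ (Fin d)) (u v : ℝ) :
    ‖∫ z : EuclideanSpace ℝ (Fin d) × ℝ, ((Real.exp (-(Real.pi / M ^ 2) * ‖z.1‖ ^ 2) *
      Real.exp (-(Real.pi / Λ ^ 2) * |z.2| ^ 2) : ℝ) : ℂ) *
      (Real.fourierChar ((inner ℝ ξ z.1 + z.2 * u) - (inner ℝ η z.1 + z.2 * v)) : ℂ)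
      ∂(volume.prod volume)‖ₑ ≤ gaussianKernel M ξ η * gaussianBump Λ (u - v) := by
  have e : ∀ z : EuclideanSpace ℝ (Fin d) × ℝ,
      ((Real.exp (-(Real.pi / M ^ 2) * ‖z.1‖ ^ 2) *
        Real.exp (-(Real.pi / Λ ^ 2) * |z.2| ^ 2) : ℝ) : ℂ) *
      (Real.fourierChar ((inner ℝ ξ z.1 + z.2 * u) - (inner ℝ η z.1 + z.2 * v)) : ℂ) =
      (((Real.exp (-(Real.pi / M ^ 2) * ‖z.1‖ ^ 2) : ℝ) : ℂ) *
        (Real.fourierChar (inner ℝ z.1 (ξ - η)) : ℂ)) *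
      (((Real.exp (-(Real.pi / Λ ^ 2) * |z.2| ^ 2) : ℝ) : ℂ) *
        (Real.fourierChar (z.2 * (u - v)) : ℂ)) := by
    intro z
    have : (inner ℝ ξ z.1 + z.2 * u) - (inner ℝ η z.1 + z.2 * v) =
        inner ℝ z.1 (ξ - η) + z.2 * (u - v) := by
      rw [inner_sub_right, real_inner_comm ξ, real_inner_comm η]; ring
    rw [this, AddChar.map_add_eq_mul, Circle.coe_mul]
    push_cast
    ring
  simp only [e]
  rw [integral_prod_mul (fun x : EuclideanSpace ℝ (Fin d) =>
      ((Real.exp (-(Real.pi / M ^ 2) * ‖x‖ ^ 2) : ℝ) : ℂ) *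
        (Real.fourierChar (inner ℝ x (ξ - η)) : ℂ))
      (fun τ : ℝ => ((Real.exp (-(Real.pi / Λ ^ 2) * |τ| ^ 2) : ℝ) : ℂ) *
        (Real.fourierChar (τ * (u - v)) : ℂ)), enorm_mul]
  gcongr
  · rw [integral_gaussian_mul_fourierChar hM0, gaussianKernel, ← ofReal_norm, Complex.norm_real,
      Real.norm_of_nonneg (by positivity), finrank_euclideanSpace, Fintype.card_fin]
  · exact enorm_integral_gaussian_fourierChar_le hΛ _

/-- Local smoothing on balls: `∫_{|x| ≤ M} ∫ |waveEvolution ρ b τ x|² dτ dx ≲ M ‖b‖₂²` for `M ≥ 1`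
and `b` supported in a fixed annulus. It is a form of the trace theorem for the level sets of `ρ`.
-/
theorem IsHomogeneousDistance.exists_lintegral_ball_waveEvolution_sq_le
    (hρ : IsHomogeneousDistance ρ β) {r R : ℝ} (hr : 0 < r) :
    ∃ A : ℝ≥0, ∀ b : EuclideanSpace ℝ (Fin d) → ℂ, Integrable b →
      (∀ ξ, ξ ∉ closedAnnulus d r R → b ξ = 0) → ∀ M : ℝ, 1 ≤ M → ∀ Λ : ℝ, 0 < Λ →
      ∫⁻ x in Metric.closedBall 0 M, ∫⁻ τ in Icc (-Λ) Λ, ‖waveEvolution ρ b τ x‖ₑ ^ 2 ≤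
        A * ENNReal.ofReal M * ∫⁻ ξ, ‖b ξ‖ₑ ^ 2 := by
  obtain ⟨c, hc, hcρ⟩ := closedAnnulus_lower_bound hρ (r := r / Real.exp 1) (by positivity)
  have hpi := Real.pi_pos
  set D : ℝ := Real.exp (Real.pi * (Real.exp 1 * R) ^ 2) * 2 ^ ((d : ℝ) / 2) with hD
  refine ⟨(ENNReal.ofReal (Real.exp Real.pi) ^ 2 * ENNReal.ofReal
    ((Real.exp d * (1 / (β * c))) * D)).toNNReal, fun b hb hbs M hM Λ hΛ => ?_⟩
  rw [ENNReal.coe_toNNReal (by finiteness)]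
  have hM0 : 0 < M := one_pos.trans_le hM
  have hρm := hρ.measurable
  have hφ : Measurable (Function.uncurry fun (z : EuclideanSpace ℝ (Fin d) × ℝ)
      (ξ : EuclideanSpace ℝ (Fin d)) => inner ℝ ξ z.1 + z.2 * ρ ξ) := by
    fun_prop
  have hw1 : Integrable fun x : EuclideanSpace ℝ (Fin d) =>
      Real.exp (-(Real.pi / M ^ 2) * ‖x‖ ^ 2) := integrable_gaussian_norm (by positivity)
  have hw2 : Integrable fun τ : ℝ => Real.exp (-(Real.pi / Λ ^ 2) * |τ| ^ 2) :=
    integrable_gaussian_norm (V := ℝ) (by positivity)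
  have hw := hw1.mul_prod hw2
  -- the weights in `x` and `τ` have widths `M` and `Λ`, and are bounded below on the region of
  -- integration
  have hmain := lintegral_weight_mul_oscillatory_sq_le (ν := volume.prod volume) (μ := volume) hφ hw
    (fun z => by positivity) (K := fun ξ η => gaussianKernel M ξ η * gaussianBump Λ (ρ ξ - ρ η))
    ((measurable_gaussianKernel M).mul ((measurable_gaussianBump Λ).comp (by fun_prop)))
    (fun ξ η => by
      simp only [gaussianBump, gaussianKernel, norm_sub_rev ξ η]; congr 5; ring)
    (fun ξ η => enorm_integral_gaussian_prod_le hM0 hΛ ξ η (ρ ξ) (ρ η))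
    (measurableSet_closedAnnulus r R)
    (A := ENNReal.ofReal ((Real.exp d * (1 / (β * c))) * D) * ENNReal.ofReal M)
    (fun ξ _ => hρ.lintegral_gaussianKernel_mul_gaussianBump_le hr hc (hcρ R) hM hΛ ξ) hb hbs
  have hmeas : Measurable fun z : EuclideanSpace ℝ (Fin d) × ℝ =>
      ENNReal.ofReal (Real.exp (-(Real.pi / M ^ 2) * ‖z.1‖ ^ 2) *
        Real.exp (-(Real.pi / Λ ^ 2) * |z.2| ^ 2)) * ‖waveEvolution ρ b z.2 z.1‖ₑ ^ 2 := by
    have h1 : Measurable fun z : EuclideanSpace ℝ (Fin d) × ℝ => waveEvolution ρ b z.2 z.1 :=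
      measurable_waveEvolution_comp hρm hb.aestronglyMeasurable measurable_snd measurable_fst
    have h2 : Measurable fun z : EuclideanSpace ℝ (Fin d) × ℝ =>
        Real.exp (-(Real.pi / M ^ 2) * ‖z.1‖ ^ 2) * Real.exp (-(Real.pi / Λ ^ 2) * |z.2| ^ 2) := by
      fun_prop
    exact h2.ennreal_ofReal.mul (h1.enorm.pow_const 2)
  have hfin : ENNReal.ofReal (Real.exp Real.pi) ^ 2 ≠ ∞ := ENNReal.pow_ne_top ENNReal.ofReal_ne_top
  calc ∫⁻ x in Metric.closedBall 0 M, ∫⁻ τ in Icc (-Λ) Λ, ‖waveEvolution ρ b τ x‖ₑ ^ 2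
      ≤ ∫⁻ x in Metric.closedBall (0 : EuclideanSpace ℝ (Fin d)) M, ∫⁻ τ in Icc (-Λ) Λ,
          ENNReal.ofReal (Real.exp Real.pi) ^ 2 *
          (ENNReal.ofReal (Real.exp (-(Real.pi / M ^ 2) * ‖x‖ ^ 2) *
            Real.exp (-(Real.pi / Λ ^ 2) * |τ| ^ 2)) * ‖waveEvolution ρ b τ x‖ₑ ^ 2) := by
        refine setLIntegral_mono' measurableSet_closedBall fun x hx => ?_
        refine setLIntegral_mono' measurableSet_Icc fun τ hτ => ?_
        rw [← mul_assoc]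
        refine le_mul_of_one_le_left' ?_
        rw [ENNReal.ofReal_mul (Real.exp_pos _).le, sq, mul_mul_mul_comm]
        exact one_le_mul (one_le_exp_pi_mul_gaussian hM0 (norm_nonneg x) (by simpa using hx))
          (one_le_exp_pi_mul_gaussian hΛ (abs_nonneg τ) (abs_le.2 hτ))
    _ ≤ ∫⁻ x : EuclideanSpace ℝ (Fin d), ∫⁻ τ : ℝ,
          ENNReal.ofReal (Real.exp Real.pi) ^ 2 *
          (ENNReal.ofReal (Real.exp (-(Real.pi / M ^ 2) * ‖x‖ ^ 2) *
            Real.exp (-(Real.pi / Λ ^ 2) * |τ| ^ 2)) * ‖waveEvolution ρ b τ x‖ₑ ^ 2) := by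
        refine lintegral_mono' Measure.restrict_le_self fun x => ?_
        exact lintegral_mono' Measure.restrict_le_self le_rfl
    _ = ENNReal.ofReal (Real.exp Real.pi) ^ 2 * ∫⁻ z : EuclideanSpace ℝ (Fin d) × ℝ,
          ENNReal.ofReal (Real.exp (-(Real.pi / M ^ 2) * ‖z.1‖ ^ 2) *
            Real.exp (-(Real.pi / Λ ^ 2) * |z.2| ^ 2)) * ‖waveEvolution ρ b z.2 z.1‖ₑ ^ 2
          ∂(volume.prod volume) := by
        rw [lintegral_prod (fun z : EuclideanSpace ℝ (Fin d) × ℝ =>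
          ENNReal.ofReal (Real.exp (-(Real.pi / M ^ 2) * ‖z.1‖ ^ 2) *
            Real.exp (-(Real.pi / Λ ^ 2) * |z.2| ^ 2)) * ‖waveEvolution ρ b z.2 z.1‖ₑ ^ 2)
            hmeas.aemeasurable, ← lintegral_const_mul' _ _ hfin]
        refine lintegral_congr fun x => ?_
        rw [lintegral_const_mul' _ _ hfin]
    _ ≤ _ := by
        rw [mul_assoc, mul_assoc]
        gcongr
        rw [← mul_assoc]
        exact hmain

end WaveEvolution

/-! ### Nonstationary phase -/

section NonstationaryPhase

variable {V : Type*} [NormedAddCommGroup V] [InnerProductSpace ℝ V] [FiniteDimensional ℝ V]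
  [MeasurableSpace V] [BorelSpace V]

/-- One integration by parts in the unit direction `e` against the oscillation
`e^{2πi Λ (⟨ξ, e⟩ + μ ψ(ξ))}`, whose phase has the `e`-derivative `Λ (1 + μ ∂_e ψ)`. -/
theorem integral_oscillation_mul_eq {ψ : V → ℝ} (hψ : ContDiff ℝ (⊤ : ℕ∞) ψ) {e : V}
    (he : ‖e‖ = 1) {μ Λ : ℝ} (hΛ : Λ ≠ 0) {F : V → ℂ} (hF : ContDiff ℝ (⊤ : ℕ∞) F)
    (hFc : HasCompactSupport F) :
    ∫ ξ, (Real.fourierChar (Λ * (inner ℝ ξ e + μ * ψ ξ)) : ℂ) *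
        (((1 + μ * fderiv ℝ ψ ξ e : ℝ) : ℂ) * F ξ) =
      -(1 / (2 * Real.pi * Λ * Complex.I)) *
        ∫ ξ, (Real.fourierChar (Λ * (inner ℝ ξ e + μ * ψ ξ)) : ℂ) * fderiv ℝ F ξ e := by
  set G : V → ℂ := fun ξ => (Real.fourierChar (Λ * (inner ℝ ξ e + μ * ψ ξ)) : ℂ) with hG
  have hGexp : G = fun ξ => Complex.exp ((2 * Real.pi * (Λ * (inner ℝ ξ e + μ * ψ ξ)) : ℝ) *
      Complex.I) := by
    ext ξ; exact Real.fourierChar_apply _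
  have hψd : Differentiable ℝ ψ := hψ.differentiable (by simp)
  have hder : ∀ ξ, HasFDerivAt G (G ξ • (Complex.I • (Complex.ofRealCLM.comp
      ((2 * Real.pi * Λ) • ((innerSL ℝ e : V →L[ℝ] ℝ) + μ • fderiv ℝ ψ ξ))))) ξ := by
    intro ξ
    have h1 : HasFDerivAt (fun ξ : V => 2 * Real.pi * (Λ * (inner ℝ ξ e + μ * ψ ξ)))
        ((2 * Real.pi * Λ) • ((innerSL ℝ e : V →L[ℝ] ℝ) + μ • fderiv ℝ ψ ξ)) ξ := by
      have h2 : HasFDerivAt (fun ξ : V => inner ℝ ξ e) (innerSL ℝ e : V →L[ℝ] ℝ) ξ := by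
        have := (innerSL ℝ e : V →L[ℝ] ℝ).hasFDerivAt (x := ξ)
        refine this.congr_of_eventuallyEq (Filter.Eventually.of_forall fun x => ?_)
        simp [real_inner_comm]
      have h3 := (h2.add ((hψd ξ).hasFDerivAt.const_mul μ)).const_mul (2 * Real.pi * Λ)
      refine h3.congr_of_eventuallyEq (Filter.Eventually.of_forall fun x => ?_)
      simp; ring
    have h4 := ((Complex.ofRealCLM.hasFDerivAt.comp ξ h1).mul_const Complex.I).cexp
    rw [hGexp]
    refine h4.congr_fderiv ?_
    ext v
    simp
  have hGd : Differentiable ℝ G := fun ξ => (hder ξ).differentiableAt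
  have hGe : ∀ ξ, fderiv ℝ G ξ e =
      (2 * Real.pi * Λ * Complex.I) * (G ξ * ((1 + μ * fderiv ℝ ψ ξ e : ℝ) : ℂ)) := by
    intro ξ
    rw [(hder ξ).fderiv]
    simp [he]
    ring
  have hGc : Continuous G := hGd.continuous
  have hFcont : Continuous F := hF.continuous
  have hF'c : Continuous fun ξ => fderiv ℝ F ξ e :=
    (hF.continuous_fderiv (by simp)).clm_apply continuous_const
  have hF'cs : HasCompactSupport fun ξ => fderiv ℝ F ξ e := hFc.fderiv_apply ℝ e
  have hψ'c : Continuous fun ξ => fderiv ℝ ψ ξ e :=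
    (hψ.continuous_fderiv (by simp)).clm_apply continuous_const
  have hG'c : Continuous fun ξ => fderiv ℝ G ξ e := by
    simp only [hGe]; fun_prop
  have hibp := integral_mul_fderiv_eq_neg_fderiv_mul_of_integrable (μ := volume) (f := G) (g := F)
    (v := e)
    ((hG'c.mul hFcont).integrable_of_hasCompactSupport hFc.mul_left)
    ((hGc.mul hF'c).integrable_of_hasCompactSupport hF'cs.mul_left)
    ((hGc.mul hFcont).integrable_of_hasCompactSupport hFc.mul_left)
    (fun x _ => hGd x) (fun x _ => hF.differentiable (by simp) x)
  have hne : (2 * Real.pi * Λ * Complex.I : ℂ) ≠ 0 := by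
    have := Real.pi_pos.ne'
    simp [this, hΛ]
  rw [hibp]
  simp only [hGe]
  rw [← integral_neg, ← integral_const_mul]
  refine integral_congr_ae (Filter.Eventually.of_forall fun ξ => ?_)
  show G ξ * (((1 + μ * fderiv ℝ ψ ξ e : ℝ) : ℂ) * F ξ) = _
  have hΛ' : (Λ : ℂ) ≠ 0 := by exact_mod_cast hΛ
  field_simp

/-- Nonstationary phase with parameters: if the phase `⟨ξ, e⟩ + μ ψ(ξ)` has no critical point
because `|μ| ‖ψ'‖ ≤ 1/2`, then the oscillatory integral decays rapidly, uniformly in `(e, μ)`. The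
amplitude `a (ξ, (e, μ))` depends smoothly on the parameters, so that compactness yields uniform
bounds after any number of integrations by parts. -/
theorem exists_norm_integral_oscillation_le {ψ : V → ℝ} (hψ : ContDiff ℝ (⊤ : ℕ∞) ψ) {L : ℝ}
    (hL : 0 < L) (hψL : ∀ ξ, ‖fderiv ℝ ψ ξ‖ ≤ L) {K : Set V} (hK : IsCompact K) (N : ℕ) :
    ∀ a : V × (V × ℝ) → ℂ, ContDiffOn ℝ (⊤ : ℕ∞) a {w | |w.2.2| * ‖w.2.1‖ * L < 1} →
      (∀ w, w.1 ∉ K → a w = 0) →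
      ∃ C : ℝ, ∀ e : V, ‖e‖ = 1 → ∀ μ : ℝ, |μ| ≤ 1 / (2 * L) → ∀ Λ : ℝ, 0 < Λ →
        ‖∫ ξ, (Real.fourierChar (Λ * (inner ℝ ξ e + μ * ψ ξ)) : ℂ) * a (ξ, (e, μ))‖ ≤
          C / Λ ^ N := by
  set W : Set (V × (V × ℝ)) := {w | |w.2.2| * ‖w.2.1‖ * L < 1} with hW
  have hWo : IsOpen W := isOpen_lt (by fun_prop) continuous_const
  set P : Set (V × ℝ) := Metric.sphere 0 1 ×ˢ Icc (-(1 / (2 * L))) (1 / (2 * L)) with hP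
  have hPc : IsCompact P := (isCompact_sphere 0 1).prod isCompact_Icc
  have hPW : ∀ ξ, ∀ p ∈ P, (ξ, p) ∈ W := by
    intro ξ p hp
    have h1 : ‖p.1‖ = 1 := by simpa using hp.1
    have h2 : |p.2| ≤ 1 / (2 * L) := abs_le.2 hp.2
    show |p.2| * ‖p.1‖ * L < 1
    rw [h1, mul_one]
    calc |p.2| * L ≤ 1 / (2 * L) * L := by gcongr
      _ = 1 / 2 := by field_simp
      _ < 1 := by norm_num
  have hmem : ∀ {e : V} {μ : ℝ}, ‖e‖ = 1 → |μ| ≤ 1 / (2 * L) → (e, μ) ∈ P := fun he hμ =>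
    ⟨by simpa using he, abs_le.1 hμ⟩
  induction N with
  | zero =>
    intro a ha haK
    have hcont : ContinuousOn a (K ×ˢ P) :=
      ha.continuousOn.mono fun w hw => hPW w.1 w.2 hw.2
    obtain ⟨C, hC⟩ := (hK.prod hPc).exists_bound_of_continuousOn hcont
    refine ⟨C * volume.real K, fun e he μ hμ Λ _ => ?_⟩
    rw [pow_zero, div_one]
    have hzero : ∀ ξ, ξ ∉ K →
        (Real.fourierChar (Λ * (inner ℝ ξ e + μ * ψ ξ)) : ℂ) * a (ξ, (e, μ)) = 0 := by
      intro ξ hξ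
      rw [haK _ hξ, mul_zero]
    rw [← setIntegral_eq_integral_of_forall_compl_eq_zero hzero]
    refine norm_setIntegral_le_of_norm_le_const hK.measure_lt_top fun ξ hξ => ?_
    rw [norm_mul, Circle.norm_coe, one_mul]
    exact hC _ ⟨hξ, hmem he hμ⟩
  | succ N ih =>
    intro a ha haK
    set q : V × (V × ℝ) → ℝ := fun w => 1 + w.2.2 * fderiv ℝ ψ w.1 w.2.1 with hq
    have hqs : ContDiff ℝ (⊤ : ℕ∞) q := by
      have h1 : ContDiff ℝ (⊤ : ℕ∞) (fderiv ℝ ψ) := hψ.fderiv_right (by simp)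
      exact contDiff_const.add (contDiff_snd.snd.mul
        ((h1.comp contDiff_fst).clm_apply contDiff_snd.fst))
    have hq0 : ∀ w ∈ W, 0 < q w := by
      intro w hw
      have h1 : |w.2.2 * fderiv ℝ ψ w.1 w.2.1| < 1 := by
        rw [abs_mul]
        refine lt_of_le_of_lt ?_ hw
        rw [mul_assoc]
        gcongr
        rw [mul_comm ‖w.2.1‖]
        exact ((fderiv ℝ ψ w.1).le_opNorm _).trans (by gcongr; exact hψL _)
      have := (abs_lt.1 h1).1
      show 0 < 1 + w.2.2 * fderiv ℝ ψ w.1 w.2.1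
      linarith
    -- one integration by parts replaces the amplitude `a` by the derivative of `a / q` in the
    -- direction `e`, which is an amplitude of the same kind
    set F : V × (V × ℝ) → ℂ := fun w => ((q w)⁻¹ : ℝ) * a w with hF
    have hFs : ContDiffOn ℝ (⊤ : ℕ∞) F W := by
      refine ContDiffOn.mul ?_ ha
      exact Complex.ofRealCLM.contDiff.comp_contDiffOn
        (hqs.contDiffOn.inv fun w hw => (hq0 w hw).ne')
    have hFK : ∀ w, w.1 ∉ K → F w = 0 := fun w hw => by simp [hF, haK w hw]
    set a' : V × (V × ℝ) → ℂ := fun w => fderiv ℝ F w (w.2.1, 0) with ha'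
    have ha's : ContDiffOn ℝ (⊤ : ℕ∞) a' W := by
      have h1 : ContDiffOn ℝ (⊤ : ℕ∞) (fderiv ℝ F) W := hFs.fderiv_of_isOpen hWo (by simp)
      exact h1.clm_apply (contDiff_snd.fst.prodMk contDiff_const).contDiffOn
    have ha'K : ∀ w, w.1 ∉ K → a' w = 0 := by
      intro w hw
      have : F =ᶠ[nhds w] fun _ => 0 := by
        filter_upwards [(hK.isClosed.isOpen_compl.preimage continuous_fst).mem_nhds hw] with x hx
        exact hFK x hx
      simp only [ha']
      rw [this.fderiv_eq]
      simp
    obtain ⟨C, hC⟩ := ih a' ha's ha'K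
    refine ⟨C / (2 * Real.pi), fun e he μ hμ Λ hΛ => ?_⟩
    have hp := hmem he hμ
    have hslice : ContDiff ℝ (⊤ : ℕ∞) fun ξ => F (ξ, (e, μ)) := by
      rw [← contDiffOn_univ]
      exact hFs.comp (contDiff_id.prodMk contDiff_const).contDiffOn fun ξ _ => hPW ξ _ hp
    have hslicec : HasCompactSupport fun ξ => F (ξ, (e, μ)) :=
      HasCompactSupport.intro hK fun ξ hξ => hFK _ hξ
    have hsl' : ∀ ξ, fderiv ℝ (fun ξ => F (ξ, (e, μ))) ξ e = a' (ξ, (e, μ)) := by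
      intro ξ
      have h1 : HasFDerivAt F (fderiv ℝ F (ξ, (e, μ))) (ξ, (e, μ)) :=
        ((hFs.contDiffAt (hWo.mem_nhds (hPW ξ _ hp))).differentiableAt (by simp)).hasFDerivAt
      have h2 : HasFDerivAt (fun ξ : V => (ξ, (e, μ))) (ContinuousLinearMap.inl ℝ V (V × ℝ)) ξ :=
        hasFDerivAt_prodMk_left ξ (e, μ)
      have h3 := HasFDerivAt.comp ξ h1 h2
      have h4 : (fun ξ => F (ξ, (e, μ))) = F ∘ fun ξ : V => (ξ, (e, μ)) := rfl
      rw [h4, h3.fderiv]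
      simp [ha']
    have hqF : ∀ ξ, ((1 + μ * fderiv ℝ ψ ξ e : ℝ) : ℂ) * F (ξ, (e, μ)) = a (ξ, (e, μ)) := by
      intro ξ
      have h1 : (q (ξ, (e, μ)) : ℂ) ≠ 0 := by exact_mod_cast (hq0 _ (hPW ξ _ hp)).ne'
      show (q (ξ, (e, μ)) : ℂ) * (((q (ξ, (e, μ)))⁻¹ : ℝ) * a (ξ, (e, μ))) = _
      rw [Complex.ofReal_inv, mul_inv_cancel_left₀ h1]
    have hkey := integral_oscillation_mul_eq hψ he (μ := μ) hΛ.ne' hslice hslicec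
    simp only [hqF, hsl'] at hkey
    rw [hkey, norm_mul]
    have hn : ‖(-(1 / (2 * Real.pi * Λ * Complex.I)) : ℂ)‖ = 1 / (2 * Real.pi * Λ) := by
      simp [abs_of_pos Real.pi_pos, abs_of_pos hΛ]
    rw [hn]
    calc 1 / (2 * Real.pi * Λ) *
          ‖∫ ξ, (Real.fourierChar (Λ * (inner ℝ ξ e + μ * ψ ξ)) : ℂ) * a' (ξ, (e, μ))‖
        ≤ 1 / (2 * Real.pi * Λ) * (C / Λ ^ N) := by
          have := Real.pi_pos
          gcongr
          exact hC e he μ hμ Λ hΛ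
      _ = C / (2 * Real.pi) / Λ ^ (N + 1) := by
          field_simp
          ring

end NonstationaryPhase

/-! ### Finite speed of propagation -/

section PropagatorKernel

variable {d : ℕ} {ρ : EuclideanSpace ℝ (Fin d) → ℝ} {β : ℝ}

/-- Finite speed of propagation up to rapidly decaying tails: the kernel of the frequency localized
propagator at time `τ` is `O(|z|^{-N})` for `|z| ≥ κ |τ|`. -/
theorem IsHomogeneousDistance.exists_norm_waveEvolution_cutoff_le
    (hρ : IsHomogeneousDistance ρ β) {r R : ℝ} (hr : 0 < r) (hR : 0 < R)
    {χ : EuclideanSpace ℝ (Fin d) → ℝ} (hχ : ContDiff ℝ (⊤ : ℕ∞) χ)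
    (hχs : Function.support χ ⊆ closedAnnulus d r R) :
    ∃ κ : ℝ, 1 ≤ κ ∧ ∀ N : ℕ, ∃ C : ℝ, 0 ≤ C ∧ ∀ (z : EuclideanSpace ℝ (Fin d)) (τ : ℝ), z ≠ 0 →
      κ * |τ| ≤ ‖z‖ → ‖waveEvolution ρ (fun ξ => (χ ξ : ℂ)) τ z‖ ≤ C / ‖z‖ ^ N := by
  obtain ⟨ψ, hψ, hψc, hψρ⟩ := hρ.exists_smooth_eqOn hr hR
  obtain ⟨L₀, hL₀⟩ := (hψ.continuous_fderiv (by simp)).bounded_above_of_compact_support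
    (hψc.fderiv ℝ)
  set L := max L₀ 1 with hLdef
  have hL1 : 1 ≤ L := le_max_right _ _
  have hL : 0 < L := one_pos.trans_le hL1
  refine ⟨2 * L, by linarith, fun N => ?_⟩
  obtain ⟨C, hC⟩ := exists_norm_integral_oscillation_le hψ hL
    (fun ξ => (hL₀ ξ).trans (le_max_left _ _)) (isCompact_closedAnnulus (d := d) r R) N
    (fun w => (χ w.1 : ℂ))
    (Complex.ofRealCLM.contDiff.comp (hχ.comp contDiff_fst)).contDiffOn
    (fun w hw => by
      have : χ w.1 = 0 := Function.notMem_support.1 fun h => hw (hχs h)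
      simp [this])
  refine ⟨max C 0, le_max_right _ _, fun z τ hz hτ => ?_⟩
  have hz' : 0 < ‖z‖ := norm_pos_iff.2 hz
  -- the phase is `|z| (⟨ξ, e⟩ + μ ρ(ξ))` with `e = z / |z|` and `μ = τ / |z|`
  have h := hC (‖z‖⁻¹ • z) (by rw [norm_smul, norm_inv, norm_norm, inv_mul_cancel₀ hz'.ne'])
    (τ / ‖z‖) (by
      rw [abs_div, abs_norm, div_le_div_iff₀ hz' (by positivity)]
      linarith) ‖z‖ hz'
  refine le_trans (le_of_eq ?_) (h.trans (by gcongr; exact le_max_left _ _))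
  rw [waveEvolution]
  congr 1
  refine integral_congr_ae (Filter.Eventually.of_forall fun ξ => ?_)
  beta_reduce
  by_cases hξ : ξ ∈ closedAnnulus d r R
  · rw [hψρ ξ hξ, inner_smul_right]
    congr 3
    field_simp
  · have : χ ξ = 0 := Function.notMem_support.1 fun h => hξ (hχs h)
    simp [this]

end PropagatorKernel

/-! ### Littlewood-Paley pieces of functions on the line -/

section LittlewoodPaley

variable {ζ : ℝ → ℝ} {h : ℝ → ℂ}

theorem IsDyadicCutoff.continuous_dyadicPiece (hζ : IsDyadicCutoff ζ) (j : ℕ) :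
    Continuous (dyadicPiece ζ j) := by
  have := hζ.smooth.continuous
  cases j with
  | zero => exact this
  | succ j =>
    show Continuous fun r => ζ (r / 2 ^ (j + 1)) - ζ (r / 2 ^ j)
    fun_prop

theorem IsDyadicCutoff.dyadicPiece_eq_zero (hζ : IsDyadicCutoff ζ) {j : ℕ} {r : ℝ}
    (hr : 2 ^ j ≤ |r|) : dyadicPiece ζ j r = 0 := by
  have h0 : ∀ u : ℝ, 1 ≤ |u| → ζ u = 0 := fun u hu => by
    refine Function.notMem_support.1 fun h => ?_
    exact absurd hu (not_le.2 (abs_lt.2 (hζ.support_subset h)))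
  have hdiv : ∀ k : ℕ, 2 ^ k ≤ |r| → ζ (r / 2 ^ k) = 0 := fun k hk => h0 _ (by
    rw [abs_div, abs_of_pos (by positivity : (0 : ℝ) < 2 ^ k), one_le_div (by positivity)]
    exact hk)
  cases j with
  | zero => exact h0 _ (by simpa using hr)
  | succ j =>
    have : (2 : ℝ) ^ j ≤ |r| := le_trans (pow_le_pow_right₀ one_le_two j.le_succ) hr
    simp only [dyadicPiece]
    rw [hdiv _ hr, hdiv _ this, sub_zero]

theorem sum_dyadicPiece (ζ : ℝ → ℝ) (J : ℕ) (r : ℝ) :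
    ∑ j ∈ Finset.range (J + 1), dyadicPiece ζ j r = ζ (r / 2 ^ J) := by
  induction J with
  | zero => simp [dyadicPiece]
  | succ J ih => rw [Finset.sum_range_succ, ih]; simp [dyadicPiece]

theorem IsDyadicCutoff.exists_sum_dyadicPiece_eq_one (hζ : IsDyadicCutoff ζ) (r : ℝ) :
    ∃ J : ℕ, ∑ j ∈ Finset.range J, dyadicPiece ζ j r = 1 := by
  obtain ⟨J, hJ⟩ := pow_unbounded_of_one_lt (2 * |r|) (one_lt_two)
  refine ⟨J + 1, ?_⟩
  rw [sum_dyadicPiece]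
  refine hζ.eq_one _ ?_
  rw [abs_div, abs_of_pos (by positivity : (0 : ℝ) < 2 ^ J), div_le_iff₀ (by positivity)]
  linarith

/-- The Fourier transform of the Littlewood-Paley piece `V_j h`, in Mathlib's normalization. -/
noncomputable def fourierPiece (ζ : ℝ → ℝ) (h : ℝ → ℂ) (j : ℕ) (r : ℝ) : ℂ :=
  (dyadicPiece ζ j (2 * Real.pi * r) : ℂ) * 𝓕 h r

/-- The actual support is `|r| ≤ 2^j / (2π)`; the larger interval has the simpler endpoints. -/
theorem IsDyadicCutoff.fourierPiece_eq_zero (hζ : IsDyadicCutoff ζ) {j : ℕ} {r : ℝ}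
    (hr : r ∉ Icc (-(2 : ℝ) ^ j) (2 ^ j)) : fourierPiece ζ h j r = 0 := by
  have h1 : (2 : ℝ) ^ j ≤ |r| := by
    by_contra! hlt
    exact hr (abs_le.1 hlt.le)
  have h2 : (2 : ℝ) ^ j ≤ |2 * Real.pi * r| := by
    rw [abs_mul, abs_of_pos (by positivity)]
    have : (1 : ℝ) ≤ 2 * Real.pi := by linarith [Real.pi_gt_three]
    nlinarith [abs_nonneg r]
  simp [fourierPiece, hζ.dyadicPiece_eq_zero h2]

theorem IsDyadicCutoff.continuous_fourierPiece (hζ : IsDyadicCutoff ζ) (hh : Integrable h) (j : ℕ) :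
    Continuous (fourierPiece ζ h j) := by
  have h1 := hζ.continuous_dyadicPiece j
  have h2 := continuous_fourier_of_integrable hh
  unfold fourierPiece
  fun_prop

theorem IsDyadicCutoff.hasCompactSupport_fourierPiece (hζ : IsDyadicCutoff ζ) (j : ℕ) :
    HasCompactSupport (fourierPiece ζ h j) :=
  HasCompactSupport.intro isCompact_Icc fun _ hr => hζ.fourierPiece_eq_zero hr

/-- Plancherel's theorem for the Littlewood-Paley pieces. -/
theorem IsDyadicCutoff.eLpNorm_littlewoodPaley (hζ : IsDyadicCutoff ζ) (hh : Integrable h) (j : ℕ) :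
    eLpNorm (littlewoodPaley ζ j h) 2 volume = eLpNorm (fourierPiece ζ h j) 2 volume := by
  have hc := hζ.continuous_fourierPiece hh j
  have hs := hζ.hasCompactSupport_fourierPiece (h := h) j
  have hm : Integrable fun r : ℝ => (dyadicPiece ζ j r : ℂ) := by
    have h1 : Continuous fun r : ℝ => (dyadicPiece ζ j r : ℂ) :=
      Complex.continuous_ofReal.comp (hζ.continuous_dyadicPiece j)
    refine h1.integrable_of_hasCompactSupport
      (HasCompactSupport.intro (K := Icc (-(2 : ℝ) ^ j) (2 ^ j)) isCompact_Icc fun r hr => ?_)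
    have : (2 : ℝ) ^ j ≤ |r| := by
      by_contra! hlt
      exact hr (abs_le.1 hlt.le)
    rw [hζ.dyadicPiece_eq_zero this, Complex.ofReal_zero]
  have he : littlewoodPaley ζ j h = 𝓕⁻ (fourierPiece ζ h j) := by
    ext x
    rw [littlewoodPaley, fourierMultiplier_eq_fourierInv hm hh]
    rfl
  rw [he, eLpNorm_fourierInv_two (hc.integrable_of_hasCompactSupport hs)
    (hc.memLp_of_hasCompactSupport hs)]

theorem IsDyadicCutoff.enorm_fourier_le_tsum (hζ : IsDyadicCutoff ζ) (h : ℝ → ℂ) (r : ℝ) :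
    ‖𝓕 h r‖ₑ ≤ ∑' j, ‖fourierPiece ζ h j r‖ₑ := by
  obtain ⟨J, hJ⟩ := hζ.exists_sum_dyadicPiece_eq_one (2 * Real.pi * r)
  have : 𝓕 h r = ∑ j ∈ Finset.range J, fourierPiece ζ h j r := by
    simp only [fourierPiece]
    rw [← Finset.sum_mul, ← Complex.ofReal_sum, hJ, Complex.ofReal_one, one_mul]
  rw [this]
  exact (enorm_sum_le _ _).trans (ENNReal.sum_le_tsum _)

theorem lintegral_mul_le_eLpNorm_two {X ε ε' : Type*} [MeasurableSpace X] [TopologicalSpace ε]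
    [ContinuousENorm ε] [TopologicalSpace ε'] [ContinuousENorm ε'] {μ : Measure X} {f : X → ε}
    {g : X → ε'} (hf : AEStronglyMeasurable f μ) (hg : AEStronglyMeasurable g μ) :
    ∫⁻ x, ‖f x‖ₑ * ‖g x‖ₑ ∂μ ≤ eLpNorm f 2 μ * eLpNorm g 2 μ := by
  have := ENNReal.lintegral_mul_le_Lp_mul_Lq μ Real.HolderConjugate.two_two hf.enorm hg.enorm
  simpa [eLpNorm_eq_lintegral_rpow_enorm_toReal two_ne_zero ENNReal.ofNat_ne_top] using this

/-- Cauchy-Schwarz on the support of `ζ_j`: the `L¹` norm of a piece of `𝓕 h` is bounded by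
`2^{j/2}` times its `L²` norm. -/
theorem IsDyadicCutoff.lintegral_fourierPiece_le (hζ : IsDyadicCutoff ζ) (hh : Integrable h)
    (j : ℕ) : ∫⁻ r, ‖fourierPiece ζ h j r‖ₑ ≤
      2 * (2 : ℝ≥0∞) ^ ((j : ℝ) * (1 / 2)) * eLpNorm (littlewoodPaley ζ j h) 2 volume := by
  rw [hζ.eLpNorm_littlewoodPaley hh]
  have h1 : ∫⁻ r, ‖fourierPiece ζ h j r‖ₑ =
      ∫⁻ r in Icc (-(2 : ℝ) ^ j) (2 ^ j), ‖fourierPiece ζ h j r‖ₑ * ‖(1 : ℝ)‖ₑ := by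
    rw [← lintegral_indicator measurableSet_Icc]
    refine lintegral_congr fun r => ?_
    by_cases hr : r ∈ Icc (-(2 : ℝ) ^ j) (2 ^ j)
    · simp [indicator_of_mem hr]
    · simp [indicator_of_notMem hr, hζ.fourierPiece_eq_zero hr]
  rw [h1]
  refine (lintegral_mul_le_eLpNorm_two (hζ.continuous_fourierPiece hh j).aestronglyMeasurable
    aestronglyMeasurable_const).trans ?_
  rw [mul_comm]
  gcongr
  · rw [eLpNorm_const _ two_ne_zero (by simp [Real.volume_Icc])]
    simp only [enorm_one, one_mul, Measure.restrict_apply_univ, Real.volume_Icc]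
    have : (2 : ℝ) ^ j - -2 ^ j = 2 * 2 ^ j := by ring
    rw [this, ENNReal.ofReal_mul zero_le_two, ENNReal.mul_rpow_of_nonneg _ _ (by positivity),
      ENNReal.ofReal_pow zero_le_two, ENNReal.ofReal_ofNat, ← ENNReal.rpow_natCast,
      ← ENNReal.rpow_mul]
    refine mul_le_mul' ?_ (le_of_eq ?_)
    · calc (2 : ℝ≥0∞) ^ (1 / (2 : ℝ≥0∞).toReal) ≤ 2 ^ (1 : ℝ) :=
            ENNReal.rpow_le_rpow_of_exponent_le one_le_two (by norm_num)
        _ = 2 := ENNReal.rpow_one _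
    · norm_num
  · exact Measure.restrict_le_self

/-- The quantity `∑ 2^{j/2} ‖V_j h‖₂`, the norm of the Besov space `B^2_{1/2,1}`. -/
noncomputable def halfBesovNorm (ζ : ℝ → ℝ) (h : ℝ → ℂ) : ℝ≥0∞ :=
  ∑' j : ℕ, (2 : ℝ≥0∞) ^ ((j : ℝ) * (1 / 2)) * eLpNorm (littlewoodPaley ζ j h) 2 volume

theorem tsum_two_rpow_neg_lt_top {ε : ℝ} (hε : 0 < ε) :
    ∑' j : ℕ, (2 : ℝ≥0∞) ^ (-((j : ℝ) * ε)) < ∞ := by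
  have h1 : ∀ j : ℕ, (2 : ℝ≥0∞) ^ (-((j : ℝ) * ε)) = ((2 : ℝ≥0∞) ^ (-ε)) ^ j := by
    intro j
    rw [← ENNReal.rpow_natCast, ← ENNReal.rpow_mul]
    congr 1; ring
  simp only [h1]
  rw [ENNReal.tsum_geometric, ENNReal.inv_lt_top]
  refine tsub_pos_of_lt (ENNReal.rpow_lt_one_of_one_lt_of_neg (by norm_num) (by linarith))

/-- The embedding `B^2_{α,s} ⊆ B^2_{1/2,1}` for `α > 1/2`, by summing a geometric series. -/
theorem exists_halfBesovNorm_le {α : ℝ} (hα : 1 / 2 < α) :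
    ∃ C : ℝ≥0, ∀ (ζ : ℝ → ℝ) (s : ℝ≥0∞) (h : ℝ → ℂ), s ≠ 0 →
      halfBesovNorm ζ h ≤ C * besovNorm ζ α s h := by
  have hfin := tsum_two_rpow_neg_lt_top (sub_pos.2 hα)
  refine ⟨(∑' j : ℕ, (2 : ℝ≥0∞) ^ (-((j : ℝ) * (α - 1 / 2)))).toNNReal, fun ζ s h hs => ?_⟩
  rw [ENNReal.coe_toNNReal hfin.ne, halfBesovNorm, ← ENNReal.tsum_mul_right]
  refine ENNReal.tsum_le_tsum fun j => ?_
  have h1 := le_seqNorm hs (fun j : ℕ => (2 : ℝ≥0∞) ^ ((j : ℝ) * α) *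
    eLpNorm (littlewoodPaley ζ j h) 2 volume) j
  refine le_trans (le_of_eq ?_) (mul_le_mul_right h1 ((2 : ℝ≥0∞) ^ (-((j : ℝ) * (α - 1 / 2)))))
  rw [← mul_assoc, ← ENNReal.rpow_add _ _ two_ne_zero ENNReal.ofNat_ne_top]
  congr 2; ring

theorem IsDyadicCutoff.integrable_fourier (hζ : IsDyadicCutoff ζ) (hh : Integrable h)
    (hB : halfBesovNorm ζ h < ∞) : Integrable (𝓕 h) := by
  refine ⟨(continuous_fourier_of_integrable hh).aestronglyMeasurable, ?_⟩
  calc ∫⁻ r, ‖𝓕 h r‖ₑ ≤ ∫⁻ r, ∑' j, ‖fourierPiece ζ h j r‖ₑ :=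
        lintegral_mono fun r => hζ.enorm_fourier_le_tsum h r
    _ = ∑' j, ∫⁻ r, ‖fourierPiece ζ h j r‖ₑ :=
        lintegral_tsum fun j => (hζ.continuous_fourierPiece hh j).measurable.enorm.aemeasurable
    _ ≤ ∑' j : ℕ, 2 * ((2 : ℝ≥0∞) ^ ((j : ℝ) * (1 / 2)) *
          eLpNorm (littlewoodPaley ζ j h) 2 volume) := by
        refine ENNReal.tsum_le_tsum fun j => ?_
        rw [← mul_assoc]
        exact hζ.lintegral_fourierPiece_le hh j
    _ < ∞ := by
        rw [ENNReal.tsum_mul_left]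
        exact ENNReal.mul_lt_top (by norm_num) hB

end LittlewoodPaley

/-! ### Multipliers as superpositions of propagators -/

section Representation

variable {d : ℕ} {ρ : EuclideanSpace ℝ (Fin d) → ℝ} {β : ℝ} {h : ℝ → ℂ}
  {χ : EuclideanSpace ℝ (Fin d) → ℝ} {r R : ℝ} {g : EuclideanSpace ℝ (Fin d) → ℂ}

/-- The function `ξ ↦ ρ(2πξ)`, which replaces `ρ` in Mathlib's normalization of the Fourier
transform. -/
noncomputable def angularRescale (ρ : EuclideanSpace ℝ (Fin d) → ℝ) :
    EuclideanSpace ℝ (Fin d) → ℝ :=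
  fun ξ => ρ ((2 * Real.pi) • ξ)

theorem IsHomogeneousDistance.angularRescale (hρ : IsHomogeneousDistance ρ β) :
    IsHomogeneousDistance (angularRescale ρ) β :=
  hρ.comp_smul (by positivity)

/-- A smooth cutoff supported in the annulus `r ≤ |ξ| ≤ R` that is equal to `1` on the frequency
support of all multipliers `h(ρ(2π ·)/t)`, where `1 ≤ t ≤ 2^β` and `h` is supported in `(1/2, 2)`.
-/
structure IsFrequencyCutoff (ρ : EuclideanSpace ℝ (Fin d) → ℝ) (β : ℝ)
    (χ : EuclideanSpace ℝ (Fin d) → ℝ) (r R : ℝ) : Prop where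
  inner_pos : 0 < r
  outer_pos : 0 < R
  smooth : ContDiff ℝ (⊤ : ℕ∞) χ
  mem_Icc : ∀ ξ, 0 ≤ χ ξ ∧ χ ξ ≤ 1
  support_subset : Function.support χ ⊆ closedAnnulus d r R
  eq_one : ∀ ξ, ξ ≠ 0 → 1 / 2 < angularRescale ρ ξ → angularRescale ρ ξ < 2 ^ β * 2 → χ ξ = 1

theorem IsHomogeneousDistance.exists_isFrequencyCutoff (hρ : IsHomogeneousDistance ρ β) :
    ∃ χ r R, IsFrequencyCutoff ρ β χ r R := by
  obtain ⟨c, C, hc, hC, hcC⟩ := hρ.angularRescale.exists_bounds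
  have hβ := hρ.degree_pos
  set r₀ : ℝ := (1 / (2 * C)) ^ (1 / β) with hr₀
  set R₀ : ℝ := (2 ^ β * 2 / c) ^ (1 / β) with hR₀
  have hr₀p : 0 < r₀ := by positivity
  have hR₀p : 0 < R₀ := by positivity
  obtain ⟨χ, h1, h2, h3, h4⟩ := exists_annular_cutoff d hr₀p hR₀p
  refine ⟨χ, r₀ / 2, 2 * R₀, by positivity, by positivity, h1, h2, h4, fun ξ hξ hl hu => ?_⟩
  obtain ⟨hlo, hhi⟩ := hcC ξ hξ
  have hroot : (‖ξ‖ ^ β) ^ (1 / β) = ‖ξ‖ := by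
    rw [← Real.rpow_mul (norm_nonneg ξ), mul_one_div_cancel hβ.ne', Real.rpow_one]
  refine h3 ξ ?_ ?_
  · rw [← hroot, hr₀]
    gcongr
    rw [div_le_iff₀ (by positivity)]
    nlinarith
  · rw [← hroot, hR₀]
    gcongr
    rw [le_div_iff₀ hc]
    nlinarith

theorem IsFrequencyCutoff.hasCompactSupport (hχ : IsFrequencyCutoff ρ β χ r R) :
    HasCompactSupport χ :=
  HasCompactSupport.intro (isCompact_closedAnnulus (d := d) r R) fun _ hξ =>
    Function.notMem_support.1 fun h => hξ (hχ.support_subset h)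

/-- The Fourier transform of `g`, localized to the frequency support of the multipliers. -/
noncomputable def localizedFourier (χ : EuclideanSpace ℝ (Fin d) → ℝ)
    (g : EuclideanSpace ℝ (Fin d) → ℂ) : EuclideanSpace ℝ (Fin d) → ℂ :=
  fun ξ => (χ ξ : ℂ) * 𝓕 g ξ

theorem IsFrequencyCutoff.continuous_localizedFourier (hχ : IsFrequencyCutoff ρ β χ r R)
    (hg : Integrable g) : Continuous (localizedFourier χ g) :=
  (Complex.continuous_ofReal.comp hχ.smooth.continuous).mul (continuous_fourier_of_integrable hg)

theorem IsFrequencyCutoff.localizedFourier_eq_zero (hχ : IsFrequencyCutoff ρ β χ r R)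
    (ξ : EuclideanSpace ℝ (Fin d)) (hξ : ξ ∉ closedAnnulus d r R) : localizedFourier χ g ξ = 0 := by
  have : χ ξ = 0 := Function.notMem_support.1 fun h => hξ (hχ.support_subset h)
  simp [localizedFourier, this]

theorem IsFrequencyCutoff.hasCompactSupport_localizedFourier (hχ : IsFrequencyCutoff ρ β χ r R) :
    HasCompactSupport (localizedFourier χ g) :=
  HasCompactSupport.intro (isCompact_closedAnnulus (d := d) r R) fun ξ hξ =>
    hχ.localizedFourier_eq_zero ξ hξ

theorem IsFrequencyCutoff.integrable_localizedFourier (hχ : IsFrequencyCutoff ρ β χ r R)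
    (hg : Integrable g) : Integrable (localizedFourier χ g) :=
  (hχ.continuous_localizedFourier hg).integrable_of_hasCompactSupport
    hχ.hasCompactSupport_localizedFourier

theorem IsFrequencyCutoff.memLp_localizedFourier (hχ : IsFrequencyCutoff ρ β χ r R)
    (hg : Integrable g) : MemLp (localizedFourier χ g) 2 :=
  (hχ.continuous_localizedFourier hg).memLp_of_hasCompactSupport
    hχ.hasCompactSupport_localizedFourier

theorem IsFrequencyCutoff.eLpNorm_localizedFourier_le (hχ : IsFrequencyCutoff ρ β χ r R)
    (hg : Integrable g) (hg2 : MemLp g 2) :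
    eLpNorm (localizedFourier χ g) 2 volume ≤ eLpNorm g 2 volume := by
  rw [← eLpNorm_fourier_two hg hg2]
  refine eLpNorm_mono fun ξ => ?_
  rw [localizedFourier, norm_mul, Complex.norm_real, Real.norm_of_nonneg (hχ.mem_Icc ξ).1]
  exact mul_le_of_le_one_left (norm_nonneg _) (hχ.mem_Icc ξ).2

theorem integrable_of_memLp_of_support_subset (hh : MemLp h 2)
    (hs : Function.support h ⊆ Ioo (1 / 2) 2) : Integrable h := by
  have h1 : IntegrableOn h (Ioo (1 / 2) 2) :=
    (hh.restrict _).integrable one_le_two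
  exact (integrableOn_iff_integrable_of_support_subset hs).1 h1

/-- The multiplier `h(ρ(2πξ)/t)` as a superposition of the exponentials `e^{2πi τ ρ(2πξ)/t}`. -/
theorem IsFrequencyCutoff.quasiradial_ae_eq [Nonempty (Fin d)]
    (hχ : IsFrequencyCutoff ρ β χ r R) (hρ : IsHomogeneousDistance ρ β)
    (hh : Integrable h) (hs : Function.support h ⊆ Ioo (1 / 2) 2) (hF : Integrable (𝓕 h)) {t : ℝ}
    (ht : t ∈ Icc 1 ((2 : ℝ) ^ β)) :
    (fun ξ => quasiradial ρ h t ((2 * Real.pi) • ξ)) =ᵐ[volume]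
      fun ξ => (χ ξ : ℂ) * 𝓕⁻ (𝓕 h) (angularRescale ρ ξ / t) := by
  have ht0 : 0 < t := one_pos.trans_le ht.1
  have hinv := fourierInv_fourier_ae_eq hh hF
  set N : Set ℝ := {u | 𝓕⁻ (𝓕 h) u ≠ h u} with hN
  have hN0 : volume N = 0 := hinv
  have hN1 : volume ((fun u => u * t⁻¹) ⁻¹' N) = 0 := by
    rw [Real.volume_preimage_mul_right (inv_ne_zero ht0.ne'), hN0, mul_zero]
  have hz : ∀ᵐ ξ : EuclideanSpace ℝ (Fin d), ξ ≠ 0 := by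
    have : Nontrivial (EuclideanSpace ℝ (Fin d)) := inferInstance
    exact measure_eq_zero_iff_ae_notMem.1 (measure_singleton (0 : EuclideanSpace ℝ (Fin d)))
  -- inversion holds only almost everywhere on `ℝ`, and `ρ` pulls null sets back to null sets
  filter_upwards [hρ.angularRescale.ae_notMem_of_volume_eq_zero hN1, hz] with ξ hξ hξ0
  have h1 : 𝓕⁻ (𝓕 h) (angularRescale ρ ξ / t) = h (angularRescale ρ ξ / t) := by
    by_contra hne
    exact hξ (by simpa [hN, div_eq_mul_inv] using hne)
  rw [h1]
  show h (angularRescale ρ ξ / t) = _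
  by_cases h0 : h (angularRescale ρ ξ / t) = 0
  · rw [h0, mul_zero]
  · obtain ⟨hl, hu⟩ := hs h0
    rw [lt_div_iff₀ ht0] at hl
    rw [div_lt_iff₀ ht0] at hu
    rw [hχ.eq_one ξ hξ0 (by nlinarith [ht.1]) (by nlinarith [ht.2]), Complex.ofReal_one, one_mul]

theorem IsFrequencyCutoff.integrable_quasiradial [Nonempty (Fin d)]
    (hχ : IsFrequencyCutoff ρ β χ r R) (hρ : IsHomogeneousDistance ρ β)
    (hh : Integrable h) (hs : Function.support h ⊆ Ioo (1 / 2) 2) (hF : Integrable (𝓕 h)) {t : ℝ}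
    (ht : t ∈ Icc 1 ((2 : ℝ) ^ β)) : Integrable (quasiradial ρ h t) := by
  have h2π : (2 * Real.pi : ℝ) ≠ 0 := by positivity
  rw [← integrable_comp_smul_iff volume _ h2π,
    integrable_congr (hχ.quasiradial_ae_eq hρ hh hs hF ht)]
  have h1 : Integrable fun ξ => (χ ξ : ℂ) :=
    (Complex.continuous_ofReal.comp hχ.smooth.continuous).integrable_of_hasCompactSupport
      (hχ.hasCompactSupport.comp_left (g := ((↑) : ℝ → ℂ)) rfl)
  have hm : Measurable fun ξ => 𝓕⁻ (𝓕 h) (angularRescale ρ ξ / t) :=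
    (continuous_fourierInv_of_integrable hF).measurable.comp
      (hρ.angularRescale.measurable.div_const t)
  refine h1.mul_bdd (c := ∫ v, ‖𝓕 h v‖) hm.aestronglyMeasurable
    (Filter.Eventually.of_forall fun ξ => ?_)
  rw [Real.fourierInv_eq]
  exact (norm_integral_le_integral_norm _).trans (by simp [Circle.norm_smul])

/-- The multiplier operator as a superposition of the propagators at times `τ / t`. -/
theorem IsFrequencyCutoff.fourierMultiplier_eq_integral [Nonempty (Fin d)]
    (hχ : IsFrequencyCutoff ρ β χ r R) (hρ : IsHomogeneousDistance ρ β)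
    (hh : Integrable h) (hs : Function.support h ⊆ Ioo (1 / 2) 2) (hF : Integrable (𝓕 h)) {t : ℝ}
    (ht : t ∈ Icc 1 ((2 : ℝ) ^ β)) (hg : Integrable g) (x : EuclideanSpace ℝ (Fin d)) :
    fourierMultiplier (quasiradial ρ h t) g x =
      ∫ τ, 𝓕 h τ * waveEvolution (angularRescale ρ) (localizedFourier χ g) (τ / t) x := by
  have hb := hχ.integrable_localizedFourier hg
  have hρm := hρ.angularRescale.measurable
  rw [fourierMultiplier_eq_fourierInv (hχ.integrable_quasiradial hρ hh hs hF ht) hg]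
  have hae : (fun ξ => quasiradial ρ h t ((2 * Real.pi) • ξ) * 𝓕 g ξ) =ᵐ[volume]
      fun ξ => 𝓕⁻ (𝓕 h) (angularRescale ρ ξ / t) * localizedFourier χ g ξ := by
    filter_upwards [hχ.quasiradial_ae_eq hρ hh hs hF ht] with ξ hξ
    rw [hξ, localizedFourier]
    ring
  rw [Real.fourierInv_congr_ae hae, Real.fourierInv_eq]
  have hint : Integrable (Function.uncurry fun (ξ : EuclideanSpace ℝ (Fin d)) (τ : ℝ) =>
      (Real.fourierChar (inner ℝ ξ x + τ / t * angularRescale ρ ξ) : ℂ) *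
        (localizedFourier χ g ξ * 𝓕 h τ)) (volume.prod volume) := by
    have hm : Measurable fun p : EuclideanSpace ℝ (Fin d) × ℝ =>
        inner ℝ p.1 x + p.2 / t * angularRescale ρ p.1 := by fun_prop
    exact integrable_fourierChar_mul hm (hb.mul_prod hF)
  calc ∫ ξ, Real.fourierChar (inner ℝ ξ x) •
          (𝓕⁻ (𝓕 h) (angularRescale ρ ξ / t) * localizedFourier χ g ξ)
      = ∫ ξ, ∫ τ, (Real.fourierChar (inner ℝ ξ x + τ / t * angularRescale ρ ξ) : ℂ) *
          (localizedFourier χ g ξ * 𝓕 h τ) := by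
        refine integral_congr_ae (Filter.Eventually.of_forall fun ξ => ?_)
        beta_reduce
        rw [Real.fourierInv_eq, Circle.smul_def, smul_eq_mul, ← integral_mul_const,
          ← integral_const_mul]
        refine integral_congr_ae (Filter.Eventually.of_forall fun τ => ?_)
        have : (inner ℝ τ (angularRescale ρ ξ / t) : ℝ) = τ / t * angularRescale ρ ξ := by
          simp only [RCLike.inner_apply, conj_trivial]
          ring
        simp only [this, AddChar.map_add_eq_mul, Circle.coe_mul, Circle.smul_def, smul_eq_mul]
        ring
    _ = ∫ τ, ∫ ξ, (Real.fourierChar (inner ℝ ξ x + τ / t * angularRescale ρ ξ) : ℂ) *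
          (localizedFourier χ g ξ * 𝓕 h τ) := integral_integral_swap hint
    _ = _ := by
        refine integral_congr_ae (Filter.Eventually.of_forall fun τ => ?_)
        beta_reduce
        rw [waveEvolution, ← integral_const_mul]
        refine integral_congr_ae (Filter.Eventually.of_forall fun ξ => ?_)
        ring

/-- The localized propagator is a convolution operator. -/
theorem IsFrequencyCutoff.enorm_waveEvolution_localizedFourier_le
    (hχ : IsFrequencyCutoff ρ β χ r R) (hρ : IsHomogeneousDistance ρ β) (hg : Integrable g) (τ : ℝ)
    (x : EuclideanSpace ℝ (Fin d)) :
    ‖waveEvolution (angularRescale ρ) (localizedFourier χ g) τ x‖ₑ ≤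
      ∫⁻ y, ‖waveEvolution (angularRescale ρ) (fun ξ => (χ ξ : ℂ)) τ (x - y)‖ₑ * ‖g y‖ₑ := by
  have h2π : (2 * Real.pi : ℝ) ≠ 0 := by positivity
  have h1 : Integrable fun ξ => (χ ξ : ℂ) :=
    (Complex.continuous_ofReal.comp hχ.smooth.continuous).integrable_of_hasCompactSupport
      (hχ.hasCompactSupport.comp_left (g := ((↑) : ℝ → ℂ)) rfl)
  set M : EuclideanSpace ℝ (Fin d) → ℂ := fun ξ =>
    (Real.fourierChar (τ * angularRescale ρ ξ) : ℂ) * (χ ξ : ℂ) with hM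
  have hMi : Integrable M :=
    integrable_fourierChar_mul (hρ.angularRescale.measurable.const_mul τ) h1
  set m : EuclideanSpace ℝ (Fin d) → ℂ := fun ξ => M ((2 * Real.pi)⁻¹ • ξ) with hm
  have hmi : Integrable m := hMi.comp_smul (inv_ne_zero h2π)
  have hmM : (fun ξ => m ((2 * Real.pi) • ξ)) = M := by
    ext ξ; simp only [hm]; rw [inv_smul_smul₀ h2π]
  have hk : ∀ z, multiplierKernel m z =
      waveEvolution (angularRescale ρ) (fun ξ => (χ ξ : ℂ)) τ z := by
    intro z
    rw [multiplierKernel, hmM, waveEvolution_eq_fourierInv]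
  have heq := fourierMultiplier_eq_fourierInv hmi hg x
  have hl : waveEvolution (angularRescale ρ) (localizedFourier χ g) τ x =
      fourierMultiplier m g x := by
    rw [heq, waveEvolution_eq_fourierInv]
    refine congrArg (fun F : EuclideanSpace ℝ (Fin d) → ℂ => 𝓕⁻ F x) (funext fun ξ => ?_)
    rw [show m ((2 * Real.pi) • ξ) = M ξ from congrFun hmM ξ, hM, localizedFourier]
    ring
  rw [hl, fourierMultiplier]
  refine (enorm_integral_le_lintegral_enorm _).trans (le_of_eq (lintegral_congr fun y => ?_))
  rw [enorm_mul, hk]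

end Representation

/-! ### The energy of the propagator on dyadic annuli -/

section SingleScale

variable {d : ℕ} {ρ : EuclideanSpace ℝ (Fin d) → ℝ} {β : ℝ} {ζ : ℝ → ℝ} {h : ℝ → ℂ}
  {χ : EuclideanSpace ℝ (Fin d) → ℝ} {r R : ℝ} {g : EuclideanSpace ℝ (Fin d) → ℂ}

theorem ofReal_two_zpow (n : ℤ) : ENNReal.ofReal ((2 : ℝ) ^ n) = (2 : ℝ≥0∞) ^ (n : ℝ) := by
  rw [← Real.rpow_intCast, ← ENNReal.ofReal_rpow_of_pos two_pos, ENNReal.ofReal_ofNat]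

theorem two_rpow_add (a b : ℝ) : (2 : ℝ≥0∞) ^ (a + b) = 2 ^ a * 2 ^ b :=
  ENNReal.rpow_add _ _ two_ne_zero ENNReal.ofNat_ne_top

theorem two_rpow_ne_top (a : ℝ) : (2 : ℝ≥0∞) ^ a ≠ ∞ :=
  ENNReal.rpow_ne_top_of_ne_zero two_ne_zero ENNReal.ofNat_ne_top

theorem measurableSet_dyadicAnnulus (n : ℤ) : MeasurableSet (dyadicAnnulus d n) :=
  (measurableSet_le measurable_const measurable_norm).inter
    (measurableSet_lt measurable_norm measurable_const)

theorem exists_volume_dyadicAnnulus_le (d : ℕ) : ∃ C : ℝ≥0, ∀ n : ℤ,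
    volume (dyadicAnnulus d n) ^ (1 / 2 : ℝ) ≤ C * (2 : ℝ≥0∞) ^ ((n : ℝ) * (d / 2)) := by
  set v := volume (Metric.ball (0 : EuclideanSpace ℝ (Fin d)) 1) with hv
  have hvt : v ≠ ∞ := measure_ball_lt_top.ne
  refine ⟨((2 : ℝ≥0∞) ^ ((d : ℝ) / 2) * v ^ (1 / 2 : ℝ)).toNNReal, fun n => ?_⟩
  rw [ENNReal.coe_toNNReal (ENNReal.mul_ne_top (two_rpow_ne_top _)
    (ENNReal.rpow_ne_top_of_nonneg (by norm_num) hvt))]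
  have h1 : volume (dyadicAnnulus d n) ≤ (2 : ℝ≥0∞) ^ (((n : ℝ) + 1) * d) * v := by
    calc volume (dyadicAnnulus d n)
        ≤ volume (Metric.ball (0 : EuclideanSpace ℝ (Fin d)) ((2 : ℝ) ^ (n + 1))) := by
          refine measure_mono fun x hx => ?_
          simpa using hx.2
      _ = ENNReal.ofReal ((2 : ℝ) ^ (n + 1)) ^ d * v := by
          rw [Measure.addHaar_ball_of_pos _ _ (by positivity), finrank_euclideanSpace,
            Fintype.card_fin,
            ENNReal.ofReal_pow (by positivity)]
      _ = _ := by
          rw [ofReal_two_zpow, ← ENNReal.rpow_natCast, ← ENNReal.rpow_mul]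
          push_cast
          rfl
  calc volume (dyadicAnnulus d n) ^ (1 / 2 : ℝ)
      ≤ ((2 : ℝ≥0∞) ^ (((n : ℝ) + 1) * d) * v) ^ (1 / 2 : ℝ) := by gcongr
    _ = _ := by
        rw [ENNReal.mul_rpow_of_nonneg _ _ (by norm_num), ← ENNReal.rpow_mul,
          mul_right_comm ((2 : ℝ≥0∞) ^ ((d : ℝ) / 2)), ← two_rpow_add]
        congr 2
        ring

/-- The square root of the energy of `waveEvolution ρ b · x` over the times `|τ| ≤ 2^j`. -/
noncomputable def waveEnergy (ρ : EuclideanSpace ℝ (Fin d) → ℝ)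
    (b : EuclideanSpace ℝ (Fin d) → ℂ) (j : ℕ) (x : EuclideanSpace ℝ (Fin d)) : ℝ≥0∞ :=
  eLpNorm (fun τ => waveEvolution ρ b τ x) 2 (volume.restrict (Icc (-(2 : ℝ) ^ j) (2 ^ j)))

theorem waveEnergy_sq (b : EuclideanSpace ℝ (Fin d) → ℂ) (j : ℕ) (x : EuclideanSpace ℝ (Fin d)) :
    waveEnergy ρ b j x ^ 2 =
      ∫⁻ τ in Icc (-(2 : ℝ) ^ j) (2 ^ j), ‖waveEvolution ρ b τ x‖ₑ ^ 2 :=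
  eLpNorm_two_sq _ _

theorem measurable_waveEnergy (hρ : Measurable ρ) {b : EuclideanSpace ℝ (Fin d) → ℂ}
    (hb : AEStronglyMeasurable b) (j : ℕ) : Measurable (waveEnergy ρ b j) := by
  have h1 : Measurable fun x => waveEnergy ρ b j x ^ 2 := by
    simp only [waveEnergy_sq]
    have h2 : Measurable (Function.uncurry fun (x : EuclideanSpace ℝ (Fin d)) (τ : ℝ) =>
        ‖waveEvolution ρ b τ x‖ₑ ^ 2) :=
      (measurable_waveEvolution_comp hρ hb measurable_snd measurable_fst).enorm.pow_const 2
    exact h2.lintegral_prod_right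
  have h3 : waveEnergy ρ b j = fun x => (waveEnergy ρ b j x ^ 2) ^ (1 / 2 : ℝ) := by
    ext x
    rw [← ENNReal.rpow_natCast, ← ENNReal.rpow_mul]
    norm_num
  rw [h3]
  exact h1.pow_const _

theorem le_mul_of_sq_le {a b A : ℝ≥0∞} (h : a ^ 2 ≤ A * b ^ 2) (hA : 1 ≤ A) : a ≤ A * b := by
  have h2 : a ^ 2 ≤ (A * b) ^ 2 := by
    refine h.trans ?_
    rw [mul_pow]
    gcongr
    exact le_self_pow₀ hA two_ne_zero
  exact (ENNReal.pow_le_pow_left_iff two_ne_zero).1 h2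

/-- Conservation of the `L²` norm, integrated over the times `|τ| ≤ 2^j`. -/
theorem eLpNorm_waveEnergy_le (hρ : Measurable ρ) {b : EuclideanSpace ℝ (Fin d) → ℂ}
    (hb : Integrable b) (hb2 : MemLp b 2) (j : ℕ) :
    eLpNorm (waveEnergy ρ b j) 2 volume ≤
      2 * ((2 : ℝ≥0∞) ^ ((j : ℝ) * (1 / 2)) * eLpNorm b 2 volume) := by
  refine le_mul_of_sq_le ?_ one_le_two
  rw [eLpNorm_two_sq, mul_pow, eLpNorm_two_sq volume b]
  simp only [enorm_eq_self, waveEnergy_sq]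
  have hm : AEMeasurable (Function.uncurry fun (x : EuclideanSpace ℝ (Fin d)) (τ : ℝ) =>
      ‖waveEvolution ρ b τ x‖ₑ ^ 2) (volume.prod (volume.restrict (Icc (-(2 : ℝ) ^ j) (2 ^ j)))) :=
    ((measurable_waveEvolution_comp hρ hb.aestronglyMeasurable measurable_snd
      measurable_fst).enorm.pow_const 2).aemeasurable
  rw [lintegral_lintegral_swap hm]
  simp only [lintegral_waveEvolution_sq hρ hb hb2]
  rw [setLIntegral_const, Real.volume_Icc, mul_comm, ← mul_assoc]
  gcongr
  have : (2 : ℝ) ^ j - -2 ^ j = 2 * 2 ^ j := by ring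
  rw [this, ENNReal.ofReal_mul zero_le_two, ENNReal.ofReal_pow zero_le_two, ENNReal.ofReal_ofNat,
    ← ENNReal.rpow_natCast (2 ^ _) 2, ← ENNReal.rpow_mul, ← ENNReal.rpow_natCast 2 j]
  have h2 : (j : ℝ) * (1 / 2) * ((2 : ℕ) : ℝ) = j := by push_cast; ring
  rw [h2]

/-- The growth of the local smoothing estimate on the `m`-th annulus: `2^{m/2}` for `m ≥ 0`, from
the estimate on balls, and `2^{md/2}` for `m < 0`, from the pointwise estimate. -/
noncomputable def smoothingWeight (d : ℕ) (m : ℤ) : ℝ≥0∞ :=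
  if 0 ≤ m then 2 ^ ((m : ℝ) * (1 / 2)) else 2 ^ ((m : ℝ) * (d / 2))

/-- The local smoothing estimates, for the energy at a point and on dyadic annuli. There is no loss
in `j`, in contrast to `eLpNorm_waveEnergy_le`. -/
theorem IsHomogeneousDistance.exists_waveEnergy_le (hρ : IsHomogeneousDistance ρ β) (hr : 0 < r) :
    ∃ A : ℝ≥0, ∀ b : EuclideanSpace ℝ (Fin d) → ℂ, Integrable b →
      (∀ ξ, ξ ∉ closedAnnulus d r R → b ξ = 0) → ∀ j : ℕ,
      (∀ x, waveEnergy ρ b j x ≤ A * eLpNorm b 2 volume) ∧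
      ∀ m : ℤ, eLpNorm (waveEnergy ρ b j) 2 (volume.restrict (dyadicAnnulus d m)) ≤
        A * smoothingWeight d m * eLpNorm b 2 volume := by
  obtain ⟨A₁, hA₁⟩ := hρ.exists_lintegral_waveEvolution_sq_le (R := R) hr
  obtain ⟨A₂, hA₂⟩ := hρ.exists_lintegral_ball_waveEvolution_sq_le (R := R) hr
  obtain ⟨v, hv⟩ := exists_volume_dyadicAnnulus_le d
  have hpt : ∀ b : EuclideanSpace ℝ (Fin d) → ℂ, Integrable b →
      (∀ ξ, ξ ∉ closedAnnulus d r R → b ξ = 0) → ∀ j : ℕ,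
      ∀ x, waveEnergy ρ b j x ≤ max A₁ 1 * eLpNorm b 2 volume := by
    intro b hb hbs j x
    refine le_mul_of_sq_le ?_ (by exact_mod_cast le_max_right A₁ 1)
    rw [waveEnergy_sq, eLpNorm_two_sq]
    exact (hA₁ b hb hbs x _ (by positivity)).trans (by gcongr; exact_mod_cast le_max_left A₁ 1)
  refine ⟨max A₁ 1 + max (2 * A₂) 1 + max A₁ 1 * v, fun b hb hbs j =>
    ⟨fun x => ?_, fun m => ?_⟩⟩
  · refine (hpt b hb hbs j x).trans ?_
    gcongr
    rw [add_assoc]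
    exact le_self_add
  rcases le_or_gt 0 m with hm | hm
  · rw [smoothingWeight, if_pos hm]
    have h2 : (1 : ℝ) ≤ 2 ^ (m + 1) := one_le_zpow₀ one_le_two (by linarith)
    have hsub : dyadicAnnulus d m ⊆ Metric.closedBall 0 ((2 : ℝ) ^ (m + 1)) := fun x hx => by
      simpa using hx.2.le
    have h3 := hA₂ b hb hbs _ h2 (2 ^ j) (by positivity)
    have h4 : eLpNorm (waveEnergy ρ b j) 2 (volume.restrict (dyadicAnnulus d m)) ≤
        max (2 * A₂) 1 * ((2 : ℝ≥0∞) ^ ((m : ℝ) * (1 / 2)) * eLpNorm b 2 volume) := by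
      refine le_mul_of_sq_le ?_ (by exact_mod_cast le_max_right _ _)
      rw [eLpNorm_two_sq, mul_pow, eLpNorm_two_sq volume b]
      simp only [enorm_eq_self, waveEnergy_sq]
      refine (lintegral_mono' (Measure.restrict_mono hsub le_rfl) le_rfl).trans (h3.trans ?_)
      have h5 : ENNReal.ofReal ((2 : ℝ) ^ (m + 1)) =
          2 * ((2 : ℝ≥0∞) ^ ((m : ℝ) * (1 / 2))) ^ 2 := by
        rw [ofReal_two_zpow, ← ENNReal.rpow_natCast, ← ENNReal.rpow_mul]
        push_cast
        rw [two_rpow_add, ENNReal.rpow_one, mul_comm]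
        congr 2
        ring
      rw [h5]
      calc _ = (2 * A₂ : ℝ≥0∞) * (((2 : ℝ≥0∞) ^ ((m : ℝ) * (1 / 2))) ^ 2 * ∫⁻ ξ, ‖b ξ‖ₑ ^ 2) := by
            ring
        _ ≤ _ := by
            gcongr
            exact_mod_cast le_max_left (2 * A₂) 1
    refine h4.trans ?_
    rw [← mul_assoc]
    gcongr
    rw [add_right_comm]
    exact le_add_self
  · rw [smoothingWeight, if_neg (not_le.2 hm)]
    calc eLpNorm (waveEnergy ρ b j) 2 (volume.restrict (dyadicAnnulus d m))
        ≤ eLpNorm (fun _ : EuclideanSpace ℝ (Fin d) => max A₁ 1 * eLpNorm b 2 volume) 2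
            (volume.restrict (dyadicAnnulus d m)) :=
          eLpNorm_mono_enorm fun x => by simpa using hpt b hb hbs j x
      _ = max A₁ 1 * eLpNorm b 2 volume * volume (dyadicAnnulus d m) ^ (1 / 2 : ℝ) := by
          rw [eLpNorm_const' _ two_ne_zero ENNReal.ofNat_ne_top]
          simp
      _ ≤ max A₁ 1 * eLpNorm b 2 volume * (v * 2 ^ ((m : ℝ) * (d / 2))) := by gcongr; exact hv m
      _ = ((max A₁ 1 : ℝ≥0) * v) * 2 ^ ((m : ℝ) * (d / 2)) * eLpNorm b 2 volume := by
          push_cast; ring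
      _ ≤ _ := by
          gcongr
          push_cast
          exact le_add_self

theorem lintegral_comp_div {t : ℝ} (ht : 0 < t) {F : ℝ → ℝ≥0∞} (hF : Measurable F) :
    ∫⁻ τ, F (τ / t) = ENNReal.ofReal t * ∫⁻ τ, F τ := by
  have h1 := Real.map_volume_mul_right (inv_ne_zero ht.ne')
  simp only [div_eq_mul_inv]
  rw [← lintegral_map hF (measurable_mul_const _), h1, lintegral_smul_measure]
  simp [abs_of_pos ht]

/-- Cauchy-Schwarz in `τ`, after which the bound is uniform in `t`: since `t ≥ 1` the times `τ / t`
stay in the interval `|τ| ≤ 2^j`, and the change of variables costs a factor `t ≤ 2^β`. -/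
theorem IsDyadicCutoff.lintegral_fourierPiece_mul_waveEvolution_le (hζ : IsDyadicCutoff ζ)
    (hh : Integrable h) (hρ : Measurable ρ) {b : EuclideanSpace ℝ (Fin d) → ℂ} (hb : Integrable b)
    {t : ℝ} (hβ : 0 < β) (ht : t ∈ Icc 1 ((2 : ℝ) ^ β)) (j : ℕ) (x : EuclideanSpace ℝ (Fin d)) :
    ∫⁻ τ, ‖fourierPiece ζ h j τ‖ₑ * ‖waveEvolution ρ b (τ / t) x‖ₑ ≤
      ENNReal.ofReal (2 ^ β) *
        (eLpNorm (littlewoodPaley ζ j h) 2 volume * waveEnergy ρ b j x) := by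
  have ht0 : 0 < t := one_pos.trans_le ht.1
  set I : Set ℝ := Icc (-(2 : ℝ) ^ j) (2 ^ j) with hI
  have hUm : Measurable fun τ => waveEvolution ρ b τ x :=
    measurable_waveEvolution_comp hρ hb.aestronglyMeasurable measurable_id measurable_const
  have hUm' : Measurable fun τ => waveEvolution ρ b (τ / t) x :=
    measurable_waveEvolution_comp hρ hb.aestronglyMeasurable (measurable_id.div_const t)
      measurable_const
  have h1 : ∫⁻ τ, ‖fourierPiece ζ h j τ‖ₑ * ‖waveEvolution ρ b (τ / t) x‖ₑ =
      ∫⁻ τ in I, ‖fourierPiece ζ h j τ‖ₑ * ‖waveEvolution ρ b (τ / t) x‖ₑ := by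
    rw [← lintegral_indicator measurableSet_Icc]
    refine lintegral_congr fun τ => ?_
    by_cases hτ : τ ∈ I
    · rw [indicator_of_mem hτ]
    · rw [indicator_of_notMem hτ, hζ.fourierPiece_eq_zero hτ, enorm_zero, zero_mul]
  have h2 : eLpNorm (fun τ => waveEvolution ρ b (τ / t) x) 2 (volume.restrict I) ≤
      ENNReal.ofReal (2 ^ β) * waveEnergy ρ b j x := by
    refine le_mul_of_sq_le ?_ ?_
    · rw [eLpNorm_two_sq, waveEnergy_sq, ← lintegral_indicator measurableSet_Icc,
        ← lintegral_indicator measurableSet_Icc]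
      calc ∫⁻ τ, I.indicator (fun τ => ‖waveEvolution ρ b (τ / t) x‖ₑ ^ 2) τ
          ≤ ∫⁻ τ, I.indicator (fun τ => ‖waveEvolution ρ b τ x‖ₑ ^ 2) (τ / t) := by
            refine lintegral_mono fun τ => ?_
            by_cases hτ : τ ∈ I
            · have hτ' : τ / t ∈ I := by
                have h3 : |τ| ≤ 2 ^ j := abs_le.2 hτ
                refine abs_le.1 ?_
                rw [abs_div, abs_of_pos ht0]
                exact (div_le_self (abs_nonneg τ) ht.1).trans h3
              rw [indicator_of_mem hτ, indicator_of_mem hτ']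
            · rw [indicator_of_notMem hτ]; exact zero_le
        _ = ENNReal.ofReal t * ∫⁻ τ, I.indicator (fun τ => ‖waveEvolution ρ b τ x‖ₑ ^ 2) τ :=
            lintegral_comp_div ht0 ((hUm.enorm.pow_const 2).indicator measurableSet_Icc)
        _ ≤ _ := by gcongr; exact ht.2
    · exact ENNReal.one_le_ofReal.2 (Real.one_le_rpow one_le_two hβ.le)
  rw [h1]
  refine (lintegral_mul_le_eLpNorm_two (hζ.continuous_fourierPiece hh j).aestronglyMeasurable
    hUm'.aestronglyMeasurable).trans ?_
  rw [mul_left_comm]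
  gcongr
  rw [hζ.eLpNorm_littlewoodPaley hh]
  exact eLpNorm_mono_measure _ Measure.restrict_le_self

end SingleScale

/-! ### The maximal function over one dilation block -/

section SingleScaleMaximal

variable {d : ℕ} {ρ : EuclideanSpace ℝ (Fin d) → ℝ} {β : ℝ} {ζ : ℝ → ℝ} {h : ℝ → ℂ}
  {χ : EuclideanSpace ℝ (Fin d) → ℝ} {r R : ℝ} {g : EuclideanSpace ℝ (Fin d) → ℂ}

theorem eLpNorm_two_const_mul {X : Type*} [MeasurableSpace X] {μ : Measure X} (c : ℝ≥0∞)
    {F : X → ℝ≥0∞} (hF : AEMeasurable F μ) :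
    eLpNorm (fun x => c * F x) 2 μ = c * eLpNorm F 2 μ := by
  refine (ENNReal.pow_right_strictMono two_ne_zero).injective ?_
  simp only [mul_pow, eLpNorm_two_sq, enorm_eq_self]
  exact lintegral_const_mul'' _ (hF.pow_const 2)

/-- The maximal function over the single dilation block `1 ≤ t ≤ 2^β`. -/
noncomputable def singleScaleMaximal (ρ : EuclideanSpace ℝ (Fin d) → ℝ) (β : ℝ) (h : ℝ → ℂ)
    (g : EuclideanSpace ℝ (Fin d) → ℂ) (x : EuclideanSpace ℝ (Fin d)) : ℝ≥0∞ :=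
  ⨆ t : Icc (1 : ℝ) (2 ^ β), ‖fourierMultiplier (quasiradial ρ h t) g x‖ₑ

/-- The part of `Σ_j ‖V_j h‖₂` over the frequencies `2^j` that are at least comparable to `2^n`. -/
noncomputable def highFrequencySum (ζ : ℝ → ℝ) (κ : ℝ) (h : ℝ → ℂ) (n : ℤ) : ℝ≥0∞ :=
  ∑' j : ℕ, if (2 : ℝ) ^ n < 2 * κ * 2 ^ j then eLpNorm (littlewoodPaley ζ j h) 2 volume else 0

/-- The size of the error terms coming from frequencies `2^j` much smaller than `2^n`. They are
present only for `n ≥ 1`. -/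
noncomputable def tailDecay (d : ℕ) (n : ℤ) : ℝ≥0∞ :=
  if 1 ≤ n then 2 ^ (-((n : ℝ) * (d / 2 + 1))) else 0

theorem IsFrequencyCutoff.enorm_fourierMultiplier_le_tsum [Nonempty (Fin d)]
    (hχ : IsFrequencyCutoff ρ β χ r R) (hρ : IsHomogeneousDistance ρ β) (hζ : IsDyadicCutoff ζ)
    (hh : Integrable h) (hs : Function.support h ⊆ Ioo (1 / 2) 2) (hB : halfBesovNorm ζ h < ∞)
    {t : ℝ} (ht : t ∈ Icc 1 ((2 : ℝ) ^ β)) (hg : Integrable g) (x : EuclideanSpace ℝ (Fin d)) :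
    ‖fourierMultiplier (quasiradial ρ h t) g x‖ₑ ≤
      ∑' j, ∫⁻ τ, ‖fourierPiece ζ h j τ‖ₑ *
        ‖waveEvolution (angularRescale ρ) (localizedFourier χ g) (τ / t) x‖ₑ := by
  have hF := hζ.integrable_fourier hh hB
  have hUm : Measurable fun τ =>
      waveEvolution (angularRescale ρ) (localizedFourier χ g) (τ / t) x :=
    measurable_waveEvolution_comp hρ.angularRescale.measurable
      (hχ.integrable_localizedFourier hg).aestronglyMeasurable (measurable_id.div_const t)
      measurable_const
  rw [hχ.fourierMultiplier_eq_integral hρ hh hs hF ht hg x]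
  have hm : ∀ j, AEMeasurable (fun τ => ‖fourierPiece ζ h j τ‖ₑ *
      ‖waveEvolution (angularRescale ρ) (localizedFourier χ g) (τ / t) x‖ₑ) volume := fun j =>
    ((hζ.continuous_fourierPiece hh j).measurable.enorm.mul hUm.enorm).aemeasurable
  rw [← lintegral_tsum hm]
  refine (enorm_integral_le_lintegral_enorm _).trans (lintegral_mono fun τ => ?_)
  rw [enorm_mul, ENNReal.tsum_mul_right]
  gcongr
  exact hζ.enorm_fourier_le_tsum h τ

theorem lintegral_enorm_le_of_support_subset {A : Set (EuclideanSpace ℝ (Fin d))}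
    (hA : MeasurableSet A) (hg : AEStronglyMeasurable g) (hgA : Function.support g ⊆ A) :
    ∫⁻ y, ‖g y‖ₑ ≤ volume A ^ (1 / 2 : ℝ) * eLpNorm g 2 volume := by
  have h1 : ∫⁻ y, ‖g y‖ₑ = ∫⁻ y, ‖A.indicator (fun _ => (1 : ℂ)) y‖ₑ * ‖g y‖ₑ := by
    refine lintegral_congr fun y => ?_
    by_cases hy : y ∈ A
    · simp [hy]
    · have : g y = 0 := Function.notMem_support.1 fun h => hy (hgA h)
      simp [this]
  rw [h1]
  refine (lintegral_mul_le_eLpNorm_two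
    (aestronglyMeasurable_const.indicator hA) hg).trans (le_of_eq ?_)
  rw [eLpNorm_indicator_const hA two_ne_zero ENNReal.ofNat_ne_top]
  simp

/-- If `g` lives on the `n`-th annulus and `x` is well inside of it, the frequencies `2^j` much
smaller than `2^n` contribute only a rapidly decaying error, by finite speed of propagation. -/
theorem IsFrequencyCutoff.exists_lintegral_fourierPiece_mul_waveEvolution_le
    (hχ : IsFrequencyCutoff ρ β χ r R) (hρ : IsHomogeneousDistance ρ β) (hζ : IsDyadicCutoff ζ) :
    ∃ C : ℝ≥0, ∃ κ : ℝ, 1 ≤ κ ∧ ∀ h : ℝ → ℂ, Integrable h →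
      ∀ n : ℤ, ∀ g : EuclideanSpace ℝ (Fin d) → ℂ, Integrable g →
      Function.support g ⊆ dyadicAnnulus d n → ∀ t ∈ Icc 1 ((2 : ℝ) ^ β),
      ∀ x : EuclideanSpace ℝ (Fin d), ‖x‖ ≤ 2 ^ (n - 1) → ∀ j : ℕ, 2 * κ * 2 ^ j ≤ (2 : ℝ) ^ n →
      ∫⁻ τ, ‖fourierPiece ζ h j τ‖ₑ *
        ‖waveEvolution (angularRescale ρ) (localizedFourier χ g) (τ / t) x‖ₑ ≤
      C * tailDecay d n * eLpNorm g 2 volume *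
        (2 ^ ((j : ℝ) * (1 / 2)) * eLpNorm (littlewoodPaley ζ j h) 2 volume) := by
  obtain ⟨κ, hκ, hκC⟩ := hρ.angularRescale.exists_norm_waveEvolution_cutoff_le hχ.inner_pos
    hχ.outer_pos hχ.smooth hχ.support_subset
  -- decay of order `d + 1`, of which `d / 2` is lost in passing from `‖g‖₁` to `‖g‖₂`
  obtain ⟨C, hC, hKC⟩ := hκC (d + 1)
  obtain ⟨v, hv⟩ := exists_volume_dyadicAnnulus_le d
  refine ⟨C.toNNReal * 2 ^ (d + 1) * v * 2, κ, hκ, fun h hh n g hg hgs t ht x hx j hj => ?_⟩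
  have ht0 : 0 < t := one_pos.trans_le ht.1
  have hn2 : (2 : ℝ) ^ n = 2 ^ (n - 1) * 2 := by
    rw [zpow_sub_one₀ two_ne_zero, inv_mul_cancel_right₀ two_ne_zero]
  have hn0 : (0 : ℝ) < 2 ^ (n - 1) := by positivity
  -- the hypothesis `hj` with `κ ≥ 1` forces `2^n ≥ 2`
  have hn1 : 1 ≤ n := by
    by_contra hlt
    have h1 : (2 : ℝ) ^ n ≤ 1 := zpow_le_one_of_nonpos₀ one_le_two (by omega)
    have h2 : (1 : ℝ) ≤ 2 ^ j := one_le_pow₀ one_le_two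
    nlinarith
  set D : ℝ := C / (2 ^ (n - 1)) ^ (d + 1) with hD
  have hU : ∀ τ ∈ Icc (-(2 : ℝ) ^ j) (2 ^ j),
      ‖waveEvolution (angularRescale ρ) (localizedFourier χ g) (τ / t) x‖ₑ ≤
        ENNReal.ofReal D * ∫⁻ y, ‖g y‖ₑ := by
    intro τ hτ
    refine (hχ.enorm_waveEvolution_localizedFourier_le hρ hg (τ / t) x).trans ?_
    rw [← lintegral_const_mul' _ _ ENNReal.ofReal_ne_top]
    refine lintegral_mono fun y => ?_
    by_cases hy : g y = 0
    · simp [hy]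
    gcongr
    have hy1 : (2 : ℝ) ^ n ≤ ‖y‖ := (hgs hy).1
    have hxy : (2 : ℝ) ^ (n - 1) ≤ ‖x - y‖ := by
      have := norm_sub_norm_le y x
      rw [norm_sub_rev] at this
      linarith
    have hτt : |τ / t| ≤ 2 ^ j := by
      rw [abs_div, abs_of_pos ht0]
      exact (div_le_self (abs_nonneg τ) ht.1).trans (abs_le.2 hτ)
    -- `κ |τ / t| ≤ κ 2^j ≤ 2^{n-1} ≤ |x - y|`, so that the kernel is evaluated in its tail
    have hne : x - y ≠ 0 := norm_pos_iff.1 (hn0.trans_le hxy)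
    have hK := hKC (x - y) (τ / t) hne (by nlinarith)
    rw [← ofReal_norm]
    refine ENNReal.ofReal_le_ofReal (hK.trans ?_)
    rw [hD]
    gcongr
  calc ∫⁻ τ, ‖fourierPiece ζ h j τ‖ₑ *
        ‖waveEvolution (angularRescale ρ) (localizedFourier χ g) (τ / t) x‖ₑ
      ≤ ∫⁻ τ, ‖fourierPiece ζ h j τ‖ₑ * (ENNReal.ofReal D * ∫⁻ y, ‖g y‖ₑ) := by
        refine lintegral_mono fun τ => ?_
        by_cases hτ : τ ∈ Icc (-(2 : ℝ) ^ j) (2 ^ j)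
        · gcongr
          exact hU τ hτ
        · rw [hζ.fourierPiece_eq_zero hτ, enorm_zero, zero_mul, zero_mul]
    _ = (∫⁻ τ, ‖fourierPiece ζ h j τ‖ₑ) * (ENNReal.ofReal D * ∫⁻ y, ‖g y‖ₑ) :=
        lintegral_mul_const _ (hζ.continuous_fourierPiece hh j).measurable.enorm
    _ ≤ (2 * 2 ^ ((j : ℝ) * (1 / 2)) * eLpNorm (littlewoodPaley ζ j h) 2 volume) *
          (ENNReal.ofReal D * ((v * 2 ^ ((n : ℝ) * (d / 2))) * eLpNorm g 2 volume)) := by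
        gcongr
        · exact hζ.lintegral_fourierPiece_le hh j
        · refine (lintegral_enorm_le_of_support_subset (measurableSet_dyadicAnnulus n)
            hg.aestronglyMeasurable hgs).trans ?_
          gcongr
          exact hv n
    _ = _ := by
        have h5 : ENNReal.ofReal D =
            C.toNNReal * 2 ^ (d + 1) * 2 ^ (-((n : ℝ) * (d + 1))) := by
          have h6 : D = C * 2 ^ (d + 1) * (2 : ℝ) ^ (-((n : ℝ) * (d + 1))) := by
            rw [hD, zpow_sub_one₀ two_ne_zero, mul_pow, Real.rpow_neg zero_le_two,
              Real.rpow_mul zero_le_two, Real.rpow_intCast]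
            have : ((d : ℝ) + 1) = ((d + 1 : ℕ) : ℝ) := by push_cast; ring
            rw [this, Real.rpow_natCast]
            field_simp
            rw [mul_assoc, ← mul_pow]
            norm_num
          rw [h6, ENNReal.ofReal_mul (by positivity), ENNReal.ofReal_mul hC,
            ENNReal.ofReal_pow zero_le_two, ← ENNReal.ofReal_rpow_of_pos two_pos,
            ENNReal.ofReal_ofNat]
          rfl
        have h7 : (2 : ℝ≥0∞) ^ (-((n : ℝ) * (d + 1))) * 2 ^ ((n : ℝ) * (d / 2)) =
            tailDecay d n := by
          rw [tailDecay, if_pos hn1, ← two_rpow_add]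
          congr 1
          ring
        rw [h5, ← h7]
        push_cast
        ring

/-- The contribution of the frequency `2^j` is controlled by the energy of the propagator. -/
theorem IsFrequencyCutoff.enorm_fourierMultiplier_le_waveEnergy [Nonempty (Fin d)]
    (hχ : IsFrequencyCutoff ρ β χ r R) (hρ : IsHomogeneousDistance ρ β) (hζ : IsDyadicCutoff ζ)
    (hh : Integrable h) (hs : Function.support h ⊆ Ioo (1 / 2) 2) (hB : halfBesovNorm ζ h < ∞)
    {t : ℝ} (ht : t ∈ Icc 1 ((2 : ℝ) ^ β)) (hg : Integrable g) (x : EuclideanSpace ℝ (Fin d)) :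
    ‖fourierMultiplier (quasiradial ρ h t) g x‖ₑ ≤
      ENNReal.ofReal (2 ^ β) * ∑' j, eLpNorm (littlewoodPaley ζ j h) 2 volume *
        waveEnergy (angularRescale ρ) (localizedFourier χ g) j x := by
  refine (hχ.enorm_fourierMultiplier_le_tsum hρ hζ hh hs hB ht hg x).trans ?_
  rw [← ENNReal.tsum_mul_left]
  exact ENNReal.tsum_le_tsum fun j => hζ.lintegral_fourierPiece_mul_waveEvolution_le hh
    hρ.angularRescale.measurable (hχ.integrable_localizedFourier hg) hρ.degree_pos ht j x

/-- For `x` well inside the annulus carrying `g`, only the high frequencies contribute to the main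
term. -/
theorem IsFrequencyCutoff.exists_enorm_fourierMultiplier_le_highFrequency [Nonempty (Fin d)]
    (hχ : IsFrequencyCutoff ρ β χ r R) (hρ : IsHomogeneousDistance ρ β) (hζ : IsDyadicCutoff ζ) :
    ∃ C : ℝ≥0, ∃ κ : ℝ, 1 ≤ κ ∧ ∀ h : ℝ → ℂ, Integrable h →
      Function.support h ⊆ Ioo (1 / 2) 2 → halfBesovNorm ζ h < ∞ →
      ∀ n : ℤ, ∀ g : EuclideanSpace ℝ (Fin d) → ℂ, Integrable g →
      Function.support g ⊆ dyadicAnnulus d n → ∀ t ∈ Icc 1 ((2 : ℝ) ^ β),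
      ∀ x : EuclideanSpace ℝ (Fin d), ‖x‖ ≤ 2 ^ (n - 1) →
      ‖fourierMultiplier (quasiradial ρ h t) g x‖ₑ ≤
        ENNReal.ofReal (2 ^ β) * (∑' j : ℕ, if (2 : ℝ) ^ n < 2 * κ * 2 ^ j then
          eLpNorm (littlewoodPaley ζ j h) 2 volume *
            waveEnergy (angularRescale ρ) (localizedFourier χ g) j x else 0) +
        C * (halfBesovNorm ζ h * tailDecay d n) * eLpNorm g 2 volume := by
  obtain ⟨C, κ, hκ, hC⟩ := hχ.exists_lintegral_fourierPiece_mul_waveEvolution_le hρ hζ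
  refine ⟨C, κ, hκ, fun h hh hs hB n g hg hgs t ht x hx => ?_⟩
  refine (hχ.enorm_fourierMultiplier_le_tsum hρ hζ hh hs hB ht hg x).trans ?_
  have h1 : C * (halfBesovNorm ζ h * tailDecay d n) * eLpNorm g 2 volume =
      ∑' j : ℕ, C * tailDecay d n * eLpNorm g 2 volume *
        (2 ^ ((j : ℝ) * (1 / 2)) * eLpNorm (littlewoodPaley ζ j h) 2 volume) := by
    rw [ENNReal.tsum_mul_left, halfBesovNorm]
    ring
  rw [h1, ← ENNReal.tsum_mul_left, ← ENNReal.tsum_add]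
  refine ENNReal.tsum_le_tsum fun j => ?_
  split_ifs with hj
  · exact (hζ.lintegral_fourierPiece_mul_waveEvolution_le hh hρ.angularRescale.measurable
      (hχ.integrable_localizedFourier hg) hρ.degree_pos ht j x).trans le_self_add
  · rw [mul_zero, zero_add]
    exact hC h hh n g hg hgs t ht x hx j (not_lt.1 hj)

/-- The `L²` bound for the maximal function over one dilation block. -/
theorem IsFrequencyCutoff.eLpNorm_singleScaleMaximal_le [Nonempty (Fin d)]
    (hχ : IsFrequencyCutoff ρ β χ r R) (hρ : IsHomogeneousDistance ρ β) (hζ : IsDyadicCutoff ζ)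
    (hh : Integrable h) (hs : Function.support h ⊆ Ioo (1 / 2) 2) (hB : halfBesovNorm ζ h < ∞)
    (hg : Integrable g) :
    eLpNorm (singleScaleMaximal ρ β h g) 2 volume ≤
      ENNReal.ofReal (2 ^ β) * 2 * halfBesovNorm ζ h *
        eLpNorm (localizedFourier χ g) 2 volume := by
  have hρm := hρ.angularRescale.measurable
  have hb := hχ.integrable_localizedFourier hg
  calc eLpNorm (singleScaleMaximal ρ β h g) 2 volume
      ≤ eLpNorm (fun x => ∑' j, ENNReal.ofReal (2 ^ β) *
          eLpNorm (littlewoodPaley ζ j h) 2 volume *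
          waveEnergy (angularRescale ρ) (localizedFourier χ g) j x) 2 volume := by
        refine eLpNorm_mono_enorm fun x => ?_
        simp only [enorm_eq_self, mul_assoc, ENNReal.tsum_mul_left]
        exact iSup_le fun t =>
          hχ.enorm_fourierMultiplier_le_waveEnergy hρ hζ hh hs hB t.2 hg x
    _ ≤ ∑' j, eLpNorm (fun x => ENNReal.ofReal (2 ^ β) *
          eLpNorm (littlewoodPaley ζ j h) 2 volume *
          waveEnergy (angularRescale ρ) (localizedFourier χ g) j x) 2 volume :=
        eLpNorm_tsum_le (fun j => ((measurable_waveEnergy hρm hb.aestronglyMeasurable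
          j).const_mul _).aemeasurable) one_le_two
    _ ≤ ∑' j : ℕ, ENNReal.ofReal (2 ^ β) * eLpNorm (littlewoodPaley ζ j h) 2 volume *
          (2 * ((2 : ℝ≥0∞) ^ ((j : ℝ) * (1 / 2)) * eLpNorm (localizedFourier χ g) 2 volume)) := by
        refine ENNReal.tsum_le_tsum fun j => ?_
        rw [eLpNorm_two_const_mul _ (measurable_waveEnergy hρm
          hb.aestronglyMeasurable j).aemeasurable]
        gcongr
        exact eLpNorm_waveEnergy_le hρm hb (hχ.memLp_localizedFourier hg) j
    _ = _ := by
        rw [halfBesovNorm, ← ENNReal.tsum_mul_left, ← ENNReal.tsum_mul_right]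
        exact tsum_congr fun j => by ring

/-- Uniform bounds for the multipliers over one dilation block: globally, and well inside the
annulus carrying `g`. -/
theorem IsFrequencyCutoff.exists_singleScale_le [Nonempty (Fin d)]
    (hχ : IsFrequencyCutoff ρ β χ r R) (hρ : IsHomogeneousDistance ρ β) (hζ : IsDyadicCutoff ζ) :
    ∃ C : ℝ≥0, ∃ κ : ℝ, 1 ≤ κ ∧ ∀ h : ℝ → ℂ, Integrable h →
      Function.support h ⊆ Ioo (1 / 2) 2 → halfBesovNorm ζ h < ∞ →
      ∀ n : ℤ, ∀ g : EuclideanSpace ℝ (Fin d) → ℂ, Integrable g → MemLp g 2 →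
      Function.support g ⊆ dyadicAnnulus d n →
      (∀ x, singleScaleMaximal ρ β h g x ≤ C * halfBesovNorm ζ h * eLpNorm g 2 volume) ∧
      (∀ x, ‖x‖ ≤ 2 ^ (n - 1) → singleScaleMaximal ρ β h g x ≤
        C * (highFrequencySum ζ κ h n + halfBesovNorm ζ h * tailDecay d n) * eLpNorm g 2 volume) ∧
      eLpNorm (singleScaleMaximal ρ β h g) 2 volume ≤
        C * halfBesovNorm ζ h * eLpNorm (localizedFourier χ g) 2 volume ∧
      ∀ m : ℤ, m + 2 ≤ n →
        eLpNorm (singleScaleMaximal ρ β h g) 2 (volume.restrict (dyadicAnnulus d m)) ≤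
          C * smoothingWeight d m * highFrequencySum ζ κ h n *
            eLpNorm (localizedFourier χ g) 2 volume +
          C * (halfBesovNorm ζ h * tailDecay d n) * 2 ^ ((m : ℝ) * (d / 2)) *
            eLpNorm g 2 volume := by
  obtain ⟨C, κ, hκ, hC⟩ := hχ.exists_enorm_fourierMultiplier_le_highFrequency hρ hζ
  obtain ⟨A, hA⟩ := hρ.angularRescale.exists_waveEnergy_le (R := R) hχ.inner_pos
  obtain ⟨v, hv⟩ := exists_volume_dyadicAnnulus_le d
  set b₀ : ℝ≥0 := ((2 : ℝ) ^ β).toNNReal with hb₀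
  set K : ℝ≥0 := b₀ * A + C + b₀ * 2 + C * v with hK
  have hK1 : (b₀ : ℝ≥0∞) * A ≤ K := by
    rw [hK]; push_cast; rw [add_assoc, add_assoc]; exact le_self_add
  have hK2 : (C : ℝ≥0∞) ≤ K := by
    rw [hK]; push_cast; rw [add_assoc, add_right_comm, add_comm _ (C : ℝ≥0∞)]
    exact le_self_add
  have hK3 : (b₀ : ℝ≥0∞) * 2 ≤ K := by
    rw [hK]; push_cast; rw [add_right_comm]; exact le_add_self
  have hK4 : (C : ℝ≥0∞) * v ≤ K := by
    rw [hK]; push_cast; exact le_add_self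
  refine ⟨K, κ, hκ, fun h hh hs hB n g hg hg2 hgs => ?_⟩
  have hρm := hρ.angularRescale.measurable
  have hb := hχ.integrable_localizedFourier hg
  have hbg := hχ.eLpNorm_localizedFourier_le hg hg2
  have hAb := hA _ hb hχ.localizedFourier_eq_zero
  set b := localizedFourier χ g with hbdef
  set N : ℕ → ℝ≥0∞ := fun j => eLpNorm (littlewoodPaley ζ j h) 2 volume with hN
  have hNB : ∑' j, N j ≤ halfBesovNorm ζ h := by
    refine ENNReal.tsum_le_tsum fun j => le_mul_of_one_le_left zero_le ?_
    simpa using ENNReal.rpow_le_rpow_of_exponent_le one_le_two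
      (show (0 : ℝ) ≤ (j : ℝ) * (1 / 2) by positivity)
  have hhigh : ∀ x, ‖x‖ ≤ 2 ^ (n - 1) → singleScaleMaximal ρ β h g x ≤
      b₀ * (∑' j : ℕ, if (2 : ℝ) ^ n < 2 * κ * 2 ^ j then
          N j * waveEnergy (angularRescale ρ) b j x else 0) +
        C * (halfBesovNorm ζ h * tailDecay d n) * eLpNorm g 2 volume := fun x hx =>
    iSup_le fun t => hC h hh hs hB n g hg hgs t t.2 x hx
  refine ⟨fun x => ?_, fun x hx => ?_, ?_, fun m hm => ?_⟩
  · refine iSup_le fun t =>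
      (hχ.enorm_fourierMultiplier_le_waveEnergy hρ hζ hh hs hB t.2 hg x).trans ?_
    calc (b₀ : ℝ≥0∞) * ∑' j, N j * waveEnergy (angularRescale ρ) b j x
        ≤ b₀ * ∑' j, N j * (A * eLpNorm g 2 volume) := by
          gcongr with j
          exact ((hAb j).1 x).trans (by gcongr)
      _ = (b₀ * A) * (∑' j, N j) * eLpNorm g 2 volume := by
          rw [ENNReal.tsum_mul_right]; ring
      _ ≤ _ := by gcongr
  · refine (hhigh x hx).trans ?_
    calc b₀ * (∑' j : ℕ, if (2 : ℝ) ^ n < 2 * κ * 2 ^ j then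
          N j * waveEnergy (angularRescale ρ) b j x else 0) +
          C * (halfBesovNorm ζ h * tailDecay d n) * eLpNorm g 2 volume
        ≤ b₀ * (∑' j : ℕ, (if (2 : ℝ) ^ n < 2 * κ * 2 ^ j then N j else 0) *
            (A * eLpNorm g 2 volume)) +
          C * (halfBesovNorm ζ h * tailDecay d n) * eLpNorm g 2 volume := by
          gcongr with j
          split_ifs
          · gcongr
            exact ((hAb j).1 x).trans (by gcongr)
          · exact zero_le
      _ = (b₀ * A) * highFrequencySum ζ κ h n * eLpNorm g 2 volume +
          C * (halfBesovNorm ζ h * tailDecay d n) * eLpNorm g 2 volume := by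
          rw [ENNReal.tsum_mul_right, highFrequencySum]; ring
      _ ≤ K * highFrequencySum ζ κ h n * eLpNorm g 2 volume +
          K * (halfBesovNorm ζ h * tailDecay d n) * eLpNorm g 2 volume := by gcongr
      _ = _ := by ring
  · refine (hχ.eLpNorm_singleScaleMaximal_le hρ hζ hh hs hB hg).trans ?_
    gcongr
    exact hK3
  · -- for `m + 2 ≤ n` the annulus is contained in the ball `|x| ≤ 2^{n-1}`
    have hball : ∀ x ∈ dyadicAnnulus d m, ‖x‖ ≤ 2 ^ (n - 1) := fun x hx =>
      hx.2.le.trans (zpow_le_zpow_right₀ one_le_two (by omega))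
    have hQm : ∀ j, AEMeasurable (waveEnergy (angularRescale ρ) b j)
        (volume.restrict (dyadicAnnulus d m)) := fun j =>
      (measurable_waveEnergy hρm hb.aestronglyMeasurable j).aemeasurable
    have hite : ∀ (j : ℕ) (x : EuclideanSpace ℝ (Fin d)),
        (if (2 : ℝ) ^ n < 2 * κ * 2 ^ j then N j * waveEnergy (angularRescale ρ) b j x else 0) =
        (if (2 : ℝ) ^ n < 2 * κ * 2 ^ j then N j else 0) * waveEnergy (angularRescale ρ) b j x :=
      fun j x => by split_ifs <;> simp
    calc eLpNorm (singleScaleMaximal ρ β h g) 2 (volume.restrict (dyadicAnnulus d m))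
        ≤ eLpNorm ((fun x => ∑' j : ℕ, (b₀ * if (2 : ℝ) ^ n < 2 * κ * 2 ^ j then N j else 0) *
            waveEnergy (angularRescale ρ) b j x) +
            fun _ => C * (halfBesovNorm ζ h * tailDecay d n) * eLpNorm g 2 volume) 2
            (volume.restrict (dyadicAnnulus d m)) := by
          refine eLpNorm_mono_enorm_ae ?_
          filter_upwards [ae_restrict_mem (measurableSet_dyadicAnnulus m)] with x hx
          simp only [enorm_eq_self, Pi.add_apply]
          refine (hhigh x (hball x hx)).trans (le_of_eq ?_)
          simp only [hite, mul_assoc (b₀ : ℝ≥0∞), ENNReal.tsum_mul_left]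
      _ ≤ eLpNorm (fun x => ∑' j : ℕ, (b₀ * if (2 : ℝ) ^ n < 2 * κ * 2 ^ j then N j else 0) *
            waveEnergy (angularRescale ρ) b j x) 2 (volume.restrict (dyadicAnnulus d m)) +
          eLpNorm (fun _ : EuclideanSpace ℝ (Fin d) =>
            C * (halfBesovNorm ζ h * tailDecay d n) * eLpNorm g 2 volume) 2
            (volume.restrict (dyadicAnnulus d m)) := by
          refine eLpNorm_add_le ?_ aestronglyMeasurable_const one_le_two
          exact (AEMeasurable.tsum fun j => (hQm j).const_mul _).aestronglyMeasurable
      _ ≤ (∑' j : ℕ, (b₀ * if (2 : ℝ) ^ n < 2 * κ * 2 ^ j then N j else 0) *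
            (A * smoothingWeight d m * eLpNorm b 2 volume)) +
          C * (halfBesovNorm ζ h * tailDecay d n) * eLpNorm g 2 volume *
            (v * 2 ^ ((m : ℝ) * (d / 2))) := by
          gcongr
          · refine (eLpNorm_tsum_le (fun j => (hQm j).const_mul _) one_le_two).trans
              (ENNReal.tsum_le_tsum fun j => ?_)
            rw [eLpNorm_two_const_mul _ (hQm j)]
            gcongr
            exact (hAb j).2 m
          · rw [eLpNorm_const' _ two_ne_zero ENNReal.ofNat_ne_top]
            simp only [enorm_eq_self, Measure.restrict_apply_univ, ENNReal.toReal_ofNat]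
            gcongr
            exact hv m
      _ = (b₀ * A) * smoothingWeight d m * highFrequencySum ζ κ h n * eLpNorm b 2 volume +
          (C * v) * (halfBesovNorm ζ h * tailDecay d n) * 2 ^ ((m : ℝ) * (d / 2)) *
            eLpNorm g 2 volume := by
          rw [ENNReal.tsum_mul_right, ENNReal.tsum_mul_left, highFrequencySum]
          ring
      _ ≤ _ := by gcongr

end SingleScaleMaximal

/-! ### Geometric sums and the Besov norm -/

section DyadicSums

variable {d : ℕ} {ζ : ℝ → ℝ} {α : ℝ}

theorem tsum_two_rpow_neg_abs_lt_top {ε : ℝ} (hε : 0 < ε) :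
    ∑' i : ℤ, (2 : ℝ≥0∞) ^ (-(|(i : ℝ)| * ε)) < ∞ := by
  rw [tsum_of_nat_of_neg_add_one ENNReal.summable ENNReal.summable, ENNReal.add_lt_top]
  have h1 := tsum_two_rpow_neg_lt_top hε
  constructor
  · simpa using h1
  · refine lt_of_le_of_lt (ENNReal.tsum_le_tsum fun n => ?_) h1
    refine ENNReal.rpow_le_rpow_of_exponent_le one_le_two ?_
    push_cast
    rw [abs_neg, abs_of_nonneg (by positivity)]
    nlinarith

/-- A two-sided sequence that is bounded by a multiple of `2^{-ε|i|}` is summable. -/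
theorem tsum_lt_top_of_le_two_rpow {ε K : ℝ} (hε : 0 < ε) {u : ℤ → ℝ≥0∞}
    (hu : ∀ i : ℤ, u i ≤ 2 ^ (K - |(i : ℝ)| * ε)) : ∑' i, u i < ∞ := by
  refine lt_of_le_of_lt (ENNReal.tsum_le_tsum hu) ?_
  simp only [sub_eq_add_neg, two_rpow_add, ENNReal.tsum_mul_left]
  exact ENNReal.mul_lt_top (two_rpow_ne_top _).lt_top (tsum_two_rpow_neg_abs_lt_top hε)

theorem tsum_ite_two_rpow_neg_mul_lt_top {a : ℝ} (ha : 0 < a) (N : ℤ) :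
    ∑' i : ℤ, (if N ≤ i then (2 : ℝ≥0∞) ^ (-((i : ℝ) * a)) else 0) < ∞ := by
  refine tsum_lt_top_of_le_two_rpow (K := 2 * |(N : ℝ)| * a) ha fun i => ?_
  split_ifs with hi
  · refine ENNReal.rpow_le_rpow_of_exponent_le one_le_two ?_
    have hi' : (N : ℝ) ≤ i := by exact_mod_cast hi
    have h1 : |(i : ℝ)| - i ≤ 2 * |(N : ℝ)| := by
      rcases abs_cases (i : ℝ) with h | h <;> rcases abs_cases (N : ℝ) with h' | h' <;> linarith
    nlinarith
  · exact zero_le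

theorem tsum_ite_two_rpow_mul_lt_top {a : ℝ} (ha : 0 < a) (N : ℤ) :
    ∑' i : ℤ, (if i ≤ N then (2 : ℝ≥0∞) ^ ((i : ℝ) * a) else 0) < ∞ := by
  rw [← (Equiv.neg ℤ).tsum_eq]
  refine lt_of_le_of_lt (ENNReal.tsum_le_tsum fun i => ?_)
    (tsum_ite_two_rpow_neg_mul_lt_top ha (-N))
  simp [neg_le]

/-- The sum over `i ≥ 0` converges because `α > 1/2`, the one over `i < 0` because `α < d/2`. -/
theorem tsum_smoothingWeight_mul_lt_top (hα : 1 / 2 < α) (hαd : α < (d : ℝ) / 2) :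
    ∑' i : ℤ, smoothingWeight d i * 2 ^ (-((i : ℝ) * α)) < ∞ := by
  refine tsum_lt_top_of_le_two_rpow (K := 0) (ε := min (α - 1 / 2) (d / 2 - α))
    (lt_min (by linarith) (by linarith)) fun i => ?_
  have h1 := min_le_left (α - 1 / 2) (d / 2 - α)
  have h2 := min_le_right (α - 1 / 2) (d / 2 - α)
  rw [smoothingWeight]
  split_ifs with hi
  · have hi' : (0 : ℝ) ≤ i := by exact_mod_cast hi
    rw [← two_rpow_add, abs_of_nonneg hi']
    refine ENNReal.rpow_le_rpow_of_exponent_le one_le_two ?_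
    nlinarith
  · have hi' : (i : ℝ) < 0 := by exact_mod_cast not_le.1 hi
    rw [← two_rpow_add, abs_of_neg hi']
    refine ENNReal.rpow_le_rpow_of_exponent_le one_le_two ?_
    nlinarith

theorem seqNorm_extend_nat (p : ℝ≥0∞) (u : ℕ → ℝ≥0∞) :
    seqNorm p (fun n : ℤ => if 0 ≤ n then u n.toNat else 0) = seqNorm p u := by
  rcases eq_or_ne p 0 with rfl | h0
  · simp [seqNorm]
  rcases eq_or_ne p ∞ with rfl | ht
  · simp only [seqNorm_top]
    refine le_antisymm (iSup_le fun n => ?_) (iSup_le fun j => ?_)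
    · split_ifs
      · exact le_iSup u _
      · exact zero_le
    · exact le_iSup_of_le (j : ℤ) (by simp)
  · have hp := ENNReal.toReal_pos h0 ht
    rw [seqNorm_eq h0 ht, seqNorm_eq h0 ht]
    congr 1
    rw [← Function.Injective.tsum_eq (g := ((↑) : ℕ → ℤ)) Nat.cast_injective]
    · simp
    · intro n hn
      by_cases h : 0 ≤ n
      · exact ⟨n.toNat, by simp [h]⟩
      · simp [h, hp] at hn

/-- The weighted high frequency sums are controlled by the Besov norm, by Young's inequality for
convolutions on `ℤ`. -/
theorem exists_seqNorm_highFrequencySum_le (hα : 0 < α) (κ : ℝ) :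
    ∃ C : ℝ≥0, ∀ (ζ : ℝ → ℝ) (h : ℝ → ℂ) (s : ℝ≥0∞), 1 ≤ s →
      seqNorm s (fun n : ℤ => 2 ^ ((n : ℝ) * α) * highFrequencySum ζ κ h n) ≤
        C * besovNorm ζ α s h := by
  obtain ⟨N, hN⟩ := pow_unbounded_of_one_lt (2 * κ) (one_lt_two : (1 : ℝ) < 2)
  set W : ℤ → ℝ≥0∞ := fun i => if i ≤ N then 2 ^ ((i : ℝ) * α) else 0 with hW
  have hWfin : ∑' i, W i < ∞ := tsum_ite_two_rpow_mul_lt_top hα N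
  refine ⟨(∑' i, W i).toNNReal, fun ζ h s hs => ?_⟩
  rw [ENNReal.coe_toNNReal hWfin.ne]
  set u : ℕ → ℝ≥0∞ := fun j => 2 ^ ((j : ℝ) * α) * eLpNorm (littlewoodPaley ζ j h) 2 volume with hu
  have h1 : besovNorm ζ α s h = seqNorm s (fun n : ℤ => if 0 ≤ n then u n.toNat else 0) :=
    (seqNorm_extend_nat s u).symm
  rw [h1]
  refine le_trans (seqNorm_mono fun n => ?_) (seqNorm_convolution_le hs W _)
  rw [← Function.Injective.tsum_eq (g := ((↑) : ℕ → ℤ)) Nat.cast_injective, highFrequencySum,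
    ← ENNReal.tsum_mul_left]
  · refine ENNReal.tsum_le_tsum fun j => ?_
    split_ifs with hj h2
    · have hnj : n - j ≤ N := by
        by_contra hlt
        have h3 : (2 : ℝ) ^ (N : ℤ) ≤ 2 ^ (n - j) := zpow_le_zpow_right₀ one_le_two (by omega)
        rw [zpow_sub₀ two_ne_zero, le_div_iff₀ (by positivity)] at h3
        simp only [zpow_natCast] at h3
        have h4 : (0 : ℝ) < 2 ^ j := by positivity
        nlinarith
      simp only [hW, if_pos hnj, hu, Int.toNat_natCast]
      rw [← mul_assoc, ← two_rpow_add]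
      refine le_of_eq ?_
      congr 2
      push_cast
      ring
    · simp at h2
    · rw [mul_zero]; exact zero_le
    · rw [mul_zero]; exact zero_le
  · intro m hm
    by_cases h : 0 ≤ m
    · exact ⟨m.toNat, by simp [h]⟩
    · simp [h] at hm

end DyadicSums

/-! ### Decomposition into dyadic annuli -/

section DyadicDecomposition

variable {d : ℕ}

theorem iUnion_dyadicAnnulus (d : ℕ) : ⋃ n : ℤ, dyadicAnnulus d n = {0}ᶜ := by
  ext x
  simp only [mem_iUnion, mem_compl_iff, mem_singleton_iff]
  constructor
  · rintro ⟨n, hn⟩ rfl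
    have : (0 : ℝ) < 2 ^ n := by positivity
    have h1 := hn.1
    rw [norm_zero] at h1
    linarith
  · intro hx
    exact exists_mem_Ico_zpow (norm_pos_iff.2 hx) one_lt_two

theorem pairwise_disjoint_dyadicAnnulus (d : ℕ) :
    Pairwise (Function.onFun Disjoint (dyadicAnnulus d)) := by
  intro m n hmn
  refine disjoint_left.2 fun x hm hn => hmn ?_
  have h1 : (2 : ℝ) ^ m < 2 ^ (n + 1) := hm.1.trans_lt hn.2
  have h2 : (2 : ℝ) ^ n < 2 ^ (m + 1) := hn.1.trans_lt hm.2
  rw [zpow_lt_zpow_iff_right₀ one_lt_two] at h1 h2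
  omega

theorem restrict_iUnion_dyadicAnnulus [Nonempty (Fin d)] :
    (volume : Measure (EuclideanSpace ℝ (Fin d))).restrict (⋃ n : ℤ, dyadicAnnulus d n) =
      volume := by
  have : Nontrivial (EuclideanSpace ℝ (Fin d)) := inferInstance
  rw [iUnion_dyadicAnnulus, restrict_compl_singleton]

theorem lintegral_eq_tsum_dyadicAnnulus [Nonempty (Fin d)]
    (F : EuclideanSpace ℝ (Fin d) → ℝ≥0∞) :
    ∫⁻ x, F x = ∑' n : ℤ, ∫⁻ x in dyadicAnnulus d n, F x := by
  rw [← lintegral_iUnion measurableSet_dyadicAnnulus (pairwise_disjoint_dyadicAnnulus d),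
    restrict_iUnion_dyadicAnnulus]

theorem integral_eq_tsum_dyadicAnnulus [Nonempty (Fin d)]
    {F : EuclideanSpace ℝ (Fin d) → ℂ} (hF : Integrable F) :
    ∫ x, F x = ∑' n : ℤ, ∫ x in dyadicAnnulus d n, F x := by
  have h1 := hasSum_integral_iUnion (f := F) (μ := volume) measurableSet_dyadicAnnulus
    (pairwise_disjoint_dyadicAnnulus d) hF.integrableOn
  rw [restrict_iUnion_dyadicAnnulus] at h1
  exact h1.tsum_eq.symm

/-- The restriction of a function to the `n`-th dyadic annulus, extended by zero. -/
noncomputable def annularPiece (f : EuclideanSpace ℝ (Fin d) → ℂ) (n : ℤ) :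
    EuclideanSpace ℝ (Fin d) → ℂ :=
  (dyadicAnnulus d n).indicator f

theorem support_annularPiece_subset (f : EuclideanSpace ℝ (Fin d) → ℂ) (n : ℤ) :
    Function.support (annularPiece f n) ⊆ dyadicAnnulus d n :=
  support_indicator_subset

theorem eLpNorm_annularPiece (f : EuclideanSpace ℝ (Fin d) → ℂ) (n : ℤ) :
    eLpNorm (annularPiece f n) 2 volume = eLpNorm f 2 (volume.restrict (dyadicAnnulus d n)) :=
  eLpNorm_indicator_eq_eLpNorm_restrict (measurableSet_dyadicAnnulus n)

theorem integrable_of_support_subset_dyadicAnnulus {g : EuclideanSpace ℝ (Fin d) → ℂ}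
    (hg : MemLp g 2) {n : ℤ} (hgs : Function.support g ⊆ dyadicAnnulus d n) : Integrable g := by
  refine ⟨hg.1, (lintegral_enorm_le_of_support_subset (measurableSet_dyadicAnnulus n) hg.1
    hgs).trans_lt (ENNReal.mul_lt_top ?_ hg.2)⟩
  obtain ⟨v, hv⟩ := exists_volume_dyadicAnnulus_le d
  exact (hv n).trans_lt (ENNReal.mul_lt_top ENNReal.coe_lt_top (two_rpow_ne_top _).lt_top)

variable {γ : ℝ} {q : ℝ≥0∞} {f : EuclideanSpace ℝ (Fin d) → ℂ}

theorem eLpNorm_annularPiece_le (γ : ℝ) (f : EuclideanSpace ℝ (Fin d) → ℂ) (hq : q ≠ 0) (n : ℤ) :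
    eLpNorm (annularPiece f n) 2 volume ≤ 2 ^ (-((n : ℝ) * γ)) * herzNorm γ 2 q f := by
  have h1 := le_seqNorm hq (fun l : ℤ => (2 : ℝ≥0∞) ^ ((l : ℝ) * γ) *
    eLpNorm f 2 (volume.restrict (dyadicAnnulus d l))) n
  refine le_trans (le_of_eq ?_) (mul_le_mul_right h1 _)
  rw [← mul_assoc, ← two_rpow_add, neg_add_cancel, ENNReal.rpow_zero, one_mul,
    eLpNorm_annularPiece]

theorem MemHerz.memLp_annularPiece (hf : MemHerz γ 2 q f) (hq : q ≠ 0) (n : ℤ) :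
    MemLp (annularPiece f n) 2 :=
  ⟨hf.1.indicator (measurableSet_dyadicAnnulus n), (eLpNorm_annularPiece_le γ f hq n).trans_lt
    (ENNReal.mul_lt_top (two_rpow_ne_top _).lt_top hf.2)⟩

theorem MemHerz.integrable_annularPiece (hf : MemHerz γ 2 q f) (hq : q ≠ 0) (n : ℤ) :
    Integrable (annularPiece f n) :=
  integrable_of_support_subset_dyadicAnnulus (hf.memLp_annularPiece hq n)
    (support_annularPiece_subset f n)

end DyadicDecomposition

/-! ### Convolution with the multiplier kernel -/

section Kernel

variable {E : Type*} [NormedAddCommGroup E] [InnerProductSpace ℝ E] [FiniteDimensional ℝ E]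
  [MeasurableSpace E] [BorelSpace E] {m g : E → ℂ}

theorem continuous_multiplierKernel (hm : Integrable m) : Continuous (multiplierKernel m) :=
  continuous_fourierInv_of_integrable (hm.comp_smul (by positivity))

theorem norm_multiplierKernel_le (m : E → ℂ) (x : E) :
    ‖multiplierKernel m x‖ ≤ ∫ ξ, ‖m ((2 * Real.pi) • ξ)‖ := by
  rw [multiplierKernel, Real.fourierInv_eq]
  exact (norm_integral_le_integral_norm _).trans (by simp [Circle.norm_smul])

theorem integrable_multiplierKernel_mul (hm : Integrable m) (hg : Integrable g) (x : E) :
    Integrable fun y => multiplierKernel m (x - y) * g y :=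
  hg.bdd_mul ((continuous_multiplierKernel hm).comp (continuous_const.sub
    continuous_id)).aestronglyMeasurable (Filter.Eventually.of_forall fun _ =>
      norm_multiplierKernel_le m _)

theorem continuous_fourierMultiplier (hm : Integrable m) (hg : Integrable g) :
    Continuous (fourierMultiplier m g) := by
  rw [funext (fourierMultiplier_eq_fourierInv hm hg)]
  refine continuous_fourierInv_of_integrable ?_
  refine (hm.comp_smul (by positivity)).mul_bdd (c := ∫ v, ‖g v‖)
    (continuous_fourier_of_integrable hg).aestronglyMeasurable
    (Filter.Eventually.of_forall fun ξ => ?_)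
  rw [Real.fourier_eq]
  exact (norm_integral_le_integral_norm _).trans (by simp [Circle.norm_smul])

/-- Multiplying `g` by a suitable phase turns the convolution with the kernel at a given point into
the convolution of the absolute values. -/
theorem exists_enorm_fourierMultiplier_eq (hm : Integrable m) (hg : AEStronglyMeasurable g)
    (x : E) : ∃ g' : E → ℂ, AEStronglyMeasurable g' ∧ (∀ y, ‖g' y‖ ≤ ‖g y‖) ∧
      (Integrable g → ‖fourierMultiplier m g' x‖ₑ =
        ∫⁻ y, ‖multiplierKernel m (x - y) * g y‖ₑ) := by
  set z : E → ℂ := fun y => multiplierKernel m (x - y) * g y with hz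
  have hzm : AEStronglyMeasurable z :=
    ((continuous_multiplierKernel hm).comp (continuous_const.sub
      continuous_id)).aestronglyMeasurable.mul hg
  have hphase : ∀ y, multiplierKernel m (x - y) * (g y * (star (z y) / ‖z y‖)) = (‖z y‖ : ℂ) := by
    intro y
    by_cases h0 : z y = 0
    · simp [h0]
    · rw [← mul_assoc, mul_div_assoc']
      show z y * star (z y) / _ = _
      have h1 : (‖z y‖ : ℂ) ≠ 0 := by simpa using h0
      rw [div_eq_iff h1]
      have := Complex.mul_conj' (z y)
      rw [sq] at this
      exact this
  refine ⟨fun y => g y * (star (z y) / ‖z y‖), ?_, fun y => ?_, fun hgi => ?_⟩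
  · have h2 : AEMeasurable z := hzm.aemeasurable
    exact (hg.aemeasurable.mul ((Complex.continuous_conj.measurable.comp_aemeasurable h2).div
      (Complex.measurable_ofReal.comp_aemeasurable h2.norm))).aestronglyMeasurable
  · rw [norm_mul]
    refine mul_le_of_le_one_right (norm_nonneg _) ?_
    rw [norm_div, norm_star, Complex.norm_real, norm_norm]
    exact div_self_le_one _
  · rw [fourierMultiplier]
    simp only [hphase]
    rw [integral_complex_ofReal, ← ofReal_norm, Complex.norm_real,
      Real.norm_of_nonneg (integral_nonneg fun _ => norm_nonneg _),
      ofReal_integral_norm_eq_lintegral_enorm (integrable_multiplierKernel_mul hm hgi x)]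

end Kernel

/-! ### Convergence of the convolution integrals -/

section Convergence

variable {d : ℕ} {ρ : EuclideanSpace ℝ (Fin d) → ℝ} {β α : ℝ} {ζ : ℝ → ℝ} {h : ℝ → ℂ}
  {χ : EuclideanSpace ℝ (Fin d) → ℝ} {r R : ℝ} {f : EuclideanSpace ℝ (Fin d) → ℂ} {q s : ℝ≥0∞}

/-- The weight in the uniform estimate, on the ball `|x| ≤ 2^M`, of the multipliers applied to
functions supported in the `n`-th annulus. -/
noncomputable def localWeight (d : ℕ) (ζ : ℝ → ℝ) (κ : ℝ) (h : ℝ → ℂ) (M n : ℤ) : ℝ≥0∞ :=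
  if n ≤ M then halfBesovNorm ζ h
  else highFrequencySum ζ κ h n + halfBesovNorm ζ h * tailDecay d n

theorem one_le_of_inv_add_inv_eq_one (hqs : q⁻¹ + s⁻¹ = 1) : 1 ≤ s := by
  rw [← ENNReal.inv_le_one, ← hqs]
  exact le_add_self

theorem MemBesov.halfBesovNorm_lt_top (hα : 1 / 2 < α) (hs : s ≠ 0) (hh : MemBesov ζ α s h) :
    halfBesovNorm ζ h < ∞ := by
  obtain ⟨C, hC⟩ := exists_halfBesovNorm_le hα
  exact (hC ζ s h hs).trans_lt (ENNReal.mul_lt_top ENNReal.coe_lt_top hh.2)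

/-- The three parts of the sum are controlled by the size of `f` near the origin, by Hölder's
inequality between `ℓ^s` and `ℓ^q`, and by the decay of the error terms, which beats `2^{nα}` since
`α < d/2`. -/
theorem tsum_localWeight_mul_lt_top (hα : 1 / 2 < α) (hαd : α < (d : ℝ) / 2) (hq : q ≠ 0)
    (hqs : q⁻¹ + s⁻¹ = 1) (hh : MemBesov ζ α s h) (hf : MemHerz (-α) 2 q f) (κ : ℝ) (M : ℤ) :
    ∑' n, localWeight d ζ κ h M n * eLpNorm (annularPiece f n) 2 volume < ∞ := by
  have hs1 := one_le_of_inv_add_inv_eq_one hqs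
  have hB := hh.halfBesovNorm_lt_top hα (zero_lt_one.trans_le hs1).ne'
  set B := halfBesovNorm ζ h with hBdef
  set F := herzNorm (-α) 2 q f with hF
  have hα0 : 0 < α := by linarith
  have hpiece : ∀ n : ℤ, eLpNorm (annularPiece f n) 2 volume ≤ 2 ^ ((n : ℝ) * α) * F := fun n => by
    have := eLpNorm_annularPiece_le (-α) f hq n
    rwa [mul_neg, neg_neg] at this
  have h1 : ∑' n : ℤ, (if n ≤ M then (2 : ℝ≥0∞) ^ ((n : ℝ) * α) else 0) * (B * F) < ∞ := by
    rw [ENNReal.tsum_mul_right]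
    exact ENNReal.mul_lt_top (tsum_ite_two_rpow_mul_lt_top hα0 M) (ENNReal.mul_lt_top hB hf.2)
  have h2 : ∑' n : ℤ, (2 ^ ((n : ℝ) * α) * highFrequencySum ζ κ h n) *
      ((2 : ℝ≥0∞) ^ ((n : ℝ) * -α) * eLpNorm f 2 (volume.restrict (dyadicAnnulus d n))) < ∞ := by
    obtain ⟨C, hC⟩ := exists_seqNorm_highFrequencySum_le hα0 κ
    refine (tsum_mul_le_seqNorm_mul hqs _ _).trans_lt (ENNReal.mul_lt_top ?_ hf.2)
    exact (hC ζ h s hs1).trans_lt (ENNReal.mul_lt_top ENNReal.coe_lt_top hh.2)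
  have h3 : ∑' n : ℤ, (if 1 ≤ n then (2 : ℝ≥0∞) ^ (-((n : ℝ) * 1)) else 0) * (B * F) < ∞ := by
    rw [ENNReal.tsum_mul_right]
    exact ENNReal.mul_lt_top (tsum_ite_two_rpow_neg_mul_lt_top one_pos 1)
      (ENNReal.mul_lt_top hB hf.2)
  refine lt_of_le_of_lt (ENNReal.tsum_le_tsum fun n => ?_)
    ((ENNReal.tsum_add.trans_lt (ENNReal.add_lt_top.2 ⟨h1, (ENNReal.tsum_add.trans_lt
      (ENNReal.add_lt_top.2 ⟨h2, h3⟩))⟩)))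
  by_cases hn : n ≤ M
  · simp only [localWeight, if_pos hn]
    refine le_trans ?_ le_self_add
    calc B * eLpNorm (annularPiece f n) 2 volume ≤ B * (2 ^ ((n : ℝ) * α) * F) := by
          gcongr; exact hpiece n
      _ = _ := by ring
  · simp only [localWeight, if_neg hn]
    refine le_trans ?_ le_add_self
    rw [add_mul]
    refine add_le_add (le_of_eq ?_) ?_
    · rw [eLpNorm_annularPiece, mul_mul_mul_comm, ← two_rpow_add, mul_neg,
        add_neg_cancel, ENNReal.rpow_zero, one_mul]
    · by_cases h1n : 1 ≤ n
      · simp only [tailDecay, if_pos h1n]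
        have hn1 : (1 : ℝ) ≤ n := by exact_mod_cast h1n
        calc B * 2 ^ (-((n : ℝ) * (d / 2 + 1))) * eLpNorm (annularPiece f n) 2 volume
            ≤ B * 2 ^ (-((n : ℝ) * (d / 2 + 1))) * (2 ^ ((n : ℝ) * α) * F) := by
              gcongr; exact hpiece n
          _ = 2 ^ (-((n : ℝ) * (d / 2 + 1)) + (n : ℝ) * α) * (B * F) := by
              rw [two_rpow_add]; ring
          _ ≤ _ := by
              gcongr
              · exact one_le_two
              · nlinarith
      · simp [tailDecay, h1n]

/-- Locally uniform bounds for the maximal function of a function supported in an annulus. -/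
theorem IsFrequencyCutoff.exists_singleScaleMaximal_ball_le [Nonempty (Fin d)]
    (hχ : IsFrequencyCutoff ρ β χ r R) (hρ : IsHomogeneousDistance ρ β) (hζ : IsDyadicCutoff ζ) :
    ∃ C : ℝ≥0, ∃ κ : ℝ, ∀ h : ℝ → ℂ, Integrable h →
      Function.support h ⊆ Ioo (1 / 2) 2 → halfBesovNorm ζ h < ∞ →
      ∀ (M n : ℤ) (g : EuclideanSpace ℝ (Fin d) → ℂ), Integrable g → MemLp g 2 →
      Function.support g ⊆ dyadicAnnulus d n → ∀ x, ‖x‖ ≤ 2 ^ M →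
      singleScaleMaximal ρ β h g x ≤ C * (localWeight d ζ κ h M n * eLpNorm g 2 volume) := by
  obtain ⟨C, κ, hκ, hC⟩ := hχ.exists_singleScale_le hρ hζ
  refine ⟨C, κ, fun h hh hs hB M n g hg hg2 hgs x hx => ?_⟩
  obtain ⟨h1, h2, -⟩ := hC h hh hs hB n g hg hg2 hgs
  rw [localWeight, ← mul_assoc]
  split_ifs with hn
  · exact h1 x
  · exact h2 x (hx.trans (zpow_le_zpow_right₀ one_le_two (by omega)))

theorem exists_norm_lt_two_zpow {E : Type*} [NormedAddCommGroup E] (x : E) :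
    ∃ M : ℤ, ‖x‖ < 2 ^ M := by
  obtain ⟨M, hM⟩ := pow_unbounded_of_one_lt ‖x‖ (one_lt_two : (1 : ℝ) < 2)
  exact ⟨M, by simpa using hM⟩

/-- On the annulus decomposition `f = Σ_n f_n` of a function in the Herz space, the multiplier
operators over one dilation block converge absolutely and locally uniformly. -/
theorem IsHomogeneousDistance.fourierMultiplier_annularPiece [Nonempty (Fin d)]
    (hρ : IsHomogeneousDistance ρ β) (hζ : IsDyadicCutoff ζ) (hα : 1 / 2 < α)
    (hαd : α < (d : ℝ) / 2) (hq : q ≠ 0) (hqs : q⁻¹ + s⁻¹ = 1) (hh : MemBesov ζ α s h)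
    (hs : Function.support h ⊆ Ioo (1 / 2) 2) (hf : MemHerz (-α) 2 q f) {t : ℝ}
    (ht : t ∈ Icc 1 ((2 : ℝ) ^ β)) :
    (∀ x, Integrable fun y => multiplierKernel (quasiradial ρ h t) (x - y) * f y) ∧
    (∀ x, fourierMultiplier (quasiradial ρ h t) f x =
      ∑' n, fourierMultiplier (quasiradial ρ h t) (annularPiece f n) x) ∧
    Continuous (fourierMultiplier (quasiradial ρ h t) f) := by
  obtain ⟨χ, r, R, hχ⟩ := hρ.exists_isFrequencyCutoff
  obtain ⟨C, κ, hC⟩ := hχ.exists_singleScaleMaximal_ball_le hρ hζ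
  have hs0 : s ≠ 0 := (zero_lt_one.trans_le (one_le_of_inv_add_inv_eq_one hqs)).ne'
  have hB := hh.halfBesovNorm_lt_top hα hs0
  have hhi := integrable_of_memLp_of_support_subset hh.1 hs
  have hm := hχ.integrable_quasiradial hρ hhi hs (hζ.integrable_fourier hhi hB) ht
  set m := quasiradial ρ h t with hmdef
  have hT : ∀ (M n : ℤ) (g : EuclideanSpace ℝ (Fin d) → ℂ), MemLp g 2 →
      Function.support g ⊆ dyadicAnnulus d n → ∀ x, ‖x‖ ≤ 2 ^ M →
      ‖fourierMultiplier m g x‖ₑ ≤ C * (localWeight d ζ κ h M n * eLpNorm g 2 volume) :=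
    fun M n g hg hgs x hx => (le_iSup (fun t : Icc (1 : ℝ) (2 ^ β) =>
      ‖fourierMultiplier (quasiradial ρ h t) g x‖ₑ) ⟨t, ht⟩).trans (hC h hhi hs hB M n g
        (integrable_of_support_subset_dyadicAnnulus hg hgs) hg hgs x hx)
  have hfin : ∀ M : ℤ, ∑' n, C * (localWeight d ζ κ h M n *
      eLpNorm (annularPiece f n) 2 volume) < ∞ := fun M => by
    rw [ENNReal.tsum_mul_left]
    exact ENNReal.mul_lt_top ENNReal.coe_lt_top
      (tsum_localWeight_mul_lt_top hα hαd hq hqs hh hf κ M)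
  have hind : ∀ (x : EuclideanSpace ℝ (Fin d)) (n : ℤ),
      (fun y => multiplierKernel m (x - y) * annularPiece f n y) =
      (dyadicAnnulus d n).indicator fun y => multiplierKernel m (x - y) * f y := by
    intro x n
    ext y
    by_cases hy : y ∈ dyadicAnnulus d n <;> simp [annularPiece, hy]
  have habs : ∀ (M : ℤ) x, ‖x‖ ≤ 2 ^ M → ∀ n : ℤ,
      ∫⁻ y in dyadicAnnulus d n, ‖multiplierKernel m (x - y) * f y‖ₑ ≤
        C * (localWeight d ζ κ h M n * eLpNorm (annularPiece f n) 2 volume) := by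
    intro M x hx n
    have hp := hf.memLp_annularPiece hq n
    -- the bound for the multiplier operator, applied to `f_n` times a phase that depends on `x`,
    -- controls the integral of the absolute value
    obtain ⟨g', hg'm, hg'n, hg'⟩ := exists_enorm_fourierMultiplier_eq hm hp.1 x
    have hg's : Function.support g' ⊆ dyadicAnnulus d n := fun y hy =>
      support_annularPiece_subset f n fun h0 =>
        hy (norm_le_zero_iff.1 ((hg'n y).trans (by simp [h0])))
    have hg'2 : MemLp g' 2 := hp.of_le hg'm (Filter.Eventually.of_forall hg'n)
    calc ∫⁻ y in dyadicAnnulus d n, ‖multiplierKernel m (x - y) * f y‖ₑ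
        = ∫⁻ y, ‖multiplierKernel m (x - y) * annularPiece f n y‖ₑ := by
          rw [← lintegral_indicator (measurableSet_dyadicAnnulus n)]
          refine lintegral_congr fun y => ?_
          rw [congrFun (hind x n) y, enorm_indicator_eq_indicator_enorm]
      _ = ‖fourierMultiplier m g' x‖ₑ := (hg' (hf.integrable_annularPiece hq n)).symm
      _ ≤ C * (localWeight d ζ κ h M n * eLpNorm g' 2 volume) := hT M n g' hg'2 hg's x hx
      _ ≤ _ := by
          gcongr
          exact eLpNorm_mono hg'n
  have hint : ∀ x, Integrable fun y => multiplierKernel m (x - y) * f y := by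
    intro x
    obtain ⟨M, hM⟩ := exists_norm_lt_two_zpow x
    refine ⟨((continuous_multiplierKernel hm).comp (continuous_const.sub
      continuous_id)).aestronglyMeasurable.mul hf.1, ?_⟩
    rw [HasFiniteIntegral, lintegral_eq_tsum_dyadicAnnulus]
    exact (ENNReal.tsum_le_tsum (habs M x hM.le)).trans_lt (hfin M)
  have hsum : ∀ x, fourierMultiplier m f x = ∑' n, fourierMultiplier m (annularPiece f n) x := by
    intro x
    rw [fourierMultiplier, integral_eq_tsum_dyadicAnnulus (hint x)]
    refine tsum_congr fun n => ?_
    rw [fourierMultiplier, hind, integral_indicator (measurableSet_dyadicAnnulus n)]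
  refine ⟨hint, hsum, ?_⟩
  rw [funext hsum, continuous_iff_continuousAt]
  intro x
  obtain ⟨M, hM⟩ := exists_norm_lt_two_zpow x
  have hcont : ContinuousOn (fun x => ∑' n, fourierMultiplier m (annularPiece f n) x)
      (Metric.ball 0 (2 ^ M)) := by
    refine continuousOn_tsum (fun n => (continuous_fourierMultiplier hm
      (hf.integrable_annularPiece hq n)).continuousOn) (ENNReal.summable_toReal (hfin M).ne)
      fun n y hy => ?_
    have h1 := hT M n _ (hf.memLp_annularPiece hq n) (support_annularPiece_subset f n) y
      (by simpa using (mem_ball_zero_iff.1 hy).le)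
    rw [← toReal_enorm]
    exact ENNReal.toReal_mono (ENNReal.ne_top_of_tsum_ne_top (hfin M).ne n) h1
  exact hcont.continuousAt (Metric.isOpen_ball.mem_nhds (by simpa using hM))

theorem lowerSemicontinuous_singleScaleMaximal {g : EuclideanSpace ℝ (Fin d) → ℂ}
    (hg : ∀ t ∈ Icc 1 ((2 : ℝ) ^ β), Continuous (fourierMultiplier (quasiradial ρ h t) g)) :
    LowerSemicontinuous (singleScaleMaximal ρ β h g) :=
  lowerSemicontinuous_iSup fun t =>
    (continuous_enorm.comp (hg t t.2)).lowerSemicontinuous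

theorem IsHomogeneousDistance.singleScaleMaximal_le_tsum [Nonempty (Fin d)]
    (hρ : IsHomogeneousDistance ρ β) (hζ : IsDyadicCutoff ζ) (hα : 1 / 2 < α)
    (hαd : α < (d : ℝ) / 2) (hq : q ≠ 0) (hqs : q⁻¹ + s⁻¹ = 1) (hh : MemBesov ζ α s h)
    (hs : Function.support h ⊆ Ioo (1 / 2) 2) (hf : MemHerz (-α) 2 q f)
    (x : EuclideanSpace ℝ (Fin d)) :
    singleScaleMaximal ρ β h f x ≤ ∑' n, singleScaleMaximal ρ β h (annularPiece f n) x := by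
  refine iSup_le fun t => ?_
  rw [(hρ.fourierMultiplier_annularPiece hζ hα hαd hq hqs hh hs hf t.2).2.1 x]
  refine enorm_tsum_le_tsum_enorm.trans (ENNReal.tsum_le_tsum fun n => ?_)
  exact le_iSup (fun t : Icc (1 : ℝ) (2 ^ β) =>
    ‖fourierMultiplier (quasiradial ρ h t) (annularPiece f n) x‖ₑ) t

end Convergence

/-! ### Dilations and almost orthogonality -/

section Dilations

variable {d : ℕ} {ρ : EuclideanSpace ℝ (Fin d) → ℝ} {β : ℝ} {h : ℝ → ℂ}
  {χ : EuclideanSpace ℝ (Fin d) → ℝ} {r R : ℝ} {f : EuclideanSpace ℝ (Fin d) → ℂ}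

/-- The dilate `x ↦ f(2^{-k} x)`. -/
noncomputable def dyadicDilate (k : ℤ) (f : EuclideanSpace ℝ (Fin d) → ℂ) :
    EuclideanSpace ℝ (Fin d) → ℂ :=
  fun x => f ((2 : ℝ) ^ (-k) • x)

theorem dyadicDilate_smul (k : ℤ) (f : EuclideanSpace ℝ (Fin d) → ℂ)
    (x : EuclideanSpace ℝ (Fin d)) : dyadicDilate k f ((2 : ℝ) ^ k • x) = f x := by
  rw [dyadicDilate, zpow_neg, inv_smul_smul₀ (by positivity)]

theorem smul_mem_dyadicAnnulus_iff (k m : ℤ) (x : EuclideanSpace ℝ (Fin d)) :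
    (2 : ℝ) ^ k • x ∈ dyadicAnnulus d (m + k) ↔ x ∈ dyadicAnnulus d m := by
  have hk : (0 : ℝ) < 2 ^ k := by positivity
  have h1 : (2 : ℝ) ^ (m + k) = 2 ^ k * 2 ^ m := by rw [add_comm, zpow_add₀ two_ne_zero]
  have h2 : (2 : ℝ) ^ (m + k + 1) = 2 ^ k * 2 ^ (m + 1) := by
    rw [add_right_comm, add_comm, zpow_add₀ two_ne_zero]
  simp only [dyadicAnnulus, mem_ofPred_eq, norm_smul, Real.norm_of_nonneg hk.le, h1, h2,
    mul_le_mul_iff_right₀ hk, mul_lt_mul_iff_right₀ hk]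

theorem dyadicDilate_annularPiece (k n : ℤ) (f : EuclideanSpace ℝ (Fin d) → ℂ) :
    dyadicDilate k (annularPiece f n) = annularPiece (dyadicDilate k f) (n + k) := by
  ext x
  have h1 := smul_mem_dyadicAnnulus_iff (d := d) (-k) (n + k) x
  rw [add_neg_cancel_right] at h1
  by_cases hx : x ∈ dyadicAnnulus d (n + k)
  · rw [dyadicDilate, annularPiece, annularPiece, indicator_of_mem (h1.2 hx),
      indicator_of_mem hx, dyadicDilate]
  · rw [dyadicDilate, annularPiece, annularPiece, indicator_of_notMem (mt h1.1 hx),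
      indicator_of_notMem hx]

theorem lintegral_comp_two_zpow_smul (k : ℤ) (F : EuclideanSpace ℝ (Fin d) → ℝ≥0∞) :
    ∫⁻ x, F ((2 : ℝ) ^ k • x) = 2 ^ (-((k : ℝ) * d)) * ∫⁻ x, F x := by
  have hk : (2 : ℝ) ^ k ≠ 0 := by positivity
  have h1 := (Homeomorph.smulOfNeZero ((2 : ℝ) ^ k) hk).measurableEmbedding.lintegral_map
    (μ := (volume : Measure (EuclideanSpace ℝ (Fin d)))) F
  have h2 := Measure.map_addHaar_smul (volume : Measure (EuclideanSpace ℝ (Fin d))) hk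
  simp only [Homeomorph.smulOfNeZero_apply] at h1
  rw [← h1, show (fun x : EuclideanSpace ℝ (Fin d) => (2 : ℝ) ^ k • x) = ((2 : ℝ) ^ k • ·) from rfl,
    h2, lintegral_smul_measure, smul_eq_mul]
  congr 1
  rw [finrank_euclideanSpace, Fintype.card_fin, abs_of_pos (by positivity),
    ← Real.rpow_natCast, ← Real.rpow_intCast, ← Real.rpow_mul zero_le_two, ← Real.rpow_neg
    zero_le_two, ← ENNReal.ofReal_rpow_of_pos two_pos, ENNReal.ofReal_ofNat]

theorem eLpNorm_comp_two_zpow_smul {ε : Type*} [TopologicalSpace ε] [ContinuousENorm ε] (k m : ℤ)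
    (F : EuclideanSpace ℝ (Fin d) → ε) :
    eLpNorm (fun x => F ((2 : ℝ) ^ k • x)) 2 (volume.restrict (dyadicAnnulus d m)) =
      2 ^ (-((k : ℝ) * (d / 2))) * eLpNorm F 2 (volume.restrict (dyadicAnnulus d (m + k))) := by
  refine (ENNReal.pow_right_strictMono two_ne_zero).injective ?_
  simp only [mul_pow, eLpNorm_two_sq]
  rw [← lintegral_indicator (measurableSet_dyadicAnnulus m),
    ← lintegral_indicator (measurableSet_dyadicAnnulus (m + k)), ← ENNReal.rpow_natCast,
    ← ENNReal.rpow_mul]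
  have h1 := lintegral_comp_two_zpow_smul k
    ((dyadicAnnulus d (m + k)).indicator fun x => ‖F x‖ₑ ^ 2)
  have h2 : -((k : ℝ) * (d / 2)) * ((2 : ℕ) : ℝ) = -((k : ℝ) * d) := by push_cast; ring
  rw [h2, ← h1]
  refine lintegral_congr fun x => ?_
  by_cases hx : x ∈ dyadicAnnulus d m
  · rw [indicator_of_mem hx, indicator_of_mem ((smul_mem_dyadicAnnulus_iff k m x).2 hx)]
  · rw [indicator_of_notMem hx,
      indicator_of_notMem (mt (smul_mem_dyadicAnnulus_iff k m x).1 hx)]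

theorem quasiMeasurePreserving_two_zpow_smul (k : ℤ) :
    Measure.QuasiMeasurePreserving (fun x : EuclideanSpace ℝ (Fin d) => (2 : ℝ) ^ k • x) := by
  refine ⟨measurable_const_smul _, ?_⟩
  have h2 := Measure.map_addHaar_smul (volume : Measure (EuclideanSpace ℝ (Fin d)))
    (show (2 : ℝ) ^ k ≠ 0 by positivity)
  rw [show (fun x : EuclideanSpace ℝ (Fin d) => (2 : ℝ) ^ k • x) = ((2 : ℝ) ^ k • ·) from rfl, h2]
  exact Measure.smul_absolutelyContinuous

theorem eLpNorm_dyadicDilate (k n : ℤ) (f : EuclideanSpace ℝ (Fin d) → ℂ) :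
    eLpNorm (dyadicDilate k f) 2 (volume.restrict (dyadicAnnulus d n)) =
      2 ^ ((k : ℝ) * (d / 2)) * eLpNorm f 2 (volume.restrict (dyadicAnnulus d (n - k))) := by
  have := eLpNorm_comp_two_zpow_smul (-k) n f
  push_cast at this
  rwa [neg_mul, neg_neg, ← sub_eq_add_neg] at this

/-- Herz spaces are invariant under dilations. -/
theorem MemHerz.dyadicDilate {γ : ℝ} {q : ℝ≥0∞} (hf : MemHerz γ 2 q f) (k : ℤ) :
    MemHerz γ 2 q (dyadicDilate k f) := by
  refine ⟨hf.1.comp_quasiMeasurePreserving (quasiMeasurePreserving_two_zpow_smul (-k)), ?_⟩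
  have h1 : herzNorm γ 2 q (_root_.dyadicDilate k f) = seqNorm q (fun l : ℤ =>
      2 ^ ((k : ℝ) * γ + (k : ℝ) * (d / 2)) * (fun l : ℤ => (2 : ℝ≥0∞) ^ ((l : ℝ) * γ) *
        eLpNorm f 2 (volume.restrict (dyadicAnnulus d l))) (Equiv.subRight k l)) := by
    rw [herzNorm, ← seqNorm]
    congr 1
    ext l
    rw [eLpNorm_dyadicDilate, two_rpow_add]
    simp only [Equiv.subRight_apply]
    have : (2 : ℝ≥0∞) ^ ((l : ℝ) * γ) = 2 ^ ((k : ℝ) * γ) * 2 ^ (((l - k : ℤ) : ℝ) * γ) := by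
      rw [← two_rpow_add]; push_cast; congr 1; ring
    rw [this]
    ring
  rw [h1, seqNorm_const_mul, seqNorm_comp_equiv q (Equiv.subRight k) fun l : ℤ =>
    (2 : ℝ≥0∞) ^ ((l : ℝ) * γ) * eLpNorm f 2 (volume.restrict (dyadicAnnulus d l))]
  exact ENNReal.mul_lt_top (two_rpow_ne_top _).lt_top hf.2

theorem integral_eq_mul_integral_two_zpow_smul (k : ℤ) (F : EuclideanSpace ℝ (Fin d) → ℂ) :
    ∫ x, F x = (((2 : ℝ) ^ k) ^ d : ℝ) * ∫ x, F ((2 : ℝ) ^ k • x) := by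
  have hk : (0 : ℝ) < ((2 : ℝ) ^ k) ^ d := by positivity
  rw [Measure.integral_comp_smul, finrank_euclideanSpace, Fintype.card_fin,
    abs_of_pos (inv_pos.2 hk), Complex.real_smul, ← mul_assoc, ← Complex.ofReal_mul,
    mul_inv_cancel₀ hk.ne', Complex.ofReal_one, one_mul]

/-- Homogeneity of `ρ` turns the dilation of `t` by `2^{kβ}` into the dilation of the kernel by
`2^k`. -/
theorem IsHomogeneousDistance.multiplierKernel_quasiradial [Nonempty (Fin d)]
    (hρ : IsHomogeneousDistance ρ β) (h : ℝ → ℂ) (k : ℤ) (t : ℝ) (x : EuclideanSpace ℝ (Fin d)) :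
    multiplierKernel (quasiradial ρ h (((2 : ℝ) ^ k) ^ β * t)) x =
      (((2 : ℝ) ^ k) ^ d : ℝ) * multiplierKernel (quasiradial ρ h t) ((2 : ℝ) ^ k • x) := by
  have hk : (0 : ℝ) < 2 ^ k := by positivity
  have hz : ∀ᵐ ξ : EuclideanSpace ℝ (Fin d), ξ ≠ 0 := by
    have : Nontrivial (EuclideanSpace ℝ (Fin d)) := inferInstance
    exact measure_eq_zero_iff_ae_notMem.1 (measure_singleton (0 : EuclideanSpace ℝ (Fin d)))
  rw [multiplierKernel, multiplierKernel, Real.fourierInv_eq, Real.fourierInv_eq,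
    integral_eq_mul_integral_two_zpow_smul k]
  congr 1
  refine integral_congr_ae ?_
  filter_upwards [hz] with ξ hξ
  have hξ' : (2 * Real.pi) • ξ ≠ 0 := smul_ne_zero (by positivity) hξ
  rw [real_inner_smul_left, real_inner_smul_right, quasiradial, quasiradial, smul_comm,
    hρ.apply_smul hk hξ', mul_div_mul_left _ _ (by positivity)]

theorem IsHomogeneousDistance.kernel_mul_comp_smul [Nonempty (Fin d)]
    (hρ : IsHomogeneousDistance ρ β) (h : ℝ → ℂ) (f : EuclideanSpace ℝ (Fin d) → ℂ) (k : ℤ) (t : ℝ)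
    (x y : EuclideanSpace ℝ (Fin d)) :
    multiplierKernel (quasiradial ρ h (((2 : ℝ) ^ k) ^ β * t)) (x - y) * f y =
      (((2 : ℝ) ^ k) ^ d : ℝ) * (multiplierKernel (quasiradial ρ h t)
        ((2 : ℝ) ^ k • x - (2 : ℝ) ^ k • y) * dyadicDilate k f ((2 : ℝ) ^ k • y)) := by
  rw [hρ.multiplierKernel_quasiradial, dyadicDilate_smul, smul_sub, mul_assoc]

theorem IsHomogeneousDistance.integrable_kernel_mul [Nonempty (Fin d)]
    (hρ : IsHomogeneousDistance ρ β) {k : ℤ} {t : ℝ} {x : EuclideanSpace ℝ (Fin d)}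
    (hi : Integrable fun y => multiplierKernel (quasiradial ρ h t) ((2 : ℝ) ^ k • x - y) *
      dyadicDilate k f y) :
    Integrable fun y =>
      multiplierKernel (quasiradial ρ h (((2 : ℝ) ^ k) ^ β * t)) (x - y) * f y := by
  simp only [hρ.kernel_mul_comp_smul]
  exact (hi.comp_smul (show (2 : ℝ) ^ k ≠ 0 by positivity)).const_mul _

theorem IsHomogeneousDistance.fourierMultiplier_dyadicDilate [Nonempty (Fin d)]
    (hρ : IsHomogeneousDistance ρ β) (h : ℝ → ℂ) (f : EuclideanSpace ℝ (Fin d) → ℂ) (k : ℤ) (t : ℝ)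
    (x : EuclideanSpace ℝ (Fin d)) :
    fourierMultiplier (quasiradial ρ h (((2 : ℝ) ^ k) ^ β * t)) f x =
      fourierMultiplier (quasiradial ρ h t) (dyadicDilate k f) ((2 : ℝ) ^ k • x) := by
  simp only [fourierMultiplier, hρ.kernel_mul_comp_smul]
  rw [integral_const_mul, ← integral_eq_mul_integral_two_zpow_smul k
    fun y => multiplierKernel (quasiradial ρ h t) ((2 : ℝ) ^ k • x - y) * dyadicDilate k f y]

theorem exists_eq_two_zpow_rpow_mul (hβ : 0 < β) {t : ℝ} (ht : 0 < t) :
    ∃ k : ℤ, ∃ t' ∈ Icc (1 : ℝ) (2 ^ β), t = ((2 : ℝ) ^ k) ^ β * t' := by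
  obtain ⟨k, hk1, hk2⟩ := exists_mem_Ico_zpow ht (Real.one_lt_rpow one_lt_two hβ)
  have h1 : ((2 : ℝ) ^ k) ^ β = ((2 : ℝ) ^ β) ^ k := by
    rw [← Real.rpow_intCast, ← Real.rpow_mul zero_le_two, mul_comm, Real.rpow_mul zero_le_two,
      Real.rpow_intCast]
  have h2 : (0 : ℝ) < ((2 : ℝ) ^ β) ^ k := by positivity
  refine ⟨k, t / ((2 : ℝ) ^ β) ^ k, ⟨?_, ?_⟩, ?_⟩
  · rwa [le_div_iff₀ h2, one_mul]
  · rw [div_le_iff₀ h2, mul_comm, ← zpow_add_one₀ (by positivity)]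
    exact hk2.le
  · rw [h1, mul_div_cancel₀ _ h2.ne']

/-- Every `t > 0` lies in one of the blocks `2^{kβ} ≤ t ≤ 2^{(k+1)β}`, and each of them is a dilate
of the block `1 ≤ t ≤ 2^β`. -/
theorem IsHomogeneousDistance.maximalFunction_le_iSup [Nonempty (Fin d)]
    (hρ : IsHomogeneousDistance ρ β) (h : ℝ → ℂ) (f : EuclideanSpace ℝ (Fin d) → ℂ)
    (x : EuclideanSpace ℝ (Fin d)) :
    maximalFunction ρ h f x ≤
      ⨆ k : ℤ, singleScaleMaximal ρ β h (dyadicDilate k f) ((2 : ℝ) ^ k • x) := by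
  refine iSup_le fun t => ?_
  obtain ⟨k, t', ht', hk⟩ := exists_eq_two_zpow_rpow_mul hρ.degree_pos t.2
  rw [hk, hρ.fourierMultiplier_dyadicDilate]
  exact le_iSup_of_le k (le_iSup (fun s : Icc (1 : ℝ) (2 ^ β) => ‖fourierMultiplier
    (quasiradial ρ h s) (dyadicDilate k f) ((2 : ℝ) ^ k • x)‖ₑ) ⟨t', ht'⟩)

/-- The supremum is dominated by the square function. -/
theorem eLpNorm_iSup_le {X : Type*} [MeasurableSpace X] {μ : Measure X} {F : ℤ → X → ℝ≥0∞}
    (hF : ∀ k, AEMeasurable (F k) μ) :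
    eLpNorm (fun x => ⨆ k, F k x) 2 μ ≤ seqNorm 2 (fun k => eLpNorm (F k) 2 μ) := by
  refine (ENNReal.pow_le_pow_left_iff two_ne_zero).1 ?_
  rw [seqNorm, eLpNorm_two_sq, eLpNorm_two_sq, lintegral_count]
  simp only [enorm_eq_self, eLpNorm_two_sq]
  rw [← lintegral_tsum fun k => (hF k).pow_const 2]
  refine lintegral_mono fun x => ?_
  have : ⨆ k, F k x ≤ (∑' k, F k x ^ 2) ^ (2 : ℝ)⁻¹ := by
    refine iSup_le fun k => ?_
    rw [ENNReal.le_rpow_inv_iff two_pos, ENNReal.rpow_ofNat]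
    exact ENNReal.le_tsum k
  rw [ENNReal.le_rpow_inv_iff two_pos, ENNReal.rpow_ofNat] at this
  exact this

/-- The dilates of a frequency cutoff have finite overlap. -/
theorem IsFrequencyCutoff.exists_tsum_enorm_sq_le (hχ : IsFrequencyCutoff ρ β χ r R) :
    ∃ D : ℝ≥0, 1 ≤ D ∧ ∀ η : EuclideanSpace ℝ (Fin d),
      ∑' k : ℤ, ‖χ ((2 : ℝ) ^ (-k) • η)‖ₑ ^ 2 ≤ D := by
  obtain ⟨M, hM⟩ := pow_unbounded_of_one_lt (max r⁻¹ R) (one_lt_two : (1 : ℝ) < 2)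
  have hMr : r⁻¹ < 2 ^ M := (le_max_left _ _).trans_lt hM
  have hMR : R < 2 ^ M := (le_max_right _ _).trans_lt hM
  have hr := hχ.inner_pos
  -- only the `k` with `r ≤ 2^{-k} |η| ≤ R` contribute, which lie within `M` of `log₂ |η|`
  refine ⟨2 * M + 1, by simp, fun η => ?_⟩
  have hle : ∀ k : ℤ, ‖χ ((2 : ℝ) ^ (-k) • η)‖ₑ ^ 2 ≤ 1 := fun k => by
    refine pow_le_one₀ zero_le ?_
    rw [← ofReal_norm, Real.norm_of_nonneg (hχ.mem_Icc _).1]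
    exact ENNReal.ofReal_le_one.2 (hχ.mem_Icc _).2
  by_cases hη : η = 0
  · have h0 : χ 0 = 0 := by
      by_contra h0
      have := (hχ.support_subset h0).1
      rw [norm_zero] at this
      linarith
    simp [hη, h0]
  obtain ⟨n, hn1, hn2⟩ := exists_mem_Ico_zpow (norm_pos_iff.2 hη) (one_lt_two : (1 : ℝ) < 2)
  have hsupp : ∀ k ∉ Finset.Icc (n - M) (n + M), ‖χ ((2 : ℝ) ^ (-k) • η)‖ₑ ^ 2 = 0 := by
    intro k hk
    by_contra hne
    have hχk : χ ((2 : ℝ) ^ (-k) • η) ≠ 0 := fun h0 => hne (by rw [h0]; simp)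
    obtain ⟨h1, h2⟩ := hχ.support_subset hχk
    rw [norm_smul, Real.norm_of_nonneg (by positivity), zpow_neg] at h1 h2
    have hk0 : (0 : ℝ) < 2 ^ k := by positivity
    rw [← div_eq_inv_mul, le_div_iff₀ hk0] at h1
    rw [← div_eq_inv_mul, div_le_iff₀ hk0] at h2
    refine hk (Finset.mem_Icc.2 ⟨?_, ?_⟩)
    · have h3 : (2 : ℝ) ^ n < 2 ^ ((M : ℤ) + k) := by
        rw [zpow_add₀ two_ne_zero, zpow_natCast]
        nlinarith
      rw [zpow_lt_zpow_iff_right₀ one_lt_two] at h3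
      omega
    · have h4 : (2 : ℝ) ^ k < 2 ^ ((M : ℤ) + (n + 1)) := by
        rw [zpow_add₀ two_ne_zero, zpow_natCast]
        have h5 : (2 : ℝ) ^ k = r⁻¹ * (r * 2 ^ k) := by field_simp
        have h6 : r * (2 : ℝ) ^ k < 2 ^ (n + 1) := h1.trans_lt hn2
        have h7 : 0 < r * (2 : ℝ) ^ k := by positivity
        rw [h5]
        exact mul_lt_mul hMr h6.le h7 (by positivity)
      rw [zpow_lt_zpow_iff_right₀ one_lt_two] at h4
      omega
  rw [tsum_eq_sum hsupp]
  refine (Finset.sum_le_sum fun k _ => hle k).trans ?_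
  rw [Finset.sum_const, nsmul_eq_mul, mul_one, Int.card_Icc]
  have : (n + M + 1 - (n - M)).toNat = 2 * M + 1 := by omega
  rw [this]
  push_cast
  rfl

theorem fourier_dyadicDilate (k : ℤ) (F : EuclideanSpace ℝ (Fin d) → ℂ)
    (ξ : EuclideanSpace ℝ (Fin d)) :
    𝓕 (dyadicDilate k F) ξ = (((2 : ℝ) ^ k) ^ d : ℝ) * 𝓕 F ((2 : ℝ) ^ k • ξ) := by
  rw [Real.fourier_eq, Real.fourier_eq, integral_eq_mul_integral_two_zpow_smul k]
  simp only [dyadicDilate_smul, real_inner_smul_left, real_inner_smul_right]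

/-- Almost orthogonality of the localizations of a function to the dilates of a fixed annulus in
frequency. -/
theorem IsFrequencyCutoff.exists_seqNorm_localizedFourier_le (hχ : IsFrequencyCutoff ρ β χ r R) :
    ∃ D : ℝ≥0, ∀ F : EuclideanSpace ℝ (Fin d) → ℂ, Integrable F → MemLp F 2 →
      seqNorm 2 (fun k : ℤ => 2 ^ (-((k : ℝ) * (d / 2))) *
        eLpNorm (localizedFourier χ (dyadicDilate k F)) 2 volume) ≤ D * eLpNorm F 2 volume := by
  obtain ⟨D, hD1, hD⟩ := hχ.exists_tsum_enorm_sq_le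
  refine ⟨D, fun F hF hF2 => le_mul_of_sq_le ?_ (by exact_mod_cast hD1)⟩
  rw [← eLpNorm_fourier_two hF hF2, seqNorm, eLpNorm_two_sq, eLpNorm_two_sq, lintegral_count]
  have hcont := continuous_fourier_of_integrable hF
  have hterm : ∀ k : ℤ, ‖(2 : ℝ≥0∞) ^ (-((k : ℝ) * (d / 2))) *
      eLpNorm (localizedFourier χ (dyadicDilate k F)) 2 volume‖ₑ ^ 2 =
      ∫⁻ η, ‖χ ((2 : ℝ) ^ (-k) • η)‖ₑ ^ 2 * ‖𝓕 F η‖ₑ ^ 2 := by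
    intro k
    have h1 := lintegral_comp_two_zpow_smul (d := d) k
      fun η => ‖χ ((2 : ℝ) ^ (-k) • η)‖ₑ ^ 2 * ‖𝓕 F η‖ₑ ^ 2
    have h2 : ∀ ξ : EuclideanSpace ℝ (Fin d), ‖localizedFourier χ (dyadicDilate k F) ξ‖ₑ ^ 2 =
        2 ^ (2 * ((k : ℝ) * d)) * (‖χ ((2 : ℝ) ^ (-k) • (2 : ℝ) ^ k • ξ)‖ₑ ^ 2 *
          ‖𝓕 F ((2 : ℝ) ^ k • ξ)‖ₑ ^ 2) := by
      intro ξ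
      rw [zpow_neg, inv_smul_smul₀ (by positivity), localizedFourier, fourier_dyadicDilate,
        enorm_mul, enorm_mul]
      have h3 : ‖(((((2 : ℝ) ^ k) ^ d : ℝ)) : ℂ)‖ₑ = 2 ^ ((k : ℝ) * d) := by
        rw [← ofReal_norm, Complex.norm_real, Real.norm_of_nonneg (by positivity),
          ENNReal.ofReal_pow (by positivity), ofReal_two_zpow, ← ENNReal.rpow_natCast,
          ← ENNReal.rpow_mul]
      have h4 : ‖((χ ξ : ℝ) : ℂ)‖ₑ = ‖χ ξ‖ₑ := by
        rw [← ofReal_norm, Complex.norm_real, ofReal_norm]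
      have h5 : (2 : ℝ≥0∞) ^ (2 * ((k : ℝ) * d)) = (2 ^ ((k : ℝ) * d)) ^ 2 := by
        rw [← ENNReal.rpow_natCast (2 ^ _) 2, ← ENNReal.rpow_mul]
        congr 1
        push_cast
        ring
      rw [h3, h4, h5]
      ring
    rw [enorm_eq_self, mul_pow, eLpNorm_two_sq, lintegral_congr h2, lintegral_const_mul' _ _
      (two_rpow_ne_top _), h1, ← mul_assoc, ← mul_assoc, ← ENNReal.rpow_natCast, ← ENNReal.rpow_mul,
      ← two_rpow_add, ← two_rpow_add]
    have h5 : -((k : ℝ) * (d / 2)) * ((2 : ℕ) : ℝ) + 2 * ((k : ℝ) * d) + -((k : ℝ) * d) = 0 := by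
      push_cast; ring
    rw [h5, ENNReal.rpow_zero, one_mul]
  simp only [hterm]
  rw [← lintegral_tsum fun k => ?_, ← lintegral_const_mul' _ _ ENNReal.coe_ne_top]
  · refine lintegral_mono fun η => ?_
    rw [ENNReal.tsum_mul_right]
    gcongr
    exact hD η
  · have : Continuous fun η : EuclideanSpace ℝ (Fin d) => χ ((2 : ℝ) ^ (-k) • η) :=
      hχ.smooth.continuous.comp (continuous_const_smul _)
    exact ((this.measurable.enorm.pow_const 2).mul
      (hcont.measurable.enorm.pow_const 2)).aemeasurable

end Dilations

/-! ### The maximal function on Herz spaces -/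

section Maximal

variable {d : ℕ} {ρ : EuclideanSpace ℝ (Fin d) → ℝ} {β α : ℝ} {ζ : ℝ → ℝ} {h : ℝ → ℂ}
  {χ : EuclideanSpace ℝ (Fin d) → ℝ} {r R : ℝ} {f : EuclideanSpace ℝ (Fin d) → ℂ}
  {p q s : ℝ≥0∞}

theorem IsHomogeneousDistance.integrable_kernel_mul_of_memHerz [Nonempty (Fin d)]
    (hρ : IsHomogeneousDistance ρ β) (hζ : IsDyadicCutoff ζ) (hα : 1 / 2 < α)
    (hαd : α < (d : ℝ) / 2) (hq : q ≠ 0) (hqs : q⁻¹ + s⁻¹ = 1) (hh : MemBesov ζ α s h)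
    (hs : Function.support h ⊆ Ioo (1 / 2) 2) (hf : MemHerz (-α) 2 q f) {t : ℝ} (ht : 0 < t)
    (x : EuclideanSpace ℝ (Fin d)) :
    Integrable fun y => multiplierKernel (quasiradial ρ h t) (x - y) * f y := by
  obtain ⟨k, t', ht', rfl⟩ := exists_eq_two_zpow_rpow_mul hρ.degree_pos ht
  exact hρ.integrable_kernel_mul ((hρ.fourierMultiplier_annularPiece hζ hα hαd hq hqs hh hs
    (hf.dyadicDilate k) ht').1 _)

/-- The maximal function is a supremum of continuous functions. -/
theorem IsHomogeneousDistance.measurable_maximalFunction [Nonempty (Fin d)]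
    (hρ : IsHomogeneousDistance ρ β) (hζ : IsDyadicCutoff ζ) (hα : 1 / 2 < α)
    (hαd : α < (d : ℝ) / 2) (hq : q ≠ 0) (hqs : q⁻¹ + s⁻¹ = 1) (hh : MemBesov ζ α s h)
    (hs : Function.support h ⊆ Ioo (1 / 2) 2) (hf : MemHerz (-α) 2 q f) :
    Measurable (maximalFunction ρ h f) := by
  refine LowerSemicontinuous.measurable (lowerSemicontinuous_iSup fun t => ?_)
  refine (continuous_enorm.comp ?_).lowerSemicontinuous
  obtain ⟨k, t', ht', hk⟩ := exists_eq_two_zpow_rpow_mul hρ.degree_pos t.2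
  rw [hk, funext (hρ.fourierMultiplier_dyadicDilate h f k t')]
  exact (hρ.fourierMultiplier_annularPiece hζ hα hαd hq hqs hh hs
    (hf.dyadicDilate k) ht').2.2.comp (continuous_const_smul _)

/-- The estimate for a single dilation block, on a single annulus, applied to a dilate of a function
supported in a single annulus. The first term collects the local part `n ≤ m + 1`, the other two
the part `n ≥ m + 2`. -/
theorem IsFrequencyCutoff.exists_weighted_singleScale_le [Nonempty (Fin d)]
    (hχ : IsFrequencyCutoff ρ β χ r R) (hρ : IsHomogeneousDistance ρ β) (hζ : IsDyadicCutoff ζ)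
    (α : ℝ) :
    ∃ C : ℝ≥0, ∃ κ : ℝ, ∀ h : ℝ → ℂ, Integrable h →
      Function.support h ⊆ Ioo (1 / 2) 2 → halfBesovNorm ζ h < ∞ →
      ∀ (f : EuclideanSpace ℝ (Fin d) → ℂ) (m n k : ℤ),
      MemLp (dyadicDilate k (annularPiece f n)) 2 →
      2 ^ ((m : ℝ) * -α) * (2 ^ (-((k : ℝ) * (d / 2))) *
        eLpNorm (singleScaleMaximal ρ β h (dyadicDilate k (annularPiece f n))) 2
          (volume.restrict (dyadicAnnulus d (m + k)))) ≤
      C * halfBesovNorm ζ h *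
        ((if -1 ≤ m - n then 2 ^ (-(((m - n : ℤ) : ℝ) * α)) else 0) *
          (2 ^ ((n : ℝ) * -α) * (2 ^ (-((k : ℝ) * (d / 2))) *
            eLpNorm (localizedFourier χ (dyadicDilate k (annularPiece f n))) 2 volume))) +
      C * (smoothingWeight d (m + k) * 2 ^ (-(((m + k : ℤ) : ℝ) * α))) *
        ((2 ^ (((n + k : ℤ) : ℝ) * α) * highFrequencySum ζ κ h (n + k)) *
          (2 ^ ((n : ℝ) * -α) * (2 ^ (-((k : ℝ) * (d / 2))) *
            eLpNorm (localizedFourier χ (dyadicDilate k (annularPiece f n))) 2 volume))) +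
      C * halfBesovNorm ζ h *
        ((if m - n ≤ -2 then 2 ^ (((m - n : ℤ) : ℝ) * (d / 2 - α)) else 0) *
          ((if 1 ≤ n + k then 2 ^ (-(((n + k : ℤ) : ℝ) * 1)) else 0) *
            (2 ^ ((n : ℝ) * -α) * eLpNorm f 2 (volume.restrict (dyadicAnnulus d n))))) := by
  obtain ⟨C, κ, hκ, hC⟩ := hχ.exists_singleScale_le hρ hζ
  refine ⟨C, κ, fun h hh hs hB f m n k hg2 => ?_⟩
  have hgs : Function.support (dyadicDilate k (annularPiece f n)) ⊆ dyadicAnnulus d (n + k) := by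
    rw [dyadicDilate_annularPiece]
    exact support_annularPiece_subset _ _
  have hgG : eLpNorm (dyadicDilate k (annularPiece f n)) 2 volume =
      2 ^ ((k : ℝ) * (d / 2)) * eLpNorm f 2 (volume.restrict (dyadicAnnulus d n)) := by
    rw [dyadicDilate_annularPiece, eLpNorm_annularPiece, eLpNorm_dyadicDilate, add_sub_cancel_right]
  have hgi := integrable_of_support_subset_dyadicAnnulus hg2 hgs
  obtain ⟨-, -, h3, h4⟩ := hC h hh hs hB (n + k) _ hgi hg2 hgs
  set g := dyadicDilate k (annularPiece f n) with hg
  set L := eLpNorm (localizedFourier χ g) 2 volume with hL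
  set G := eLpNorm f 2 (volume.restrict (dyadicAnnulus d n)) with hG
  set B := halfBesovNorm ζ h with hBdef
  by_cases hmn : -1 ≤ m - n
  · rw [if_pos hmn, add_assoc]
    refine le_trans ?_ le_self_add
    calc 2 ^ ((m : ℝ) * -α) * (2 ^ (-((k : ℝ) * (d / 2))) *
          eLpNorm (singleScaleMaximal ρ β h g) 2 (volume.restrict (dyadicAnnulus d (m + k))))
        ≤ 2 ^ ((m : ℝ) * -α) * (2 ^ (-((k : ℝ) * (d / 2))) * (C * B * L)) := by
          gcongr
          exact (eLpNorm_mono_measure _ Measure.restrict_le_self).trans h3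
      _ = _ := by
          have : (2 : ℝ≥0∞) ^ ((m : ℝ) * -α) =
              2 ^ (-(((m - n : ℤ) : ℝ) * α)) * 2 ^ ((n : ℝ) * -α) := by
            rw [← two_rpow_add]; push_cast; congr 1; ring
          rw [this]
          ring
  · rw [if_neg hmn, if_pos (show m - n ≤ -2 by omega), zero_mul, mul_zero, zero_add]
    calc 2 ^ ((m : ℝ) * -α) * (2 ^ (-((k : ℝ) * (d / 2))) *
          eLpNorm (singleScaleMaximal ρ β h g) 2 (volume.restrict (dyadicAnnulus d (m + k))))
        ≤ 2 ^ ((m : ℝ) * -α) * (2 ^ (-((k : ℝ) * (d / 2))) *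
          (C * smoothingWeight d (m + k) * highFrequencySum ζ κ h (n + k) * L +
            C * (B * tailDecay d (n + k)) * 2 ^ (((m + k : ℤ) : ℝ) * (d / 2)) *
              eLpNorm g 2 volume)) := by
          gcongr
          exact h4 (m + k) (by omega)
      _ = _ := by
          rw [mul_add, mul_add, hgG]
          congr 1
          · have : (2 : ℝ≥0∞) ^ ((m : ℝ) * -α) = 2 ^ (-(((m + k : ℤ) : ℝ) * α)) *
                2 ^ (((n + k : ℤ) : ℝ) * α) * 2 ^ ((n : ℝ) * -α) := by
              rw [← two_rpow_add, ← two_rpow_add]; push_cast; congr 1; ring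
            rw [this]
            ring
          · by_cases hnk : 1 ≤ n + k
            · rw [tailDecay, if_pos hnk, if_pos hnk]
              calc _ = C * B * (2 ^ ((m : ℝ) * -α) * 2 ^ (-((k : ℝ) * (d / 2))) *
                    2 ^ (-(((n + k : ℤ) : ℝ) * (d / 2 + 1))) *
                    2 ^ (((m + k : ℤ) : ℝ) * (d / 2)) * 2 ^ ((k : ℝ) * (d / 2))) * G := by ring
                _ = C * B * (2 ^ (((m - n : ℤ) : ℝ) * (d / 2 - α)) *
                    2 ^ (-(((n + k : ℤ) : ℝ) * 1)) * 2 ^ ((n : ℝ) * -α)) * G := by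
                  simp only [← two_rpow_add]
                  congr 3
                  push_cast
                  ring
                _ = _ := by ring
            · rw [tailDecay, if_neg hnk, if_neg hnk]
              simp

/-- The estimate for the maximal function, with the exponent of the target space either equal to
the one of the source space or to `2`. -/
theorem IsHomogeneousDistance.exists_herzNorm_maximalFunction_le
    (hρ : IsHomogeneousDistance ρ β) (hζ : IsDyadicCutoff ζ) (hα : 1 / 2 < α)
    (hαd : α < (d : ℝ) / 2) (hq : 1 ≤ q) (hqs : q⁻¹ + s⁻¹ = 1) (hqp : q ≤ p) (hp : 2 ≤ p) :
    ∃ C : ℝ≥0, ∀ h : ℝ → ℂ, MemBesov ζ α s h → Function.support h ⊆ Ioo (1 / 2) 2 →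
      ∀ f : EuclideanSpace ℝ (Fin d) → ℂ, MemHerz (-α) 2 q f →
        (∀ t : ℝ, 0 < t → ∀ x : EuclideanSpace ℝ (Fin d),
          Integrable (fun y => multiplierKernel (quasiradial ρ h t) (x - y) * f y) volume) ∧
        MemHerz (-α) 2 p (maximalFunction ρ h f) ∧
        herzNorm (-α) 2 p (maximalFunction ρ h f) ≤
          C * besovNorm ζ α s h * herzNorm (-α) 2 q f := by
  -- `1/2 < α < d/2` excludes `d = 0`
  have hd : 0 < d := by
    rcases Nat.eq_zero_or_pos d with rfl | hd
    · norm_num at hαd; linarith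
    · exact hd
  have : Nonempty (Fin d) := ⟨⟨0, hd⟩⟩
  have hq0 : q ≠ 0 := (zero_lt_one.trans_le hq).ne'
  have hs1 : 1 ≤ s := one_le_of_inv_add_inv_eq_one hqs
  have hs0 : s ≠ 0 := (zero_lt_one.trans_le hs1).ne'
  have hα0 : 0 < α := by linarith
  obtain ⟨χ, r, R, hχ⟩ := hρ.exists_isFrequencyCutoff
  obtain ⟨C₁, κ, hC₁⟩ := hχ.exists_weighted_singleScale_le hρ hζ α
  obtain ⟨D, hD⟩ := hχ.exists_seqNorm_localizedFourier_le
  obtain ⟨C₂, hC₂⟩ := exists_seqNorm_highFrequencySum_le hα0 κ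
  obtain ⟨C₃, hC₃⟩ := exists_halfBesovNorm_le hα
  set w : ℤ → ℝ≥0∞ := fun i => if -1 ≤ i then 2 ^ (-((i : ℝ) * α)) else 0 with hw
  set w' : ℤ → ℝ≥0∞ := fun i => if i ≤ -2 then 2 ^ ((i : ℝ) * (d / 2 - α)) else 0 with hw'
  set v : ℤ → ℝ≥0∞ := fun i => smoothingWeight d i * 2 ^ (-((i : ℝ) * α)) with hv
  set e : ℤ → ℝ≥0∞ := fun i => if 1 ≤ i then 2 ^ (-((i : ℝ) * 1)) else 0 with he
  have hwt : ∑' i, w i < ∞ := tsum_ite_two_rpow_neg_mul_lt_top hα0 (-1)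
  have hwt' : ∑' i, w' i < ∞ := tsum_ite_two_rpow_mul_lt_top (sub_pos.2 hαd) (-2)
  have hvt : ∑' i, v i < ∞ := tsum_smoothingWeight_mul_lt_top hα hαd
  have het : seqNorm 2 e < ∞ := by
    refine (seqNorm_antitone one_ne_zero one_le_two e).trans_lt ?_
    rw [seqNorm_one]
    exact tsum_ite_two_rpow_neg_mul_lt_top one_pos 1
  set K : ℝ≥0∞ := C₁ * C₃ * (∑' i, w i) * D + C₁ * (∑' i, v i) * C₂ * D +
    C₁ * C₃ * (∑' i, w' i) * seqNorm 2 e with hK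
  have hKt : K ≠ ∞ := by rw [hK]; finiteness
  refine ⟨K.toNNReal, fun h hh hs f hf => ?_⟩
  have hB := hh.halfBesovNorm_lt_top hα hs0
  have hhi := integrable_of_memLp_of_support_subset hh.1 hs
  have hpiece : ∀ k n, MemLp (dyadicDilate k (annularPiece f n)) 2 := fun k n => by
    rw [dyadicDilate_annularPiece]
    exact (hf.dyadicDilate k).memLp_annularPiece hq0 _
  have hpiecei : ∀ k n, Integrable (dyadicDilate k (annularPiece f n)) := fun k n => by
    rw [dyadicDilate_annularPiece]
    exact (hf.dyadicDilate k).integrable_annularPiece hq0 _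
  have hSm : ∀ k n, Measurable
      (singleScaleMaximal ρ β h (dyadicDilate k (annularPiece f n))) := fun k n =>
    (lowerSemicontinuous_singleScaleMaximal fun t ht => continuous_fourierMultiplier
      (hχ.integrable_quasiradial hρ hhi hs (hζ.integrable_fourier hhi hB) ht)
      (hpiecei k n)).measurable
  have hSkm : ∀ k, Measurable (singleScaleMaximal ρ β h (dyadicDilate k f)) := fun k =>
    (lowerSemicontinuous_singleScaleMaximal fun t ht => (hρ.fourierMultiplier_annularPiece hζ hα
      hαd hq0 hqs hh hs (hf.dyadicDilate k) ht).2.2).measurable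
  -- `a n` is the weighted norm of `f` on the `n`-th annulus, `A k n` the part of it at the
  -- frequencies of size `2^k`, and `O m k` the weighted norm on the `m`-th annulus of the maximal
  -- function over the `k`-th dilation block
  set a : ℤ → ℝ≥0∞ := fun n => 2 ^ ((n : ℝ) * -α) *
    eLpNorm f 2 (volume.restrict (dyadicAnnulus d n)) with ha
  set A : ℤ → ℤ → ℝ≥0∞ := fun k n => 2 ^ ((n : ℝ) * -α) * (2 ^ (-((k : ℝ) * (d / 2))) *
    eLpNorm (localizedFourier χ (dyadicDilate k (annularPiece f n))) 2 volume) with hA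
  set O : ℤ → ℤ → ℝ≥0∞ := fun m k => 2 ^ ((m : ℝ) * -α) * (2 ^ (-((k : ℝ) * (d / 2))) *
    eLpNorm (singleScaleMaximal ρ β h (dyadicDilate k f)) 2
      (volume.restrict (dyadicAnnulus d (m + k)))) with hO
  set c : ℤ → ℝ≥0∞ := fun i => 2 ^ ((i : ℝ) * α) * highFrequencySum ζ κ h i with hc
  set B := halfBesovNorm ζ h with hBdef
  have hAD : ∀ n, seqNorm 2 (fun k => A k n) ≤ D * a n := fun n => by
    simp only [hA, ha]
    rw [seqNorm_const_mul, mul_left_comm, ← eLpNorm_annularPiece]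
    gcongr
    exact hD _ (hf.integrable_annularPiece hq0 n) (hf.memLp_annularPiece hq0 n)
  have hOle : ∀ m k, O m k ≤ (C₁ * B) * ∑' n, w (m - n) * A k n +
      (C₁ * v (m + k)) * ∑' n, c (n + k) * A k n +
      (C₁ * B) * ∑' n, w' (m - n) * (e (n + k) * a n) := by
    intro m k
    have h1 : eLpNorm (singleScaleMaximal ρ β h (dyadicDilate k f)) 2
        (volume.restrict (dyadicAnnulus d (m + k))) ≤
        ∑' n, eLpNorm (singleScaleMaximal ρ β h (dyadicDilate k (annularPiece f n))) 2
          (volume.restrict (dyadicAnnulus d (m + k))) := by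
      refine le_trans (eLpNorm_mono_enorm fun x => ?_)
        (eLpNorm_tsum_le (fun n => (hSm k n).aemeasurable) one_le_two)
      simp only [enorm_eq_self, dyadicDilate_annularPiece]
      exact (hρ.singleScaleMaximal_le_tsum hζ hα hαd hq0 hqs hh hs (hf.dyadicDilate k)
        x).trans_eq ((Equiv.addRight k).tsum_eq fun n =>
          singleScaleMaximal ρ β h (annularPiece (dyadicDilate k f) n) x).symm
    simp only [hO]
    refine (mul_le_mul' le_rfl (mul_le_mul' le_rfl h1)).trans ?_
    simp only [← ENNReal.tsum_mul_left]
    rw [← ENNReal.tsum_add, ← ENNReal.tsum_add]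
    exact ENNReal.tsum_le_tsum fun n => hC₁ h hhi hs hB f m n k (hpiece k n)
  have hmain := seqNorm_seqNorm_two_le (B := C₁ * B) (w := w) (w' := w')
    (v := fun i => C₁ * v i) (c := c) (e := e) hq hqp hp hqs hAD hOle
  have hle : herzNorm (-α) 2 p (maximalFunction ρ h f) ≤
      K * besovNorm ζ α s h * herzNorm (-α) 2 q f := by
    calc herzNorm (-α) 2 p (maximalFunction ρ h f)
        ≤ seqNorm p fun m => seqNorm 2 (O m) := by
          refine seqNorm_mono fun m => ?_
          simp only [hO]
          rw [seqNorm_const_mul]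
          gcongr
          simp only [← eLpNorm_comp_two_zpow_smul]
          refine le_trans (eLpNorm_mono_enorm fun x => ?_) (eLpNorm_iSup_le fun k =>
            ((hSkm k).comp (measurable_const_smul ((2 : ℝ) ^ k))).aemeasurable)
          exact hρ.maximalFunction_le_iSup h f x
      _ ≤ _ := hmain
      _ ≤ (C₁ * (C₃ * besovNorm ζ α s h) * (∑' i, w i) * D +
            (C₁ * ∑' i, v i) * (C₂ * besovNorm ζ α s h) * D +
            C₁ * (C₃ * besovNorm ζ α s h) * (∑' i, w' i) * seqNorm 2 e) * seqNorm q a := by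
          rw [ENNReal.tsum_mul_left]
          gcongr
          · exact hC₃ ζ s h hs0
          · exact hC₂ ζ h s hs1
          · exact hC₃ ζ s h hs0
      _ = K * besovNorm ζ α s h * seqNorm q a := by rw [hK]; ring
      _ = _ := rfl
  rw [ENNReal.coe_toNNReal hKt]
  refine ⟨fun t ht x => hρ.integrable_kernel_mul_of_memHerz hζ hα hαd hq0 hqs hh hs hf ht x,
    ⟨(hρ.measurable_maximalFunction hζ hα hαd hq0 hqs hh hs hf).aestronglyMeasurable, ?_⟩, hle⟩
  exact hle.trans_lt (ENNReal.mul_lt_top (ENNReal.mul_lt_top hKt.lt_top hh.2) hf.2)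

end Maximal

theorem theorem1p2 {d : ℕ} {ρ : EuclideanSpace ℝ (Fin d) → ℝ} {β : ℝ}
    (hρ : IsHomogeneousDistance ρ β) {ζ : ℝ → ℝ} (hζ : IsDyadicCutoff ζ)
    {α : ℝ} (hα : 1 / 2 < α) (hαd : α < (d : ℝ) / 2)
    {q s : ℝ≥0∞} (hq : 1 ≤ q) (hqs : q⁻¹ + s⁻¹ = 1) :
    (2 ≤ q → ∃ C : ℝ≥0, ∀ h : ℝ → ℂ, MemBesov ζ α s h →
      Function.support h ⊆ Ioo (1 / 2) 2 →
      ∀ f : EuclideanSpace ℝ (Fin d) → ℂ, MemHerz (-α) 2 q f →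
        (∀ t : ℝ, 0 < t → ∀ x : EuclideanSpace ℝ (Fin d),
          Integrable (fun y => multiplierKernel (quasiradial ρ h t) (x - y) * f y) volume) ∧
        MemHerz (-α) 2 q (maximalFunction ρ h f) ∧
        herzNorm (-α) 2 q (maximalFunction ρ h f) ≤
          C * besovNorm ζ α s h * herzNorm (-α) 2 q f) ∧
    (q ≤ 2 → ∃ C : ℝ≥0, ∀ h : ℝ → ℂ, MemBesov ζ α s h →
      Function.support h ⊆ Ioo (1 / 2) 2 →
      ∀ f : EuclideanSpace ℝ (Fin d) → ℂ, MemHerz (-α) 2 q f →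
        (∀ t : ℝ, 0 < t → ∀ x : EuclideanSpace ℝ (Fin d),
          Integrable (fun y => multiplierKernel (quasiradial ρ h t) (x - y) * f y) volume) ∧
        MemHerz (-α) 2 2 (maximalFunction ρ h f) ∧
        herzNorm (-α) 2 2 (maximalFunction ρ h f) ≤
          C * besovNorm ζ α s h * herzNorm (-α) 2 q f) :=
  ⟨fun hq2 => hρ.exists_herzNorm_maximalFunction_le hζ hα hαd hq hqs le_rfl hq2,
    fun hq2 => hρ.exists_herzNorm_maximalFunction_le hζ hα hαd hq hqs hq2 le_rfl⟩
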